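/- Let $r \ge 0$, fix a global monomial ordering (a well-ordering compatible with multiplication) on the monomials in $X_0,\dots,X_r$, and let $\Gamma \subset \mathbb{P}^r_{\mathbb{Q}}$ be an integral, non-degenerate (i.e. not contained in a hyperplane) projective curve with homogeneous ideal $I(\Gamma) \subset \mathbb{Q}[X_0,\dots,X_r]$. Notation. For a ring $A$ let $\overline A$ be its normalization (integral closure in its total ring of fractions) and $\mathcal{C}_A = \{a \in A \mid a\overline A \subset A\}$ its conductor. For an integral non-degenerate projective curve $\Gamma \subset \mathbb{P}^r_k$ over a field $k$, the Gorenstein adjoint ideal $\mathfrak{G}(\Gamma)$ is the largest homogeneous ideal $J \subset k[X_0,\dots,X_r]$ whose image $J_P$ in $\mathcal{O}_{\Gamma,P}$ equals $\mathcal{C}_{\mathcal{O}_{\Gamma,P}}$ for every singular point $P$ of $\Gamma$. For an ideal $J \subset \mathbb{Q}[X_0,\dots,X_r]$ and a prime $p$, let $J_p \subset \mathbb{F}_p[X_0,\dots,X_r]$ be the ideal generated by the reductions modulo $p$ of the elements of $J \cap \mathbb{Z}[X_0,\dots,X_r]$. If $I(\Gamma)_p$ is the homogeneous prime ideal of an integral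 non-degenerate curve in $\mathbb{P}^r_{\mathbb{F}_p}$, write $\Gamma_p$ for this curve and say that $\Gamma_p$ is defined. In this case $p$ is called lucky if (L1) $\mathfrak{G}(\Gamma)_p = \mathfrak{G}(\Gamma_p)$, and (L2) the reduced Gröbner bases of $\mathfrak{G}(\Gamma)$ and of $\mathfrak{G}(\Gamma_p)$ have the same set of leading monomials. Lemma. All but finitely many of the primes $p$ for which $\Gamma_p$ is defined are lucky. Moreover, if $\Gamma$ is geometrically integral, then for all but finitely many primes $p$ the curve $\Gamma_p$ is defined and $p$ is lucky. -/

import Mathlib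

namespace AdjointCurve

noncomputable section

open MvPolynomial

attribute [local instance] MvPolynomial.gradedAlgebra

/-- The standard grading of the homogeneous coordinate ring `k[X₀, …, X_r]` of `ℙ^r`. -/
abbrev grading (r : ℕ) (k : Type*) [Field k] :
    ℕ → Submodule k (MvPolynomial (Fin (r + 1)) k) :=
  homogeneousSubmodule (Fin (r + 1)) k

/-- `I` is the homogeneous ideal `I(Γ)` of an integral, non-degenerate projective curve
`Γ ⊆ ℙ^r` over `k`: it is a homogeneous prime ideal, the projective dimension of `Γ` is one
(so that the affine cone, that is, the homogeneous coordinate ring, has dimension two), and no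
hyperplane contains `Γ`. -/
structure IsCurveIdeal {r : ℕ} {k : Type*} [Field k]
    (I : Ideal (MvPolynomial (Fin (r + 1)) k)) : Prop where
  isHomogeneous : I.IsHomogeneous (grading r k)
  isPrime : I.IsPrime
  ringKrullDim_eq_two : ringKrullDim (MvPolynomial (Fin (r + 1)) k ⧸ I) = 2
  nondegenerate : ∀ l ∈ I, l.IsHomogeneous 1 → l = 0

/-- The curve over `k` with homogeneous ideal `I` is geometrically integral: it stays integral
over an algebraic closure of `k`. -/
def IsGeometricallyIntegral {r : ℕ} {k : Type*} [Field k]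
    (I : Ideal (MvPolynomial (Fin (r + 1)) k)) : Prop :=
  (I.map (MvPolynomial.map (algebraMap k (AlgebraicClosure k)))).IsPrime

/-- The local ring `𝒪_{ℙ^r, P}` of projective space at the (scheme-theoretic) point `P`. -/
abbrev ambientLocalRing {r : ℕ} {k : Type*} [Field k]
    (P : ProjectiveSpectrum (grading r k)) : Type _ :=
  HomogeneousLocalization.AtPrime (grading r k) P.asHomogeneousIdeal.toIdeal

/-- The stalk at `P` of the ideal sheaf on `ℙ^r` associated with the homogeneous ideal `J`: all
fractions of degree zero that lie in the extension of `J` to the localization at `P`. -/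
def idealAt {r : ℕ} {k : Type*} [Field k]
    (J : Ideal (MvPolynomial (Fin (r + 1)) k)) (P : ProjectiveSpectrum (grading r k)) :
    Ideal (ambientLocalRing P) :=
  (J.map (algebraMap (MvPolynomial (Fin (r + 1)) k)
    (Localization.AtPrime P.asHomogeneousIdeal.toIdeal))).comap
    (algebraMap (ambientLocalRing P) (Localization.AtPrime P.asHomogeneousIdeal.toIdeal))

/-- The local ring `𝒪_{Γ, P}` of the curve `Γ` with homogeneous ideal `I` at a point `P`. -/
abbrev localRing {r : ℕ} {k : Type*} [Field k]
    (I : Ideal (MvPolynomial (Fin (r + 1)) k)) (P : ProjectiveSpectrum (grading r k)) : Type _ :=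
  ambientLocalRing P ⧸ idealAt I P

/-- The ideal `J_P` of `𝒪_{Γ, P}` given by a homogeneous ideal `J` of `k[X₀, …, X_r]`. -/
def localIdeal {r : ℕ} {k : Type*} [Field k]
    (I J : Ideal (MvPolynomial (Fin (r + 1)) k)) (P : ProjectiveSpectrum (grading r k)) :
    Ideal (localRing I P) :=
  (idealAt J P).map (Ideal.Quotient.mk (idealAt I P))

/-- The conductor `𝒞_A = {a ∈ A | a Ā ⊆ A}` of a ring `A` in its normalization `Ā`, the integral
closure of `A` in its total ring of fractions. -/
def conductorIdeal (A : Type*) [CommRing A] : Ideal A where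
  carrier := {a | ∀ b ∈ integralClosure A (FractionRing A),
    ∃ c : A, algebraMap A (FractionRing A) c = algebraMap A (FractionRing A) a * b}
  zero_mem' := fun b _ => ⟨0, by simp⟩
  add_mem' := by
    intro a a' ha ha' b hb
    obtain ⟨c, hc⟩ := ha b hb
    obtain ⟨c', hc'⟩ := ha' b hb
    exact ⟨c + c', by rw [map_add, map_add, hc, hc', add_mul]⟩
  smul_mem' := by
    intro x a ha b hb
    obtain ⟨c, hc⟩ := ha b hb
    exact ⟨x * c, by rw [smul_eq_mul, map_mul, map_mul, hc, mul_assoc]⟩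

/-- The singular locus of the curve with homogeneous ideal `I`: the points of the curve whose
local ring is not regular. -/
def singularLocus {r : ℕ} {k : Type*} [Field k]
    (I : Ideal (MvPolynomial (Fin (r + 1)) k)) : Set (ProjectiveSpectrum (grading r k)) :=
  {P | P ∈ ProjectiveSpectrum.zeroLocus (grading r k) (I : Set (MvPolynomial (Fin (r + 1)) k)) ∧
    ¬ IsRegularLocalRing (localRing I P)}

/-- The Gorenstein adjoint ideal `𝔊(Γ)` of the curve `Γ` with homogeneous ideal `I`: the largest
homogeneous ideal `J` with `J_P = 𝒞_{𝒪_{Γ, P}}` for all singular points `P` of `Γ`. (A largest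
ideal of this kind is the supremum of all of them in the lattice of ideals.) -/
def gorensteinAdjointIdeal {r : ℕ} {k : Type*} [Field k]
    (I : Ideal (MvPolynomial (Fin (r + 1)) k)) : Ideal (MvPolynomial (Fin (r + 1)) k) :=
  sSup {J | J.IsHomogeneous (grading r k) ∧
    ∀ P ∈ singularLocus I, localIdeal I J P = conductorIdeal (localRing I P)}

/-- The reduction `J_p` modulo `p` of an ideal `J` of `ℚ[X]`: the ideal of `𝔽_p[X]` generated by
the residue classes of the elements of `J₀ = J ∩ ℤ[X]`. -/
def reduction {σ : Type*} (p : ℕ) (J : Ideal (MvPolynomial σ ℚ)) :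
    Ideal (MvPolynomial σ (ZMod p)) :=
  (J.comap (MvPolynomial.map (Int.castRingHom ℚ))).map (MvPolynomial.map (Int.castRingHom (ZMod p)))

/-- `G` is the reduced Gröbner basis of the ideal `J` with respect to the (global) monomial
ordering `m`. Monomials are identified with their exponent vectors, ordered componentwise by
divisibility; `m.degree f` is the leading monomial of `f`. -/
structure IsReducedGroebnerBasis {σ k : Type*} [Field k] (m : MonomialOrder σ)
    (J : Ideal (MvPolynomial σ k)) (G : Set (MvPolynomial σ k)) : Prop where
  subset : G ⊆ J
  exists_degree_le : ∀ f ∈ J, f ≠ 0 → ∃ g ∈ G, m.degree g ≤ m.degree f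
  monic : ∀ g ∈ G, m.Monic g
  reduced : ∀ g ∈ G, ∀ h ∈ G, h ≠ g → ∀ c ∈ g.support, ¬ m.degree h ≤ c

/-- The prime `p` is lucky for the curve `Γ` over `ℚ` with homogeneous ideal `I` (and the monomial
ordering `m`): `𝔊(Γ)_p = 𝔊(Γ_p)`, and the reduced Gröbner bases `G₀` of `𝔊(Γ)` and `Gp` of
`𝔊(Γ_p)` have the same set of leading monomials. -/
def IsLucky {r : ℕ} (m : MonomialOrder (Fin (r + 1)))
    (I : Ideal (MvPolynomial (Fin (r + 1)) ℚ)) (p : ℕ) [Fact p.Prime] : Prop :=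
  reduction p (gorensteinAdjointIdeal I) = gorensteinAdjointIdeal (reduction p I) ∧
    ∃ (G₀ : Set (MvPolynomial (Fin (r + 1)) ℚ)) (Gp : Set (MvPolynomial (Fin (r + 1)) (ZMod p))),
      IsReducedGroebnerBasis m (gorensteinAdjointIdeal I) G₀ ∧
      IsReducedGroebnerBasis m (gorensteinAdjointIdeal (reduction p I)) Gp ∧
      m.degree '' G₀ = m.degree '' Gp

end

end AdjointCurve

/-! One principle drives the reduction arguments: a Noetherian module has no `p`-torsion for large
primes `p` (`eventually_torsionFree`). Applied to suitable cokernels and quotients of modules over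
finitely generated ℤ-algebras, it lets relations modulo `p` be lifted, so that kernels,
intersections and colon ideals commute with reduction modulo almost all `p`.

From local to global: the conductor commutes with localization and is the unit ideal at a regular
point, so `𝔊(Γ)` is the intersection, over the charts `X i = 1`, of the homogeneous cores of the
preimages of the chart conductors (`gorensteinAdjointIdeal_eq`). Intersections and these homogeneous
cores commute with reduction; the crux for (L1) is that the conductor of one chart does
(`eventually_chart`).

By Noether normalization the chart ring contains an order `S`, finite over `ℤ[X]`, whose quotient `S
/ p` is the reduced chart ring for almost all `p`. If `B` is the normalization of `S`, then the
conductor of `S` is the annihilator of `B / S`, hence the kernel of a map from `S` to a power of `B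
/ S`, and such kernels reduce well. It remains to see that `B / p` is still normal
(`eventually_isIntegrallyClosed`). By Grauert and Remmert this can be tested on the radical `J` of a
common denominator `d`: every `w / d` that maps `J` into itself must lie in the ring. The element `d
= F'(y)`, for the minimal polynomial `F` of a primitive element `y`, is a denominator over ℤ and
modulo `p` alike, by the trace form. The ideal `J` stays radical because the generators of `B / J`
satisfy separable equations over ℚ, which stay separable modulo almost all `p`. The last condition
concerns a colon ideal, and the torsion principle applies.

For (L2), let `p` divide no leading coefficient of fixed integral lifts for the finitely many
minimal leading monomials of `J`. Then `J` and `J_p` have the same leading monomials, and the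
minimal ones are those of the reduced Gröbner basis.

If `Γ` is geometrically integral, an order in its homogeneous coordinate ring is generated
birationally by an element `y` whose minimal polynomial over `ℤ[Y]` is irreducible over `ℚ̄[Y]`. The
factorizations of a given shape form a scheme of finite type over ℤ; having no points over `ℚ̄`, it
has none over `𝔽_p` for large `p`. So the polynomial stays irreducible, and the reduction is a
domain of the same dimension. -/

namespace AdjointCurve

open Polynomial Filter

/-! ### Torsion, a normality criterion, common denominators and reducedness -/

/-- A Noetherian module has no `p`-torsion for almost all primes `p`. -/
theorem eventually_torsionFree (R M : Type*) [CommRing R] [AddCommGroup M] [Module R M]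
    [IsNoetherian R M] :
    ∀ᶠ p : ℕ in atTop, p.Prime → ∀ x : M, (p : ℕ) • x = 0 → x = 0 := by
  -- The kernels of `n!` form an ascending chain, which becomes stationary at some `n`. An element
  -- killed by a prime `p > n` is killed by `p!`, hence by `n!`, which is coprime to `p`.
  let T : ℕ →o Submodule R M :=
    { toFun := fun n => LinearMap.ker (n.factorial • (LinearMap.id : M →ₗ[R] M))
      monotone' := by
        intro a b hab x hx
        obtain ⟨c, hc⟩ := Nat.factorial_dvd_factorial hab
        simp only [LinearMap.mem_ker, LinearMap.smul_apply, LinearMap.id_apply] at hx ⊢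
        rw [hc, mul_comm, mul_smul, hx, smul_zero] }
  obtain ⟨n, hn⟩ := monotone_stabilizes_iff_noetherian.mpr ‹IsNoetherian R M› T
  filter_upwards [eventually_gt_atTop n] with p hp hprime x hx
  have h1 : x ∈ T p := by
    obtain ⟨c, hc⟩ := Nat.dvd_factorial hprime.pos le_rfl
    change p.factorial • x = 0
    rw [hc, mul_comm, mul_smul, hx, smul_zero]
  rw [← hn p hp.le] at h1
  have h2 : n.factorial • x = 0 := h1
  have hcop : Nat.Coprime p n.factorial :=
    (Nat.Prime.coprime_iff_not_dvd hprime).mpr fun h => by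
      have := (Nat.Prime.dvd_factorial hprime).mp h
      omega
  have h3 : addOrderOf x ∣ 1 := by
    rw [← hcop]
    exact Nat.dvd_gcd (addOrderOf_dvd_of_nsmul_eq_zero hx) (addOrderOf_dvd_of_nsmul_eq_zero h2)
  exact AddMonoid.addOrderOf_eq_one_iff.mp (Nat.dvd_one.mp h3)

/-- A form of the Grauert–Remmert criterion for normality. -/
theorem isIntegrallyClosed_of_colon {B : Type*} [CommRing B] [IsDomain B]
    {d : B} (hd : d ≠ 0) {J : Ideal B} (hJ : J.IsRadical) {n : ℕ} (hJn : J ^ n ≤ Ideal.span {d})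
    (hden : ∀ z : FractionRing B, IsIntegral B z →
      ∃ b, algebraMap B (FractionRing B) b = algebraMap B (FractionRing B) d * z)
    (hcol : ∀ w, (∀ j ∈ J, ∃ j' ∈ J, w * j = d * j') → d ∣ w) : IsIntegrallyClosed B := by
  let K := FractionRing B
  have hinj : Function.Injective (algebraMap B K) := IsFractionRing.injective B K
  have hdK : algebraMap B K d ≠ 0 := fun h => hd (hinj (by rw [h, map_zero]))
  -- If `zJ ⊆ B`, then even `zJ ⊆ J` because `J` is radical; so `w = dz` satisfies `wJ ⊆ dJ`, and
  -- the colon condition gives `z ∈ B`.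
  have step : ∀ z : K, IsIntegral B z →
      (∀ j ∈ J, ∃ b, algebraMap B K b = algebraMap B K j * z) → ∃ b, algebraMap B K b = z := by
    intro z hz hzJ
    have hmem : ∀ j ∈ J, ∃ b ∈ J, algebraMap B K b = algebraMap B K j * z := by
      intro j hj
      obtain ⟨b, hb⟩ := hzJ j hj
      refine ⟨b, ?_, hb⟩
      obtain ⟨q, hq, hqz⟩ := hz
      -- Scaling the roots of an integral equation of `z` by `j` gives one for `b = jz` whose lower
      -- coefficients are multiples of `j`. Thus a power of `b` lies in `J`.
      have h1 : aeval (algebraMap B K b) (scaleRoots q j) = 0 := by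
        rw [hb]
        exact scaleRoots_aeval_eq_zero hqz
      have h2 : eval b (scaleRoots q j) = 0 := by
        apply hinj
        rw [map_zero, ← h1, aeval_algebraMap_apply, coe_aeval_eq_eval]
      rw [eval_eq_sum_range, natDegree_scaleRoots, Finset.sum_range_succ,
        coeff_scaleRoots_natDegree, hq.leadingCoeff, one_mul] at h2
      refine hJ ⟨q.natDegree, ?_⟩
      rw [eq_neg_of_add_eq_zero_right h2]
      refine J.neg_mem (J.sum_mem fun i hi => J.mul_mem_right _ ?_)
      rw [coeff_scaleRoots]
      refine J.mul_mem_left _ (J.pow_mem_of_mem hj _ ?_)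
      have := Finset.mem_range.mp hi
      omega
    obtain ⟨w, hw⟩ := hden z hz
    obtain ⟨b, rfl⟩ : d ∣ w := by
      refine hcol w fun j hj => ?_
      obtain ⟨b, hbJ, hb⟩ := hmem j hj
      refine ⟨b, hbJ, hinj ?_⟩
      rw [map_mul, map_mul, hw, hb]
      ring
    exact ⟨b, mul_left_cancel₀ hdK (by rw [← hw, map_mul])⟩
  -- Descent on the power: if `J ^ (m + 1) * z ⊆ B`, then for `j ∈ J ^ m` the integral element `jz`
  -- multiplies `J` into `B`, so it already lies in `B`. The descent starts at `J ^ n ⊆ (d)`, since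
  -- `dz ∈ B`.
  have main : ∀ m : ℕ, ∀ z : K, IsIntegral B z →
      (∀ j ∈ J ^ m, ∃ b, algebraMap B K b = algebraMap B K j * z) →
      ∃ b, algebraMap B K b = z := by
    intro m
    induction m with
    | zero =>
      intro z _ h
      obtain ⟨b, hb⟩ := h 1 (by simp)
      exact ⟨b, by rw [hb, map_one, one_mul]⟩
    | succ m ih =>
      intro z hz h
      refine ih z hz fun j hj => step _ (isIntegral_algebraMap.mul hz) fun i hi => ?_
      obtain ⟨b, hb⟩ := h (j * i) (by rw [pow_succ]; exact Ideal.mul_mem_mul hj hi)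
      exact ⟨b, by rw [hb, map_mul]; ring⟩
  refine (isIntegrallyClosed_iff K).mpr fun {z} hz => main n z hz fun j hj => ?_
  obtain ⟨c, rfl⟩ := Ideal.mem_span_singleton.mp (hJn hj)
  obtain ⟨b, hb⟩ := hden z hz
  exact ⟨c * b, by rw [map_mul, map_mul, hb]; ring⟩

/-- If `y` is a root of the monic polynomial `F`, then `F'(y)` is a common denominator for the
elements of `K(y)` that are integral over `R`. -/
theorem derivative_mul_mem_adjoin (R K : Type*) {L : Type*} [CommRing R] [IsDomain R]
    [IsIntegrallyClosed R] [Field K] [Algebra R K] [IsFractionRing R K] [Field L] [Algebra R L]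
    [Algebra K L] [IsScalarTower R K L] {y : L} {F : R[X]} (hF : F.Monic) (hFy : aeval y F = 0)
    (hF' : aeval y (derivative F) ≠ 0) (htop : Algebra.adjoin K {y} = ⊤) {z : L}
    (hz : IsIntegral R z) : aeval y (derivative F) * z ∈ Algebra.adjoin R {y} := by
  have hy : IsIntegral R y := ⟨F, hF, hFy⟩
  have hyK : IsIntegral K y := hy.tower_top
  have : FaithfulSMul R L := (faithfulSMul_iff_algebraMap_injective R L).mpr <| by
    rw [IsScalarTower.algebraMap_eq R K L]
    exact (algebraMap K L).injective.comp (IsFractionRing.injective R K)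
  -- With `F = G * H` and `G(y) = 0` one gets `F'(y) = G'(y) H(y)`. So `G'(y) ≠ 0`, which makes the
  -- extension separable in any characteristic, and it suffices to treat `G'(y)`.
  obtain ⟨H, hH⟩ := minpoly.isIntegrallyClosed_dvd hy hFy
  set G := minpoly R y with hG
  have hGK : minpoly K y = G.map (algebraMap R K) :=
    minpoly.isIntegrallyClosed_eq_field_fractions' K hy
  have hder : aeval y (derivative F) = aeval y (derivative G) * aeval y H := by
    rw [hH, derivative_mul, map_add, map_mul, map_mul, minpoly.aeval, zero_mul, add_zero]
  have hGy : aeval y (derivative (minpoly K y)) = aeval y (derivative G) := by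
    rw [hGK, derivative_map, aeval_map_algebraMap]
  have hG0 : aeval y (derivative G) ≠ 0 := fun h => hF' (by rw [hder, h, zero_mul])
  have hsep : (minpoly K y).Separable := by
    rw [separable_iff_derivative_ne_zero (minpoly.irreducible hyK)]
    intro h
    rw [h, map_zero] at hGy
    exact hG0 hGy.symm
  have htop' : IntermediateField.adjoin K {y} = ⊤ := by
    apply IntermediateField.toSubalgebra_injective
    rw [IntermediateField.adjoin_simple_toSubalgebra_of_isAlgebraic hyK.isAlgebraic, htop]
    rfl
  have hfin : FiniteDimensional K L := by
    have := IntermediateField.adjoin.finiteDimensional hyK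
    rw [htop'] at this
    exact Module.Finite.equiv (IntermediateField.topEquiv (F := K) (E := L)).toLinearEquiv
  have hsepL : Algebra.IsSeparable K L := by
    have h := (IntermediateField.isSeparable_adjoin_simple_iff_isSeparable K L).mpr hsep
    rw [htop'] at h
    exact Algebra.IsSeparable.of_algHom K _
      (IntermediateField.topEquiv (F := K) (E := L)).symm.toAlgHom
  -- Euler's formula: the dual of `R[y]` under the trace form is `G'(y)⁻¹ R[y]`. It contains every
  -- integral `z`, because traces of integral elements lie in the integrally closed ring `R`.
  have hdual := traceForm_dualSubmodule_adjoin R K htop hy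
  have hzdual : z ∈ (Algebra.traceForm K L).dualSubmodule
      (Subalgebra.toSubmodule (Algebra.adjoin R {y})) := by
    intro w hw
    have hwint : IsIntegral R w :=
      (_root_.adjoin_le_integralClosure hy) hw
    rw [Algebra.traceForm_apply, Submodule.mem_one]
    obtain ⟨c, hc⟩ := IsIntegrallyClosed.algebraMap_eq_of_integral
      (Algebra.isIntegral_trace (L := K) (hz.mul hwint))
    exact ⟨c, hc⟩
  rw [hdual, Submodule.mem_smul_pointwise_iff_exists] at hzdual
  obtain ⟨u, hu, rfl⟩ := hzdual
  rw [hGy, hder, smul_eq_mul, mul_comm (aeval y (derivative G)), mul_assoc,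
    mul_inv_cancel_left₀ hG0]
  exact Subalgebra.mul_mem _ (aeval_mem_adjoin_singleton R y) hu

/-- An algebra over a field that is generated by roots of polynomials coprime to their derivative
is reduced. -/
theorem isReduced_of_adjoin_eq_top {k Q : Type*} [Field k] [CommRing Q] [Algebra k Q]
    {s : Set Q} (hs : s.Finite) (hadj : Algebra.adjoin k s = ⊤)
    (h : ∀ z ∈ s, ∃ g : k[X], aeval z g = 0 ∧ IsUnit (aeval z (derivative g))) :
    IsReduced Q := by
  have hft : Algebra.FiniteType k Q := ⟨⟨hs.toFinset, by simpa using hadj⟩⟩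
  -- From `g(z) = 0` follows `g'(z) dz = 0`, hence `dz = 0` for the generators. The algebra is
  -- therefore unramified over a field, and so reduced.
  have hD : KaehlerDifferential.D k Q = 0 := by
    refine Derivation.ext_of_adjoin_eq_top s hadj fun z hz => ?_
    obtain ⟨g, hg, hu⟩ := h z hz
    have h1 := Derivation.map_aeval (KaehlerDifferential.D k Q) g z
    rw [hg, map_zero] at h1
    obtain ⟨v, hv⟩ := hu.exists_left_inv
    calc KaehlerDifferential.D k Q z = (v * aeval z (derivative g)) • KaehlerDifferential.D k Q z := by
          rw [hv, one_smul]
      _ = 0 := by rw [mul_smul, ← h1, smul_zero]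
  have hsub : Subsingleton (Ω[Q⁄k]) := by
    have h2 := KaehlerDifferential.span_range_derivation k Q
    rw [hD] at h2
    have h3 : (⊥ : Submodule Q (Ω[Q⁄k])) = ⊤ := by
      rw [← h2]
      symm
      rw [Submodule.span_eq_bot]
      rintro _ ⟨x, rfl⟩
      rfl
    exact (Submodule.subsingleton_iff Q).mp (subsingleton_of_bot_eq_top h3)
  have : Algebra.FormallyUnramified k Q := ⟨hsub⟩
  exact Algebra.FormallyUnramified.isReduced_of_field k Q

end AdjointCurve

/-! ### Normality of the reductions of a normal order over `ℤ[X]` -/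

namespace AdjointCurve

open Polynomial Filter

/-- Clearing the denominators of a rational polynomial. -/
theorem exists_map_eq_smul (q : ℚ[X]) :
    ∃ n : ℤ, n ≠ 0 ∧ ∃ P : ℤ[X], P.map (Int.castRingHom ℚ) = (n : ℚ) • q := by
  obtain ⟨b, hb, h⟩ := IsLocalization.integerNormalization_spec (nonZeroDivisors ℤ) q
  refine ⟨b, nonZeroDivisors.ne_zero hb,
    IsLocalization.integerNormalization (nonZeroDivisors ℤ) q, ?_⟩
  exact h.trans (Int.cast_smul_eq_zsmul ℚ b q).symm

/-- In a domain that is integral over `ℤ[X]`, every element satisfies, modulo any nonzero element,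
an algebraic equation over `ℤ`. -/
theorem exists_aeval_mem_span {B : Type} [CommRing B] [IsDomain B] [Algebra ℤ[X] B]
    [Algebra.IsIntegral ℤ[X] B] [FaithfulSMul ℤ[X] B] {d : B} (hd : d ≠ 0) (z : B) :
    ∃ f : ℤ[X], f ≠ 0 ∧ aeval z f ∈ Ideal.span {d} := by
  have hZ : FaithfulSMul ℤ B := by
    rw [faithfulSMul_iff_algebraMap_injective, IsScalarTower.algebraMap_eq ℤ ℤ[X] B]
    exact (FaithfulSMul.algebraMap_injective ℤ[X] B).comp (C_injective)
  by_cases hz : IsAlgebraic ℤ z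
  · obtain ⟨f, hf, hfz⟩ := hz
    exact ⟨f, hf, by rw [hfz]; exact zero_mem _⟩
  -- If `z` is transcendental, it is a transcendence basis, as the transcendence degree is one. Then
  -- `d` is algebraic over `ℤ[z]`, so the ideal `(d)` meets `ℤ[z]` nontrivially.
  have htr : Algebra.trdeg ℤ B = 1 := by
    rw [← trdeg_add_eq ℤ ℤ[X] (A := B), Polynomial.trdeg_of_isDomain,
      trdeg_eq_zero, add_zero]
  have hind : AlgebraicIndependent ℤ (fun _ : Unit => z) :=
    algebraicIndependent_unique_type_iff.mpr hz
  have hb := AlgebraicIndependent.isTranscendenceBasis_of_trdeg_le_of_finite hind (by rw [htr]; simp)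
  have halg := hb.isAlgebraic
  have hne := Ideal.comap_ne_bot_of_algebraic_mem hd (Ideal.mem_span_singleton_self d)
    (halg.isAlgebraic d)
  obtain ⟨⟨a, ha⟩, haI, ha0⟩ := Submodule.exists_mem_ne_zero_of_ne_bot hne
  rw [Set.range_const, Algebra.adjoin_singleton_eq_range_aeval] at ha
  obtain ⟨f, rfl⟩ := ha
  refine ⟨f, ?_, haI⟩
  rintro rfl
  exact ha0 (Subtype.ext (map_zero _))

/-- In a reduced ring, an element that is algebraic over `ℤ` is a root of a polynomial that is
coprime to its derivative over `ℚ`. -/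
theorem exists_separable_eval₂_eq_zero {Q : Type*} [CommRing Q] [IsReduced Q] {z : Q} {f : ℤ[X]}
    (hf : f ≠ 0) (hfz : eval₂ (Int.castRingHom Q) z f = 0) :
    ∃ g u v : ℤ[X], ∃ n : ℤ, n ≠ 0 ∧ eval₂ (Int.castRingHom Q) z g = 0 ∧
      u * g + v * derivative g = C n := by
  have hinj : Function.Injective (Polynomial.map (Int.castRingHom ℚ)) :=
    map_injective _ Int.cast_injective
  have hf' : f.map (Int.castRingHom ℚ) ≠ 0 := fun h => hf (hinj (by rw [h, Polynomial.map_zero]))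
  -- The squarefree `y` satisfies `f ∣ y ^ k`, so its value at `z` is nilpotent, hence zero in a
  -- reduced ring. Over ℚ squarefree means separable, and the Bézout relation yields `u`, `v` and
  -- `n` after clearing denominators.
  obtain ⟨y, k, hy, -, q, hq⟩ := exists_squarefree_dvd_pow_of_ne_zero hf'
  obtain ⟨u₀, v₀, huv⟩ := PerfectField.separable_iff_squarefree.mpr hy
  obtain ⟨m, hm, G, hG⟩ := exists_map_eq_smul y
  obtain ⟨a, ha, U, hU⟩ := exists_map_eq_smul u₀
  obtain ⟨b, hb, V, hV⟩ := exists_map_eq_smul v₀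
  obtain ⟨c, hc, P, hP⟩ := exists_map_eq_smul q
  have h1 : C c * G ^ k = C (m ^ k) * (f * P) := by
    apply hinj
    simp only [Polynomial.map_mul, Polynomial.map_pow, hG, map_C, hP, smul_eq_C_mul, mul_pow, hq]
    simp only [eq_intCast, map_pow]
    ring
  have h2 : eval₂ (Int.castRingHom Q) z (C c * G) = 0 := by
    have h3 : eval₂ (Int.castRingHom Q) z (C c * G ^ k) = 0 := by
      rw [h1, eval₂_mul, eval₂_mul, hfz, zero_mul, mul_zero]
    refine IsNilpotent.eq_zero ⟨k + 1, ?_⟩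
    rw [← eval₂_pow, mul_pow, pow_succ, pow_succ, show C c ^ k * C c * (G ^ k * G) =
      C c * G ^ k * (C c ^ k * G) by ring, eval₂_mul, h3, zero_mul]
  refine ⟨C c * G, C b * U, C a * V, c * m * a * b, by positivity, h2, ?_⟩
  apply hinj
  simp only [Polynomial.map_mul, Polynomial.map_add, map_C, hU, hV, hG, smul_eq_C_mul,
    derivative_mul, derivative_C, zero_mul, zero_add, ← derivative_map]
  have : C (c * m * a * b : ℚ) = C (c * m * a * b : ℚ) * (u₀ * y + v₀ * derivative y) := by
    rw [huv, mul_one]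
  simp only [eq_intCast, Int.cast_mul]
  rw [this]
  simp only [map_mul]
  ring

section

attribute [local instance] FractionRing.liftAlgebra

/-- The fraction field of a finite extension of a domain of characteristic zero is generated by
one element of the extension. -/
theorem exists_adjoin_eq_top (R B : Type*) [CommRing R] [IsDomain R] [CharZero R] [CommRing B]
    [IsDomain B] [Algebra R B] [Module.Finite R B] [FaithfulSMul R B] :
    ∃ y : B, Algebra.adjoin (FractionRing R) {algebraMap B (FractionRing B) y} = ⊤ := by
  have : CharZero (FractionRing R) :=
    charZero_of_injective_algebraMap (IsFractionRing.injective R (FractionRing R))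
  have hloc : IsLocalization (Algebra.algebraMapSubmonoid B (nonZeroDivisors R))
      (FractionRing B) := inferInstance
  have hfin : FiniteDimensional (FractionRing R) (FractionRing B) :=
    .of_isLocalization R B (nonZeroDivisors R)
  obtain ⟨α, hα⟩ := Field.exists_primitive_element (FractionRing R) (FractionRing B)
  -- A primitive element can be written with a denominator from `R`; its numerator generates the
  -- same field.
  obtain ⟨y, ⟨_, c, hc, rfl⟩, rfl⟩ := IsLocalization.exists_mk'_eq
    (Algebra.algebraMapSubmonoid B (nonZeroDivisors R)) α
  refine ⟨y, ?_⟩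
  have hc0 : algebraMap R (FractionRing R) c ≠ 0 :=
    IsFractionRing.to_map_ne_zero_of_mem_nonZeroDivisors hc
  rw [← IntermediateField.adjoin_simple_toSubalgebra_of_isAlgebraic
    (Algebra.IsAlgebraic.isAlgebraic _), ← IntermediateField.top_toSubalgebra, ← hα]
  congr 1
  refine le_antisymm ?_ ?_ <;> rw [IntermediateField.adjoin_simple_le_iff]
  · rw [hα]; trivial
  · have h1 := IsLocalization.mk'_spec (FractionRing B) y
      (⟨algebraMap R B c, c, hc, rfl⟩ : Algebra.algebraMapSubmonoid B (nonZeroDivisors R))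
    set α := IsLocalization.mk' (FractionRing B) y
      (⟨algebraMap R B c, c, hc, rfl⟩ : Algebra.algebraMapSubmonoid B (nonZeroDivisors R))
    have h2 : α = (algebraMap R (FractionRing R) c)⁻¹ • algebraMap B (FractionRing B) y := by
      rw [← h1, Algebra.smul_def, map_inv₀, ← IsScalarTower.algebraMap_apply R (FractionRing R),
        IsScalarTower.algebraMap_apply R B (FractionRing B), mul_comm α, inv_mul_cancel_left₀]
      rw [← IsScalarTower.algebraMap_apply R B (FractionRing B),
        IsScalarTower.algebraMap_apply R (FractionRing R) (FractionRing B)]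
      exact (_root_.map_ne_zero _).mpr hc0
    rw [h2]
    exact IntermediateField.smul_mem _ (IntermediateField.mem_adjoin_simple_self _ _)

/-- A polynomial equation over `R` with nonvanishing derivative whose root generates the fraction
field. -/
theorem exists_monic_aeval_eq_zero (R B : Type*) [CommRing R] [IsDomain R] [CharZero R]
    [IsIntegrallyClosed R] [CommRing B] [IsDomain B] [Algebra R B] [Module.Finite R B]
    [FaithfulSMul R B] :
    ∃ (y : B) (F : R[X]), F.Monic ∧ aeval y F = 0 ∧ aeval y (derivative F) ≠ 0 ∧
      Algebra.adjoin (FractionRing R) {algebraMap B (FractionRing B) y} = ⊤ := by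
  obtain ⟨y, hy⟩ := exists_adjoin_eq_top R B
  have hint : IsIntegral R y := Algebra.IsIntegral.isIntegral y
  refine ⟨y, minpoly R y, minpoly.monic hint, minpoly.aeval _ _, ?_, hy⟩
  intro h
  -- The derivative has smaller degree than the minimal polynomial and is nonzero in characteristic
  -- zero, so it cannot vanish at `y`.
  have h1 := minpoly.IsIntegrallyClosed.degree_le_of_ne_zero (s := y) (p := derivative (minpoly R y)) ?_ h
  · exact absurd h1 (not_le.mpr (degree_derivative_lt (minpoly.ne_zero hint)))
  · intro h0
    exact (minpoly.natDegree_pos hint).ne' (derivative_eq_zero.mp h0)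

/-- The reductions of a normal domain that is finite over `ℤ[X]` have a common denominator for
the elements that are integral over them. -/
theorem exists_eventually_mul_mem {B : Type} [CommRing B] [IsDomain B] [Algebra ℤ[X] B]
    [Module.Finite ℤ[X] B] [FaithfulSMul ℤ[X] B] [IsIntegrallyClosed B] :
    ∃ d : B, d ≠ 0 ∧ ∀ᶠ p : ℕ in atTop, p.Prime → ∀ [IsDomain (B ⧸ Ideal.span {(p : B)})],
      ∀ z : FractionRing (B ⧸ Ideal.span {(p : B)}), IsIntegral (B ⧸ Ideal.span {(p : B)}) z →
        ∃ b : B ⧸ Ideal.span {(p : B)}, algebraMap _ (FractionRing (B ⧸ Ideal.span {(p : B)})) b =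
          algebraMap _ _ (Ideal.Quotient.mk (Ideal.span {(p : B)}) d) * z := by
  obtain ⟨y, F, hF, hFy, hF', htop⟩ := exists_monic_aeval_eq_zero ℤ[X] B
  have hN : IsNoetherianRing B := isNoetherian_of_tower ℤ[X] inferInstance
  set d := aeval y (derivative F) with hd
  -- The inclusion `dB ⊆ ℤ[X][y]`, which can be reduced modulo `p`, shows below that `y` still
  -- generates the fraction field of `B / p`.
  have hdB : ∀ b : B, d * b ∈ Algebra.adjoin ℤ[X] {y} := by
    intro b
    have h1 := derivative_mul_mem_adjoin ℤ[X] (FractionRing ℤ[X]) (y := algebraMap B (FractionRing B) y)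
      (z := algebraMap B (FractionRing B) b) hF
      (by rw [aeval_algebraMap_apply, hFy, map_zero])
      (by
        rw [aeval_algebraMap_apply]
        exact fun h => hF' (IsFractionRing.injective B (FractionRing B) (by rw [h, map_zero])))
      htop ((Algebra.IsIntegral.isIntegral b).algebraMap)
    rw [aeval_algebraMap_apply, ← map_mul, ← Set.image_singleton] at h1
    rw [← IsScalarTower.coe_toAlgHom' ℤ[X] B (FractionRing B), ← AlgHom.map_adjoin] at h1
    obtain ⟨x, hx, hxe⟩ := h1
    rwa [← IsFractionRing.injective B (FractionRing B) hxe]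
  refine ⟨d, hF', ?_⟩
  -- Absence of torsion in `B / dB` keeps `d` nonzero modulo `p`; absence of torsion in `B / ℤ[X]`
  -- keeps `𝔽_p[X] → B / p` injective.
  filter_upwards [eventually_torsionFree B (B ⧸ Ideal.span {d}),
    eventually_torsionFree ℤ[X] (B ⧸ LinearMap.range (Algebra.linearMap ℤ[X] B))] with p h1 h2 hp hdom
  have : Fact p.Prime := ⟨hp⟩
  set P := Ideal.span {(p : B)} with hP
  intro z hz
  have hchar : CharP (B ⧸ P) p := by
    rw [CharP.charP_iff_prime_eq_zero hp, ← map_natCast (Ideal.Quotient.mk P)]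
    exact Ideal.Quotient.eq_zero_iff_mem.mpr (Ideal.mem_span_singleton_self _)
  have hd0 : Ideal.Quotient.mk P d ≠ 0 := by
    intro h
    rw [Ideal.Quotient.eq_zero_iff_mem, hP, Ideal.mem_span_singleton] at h
    obtain ⟨b, hb⟩ := h
    have h6 : b ∈ Ideal.span {d} := by
      rw [← Ideal.Quotient.eq_zero_iff_mem]
      refine h1 hp _ ?_
      rw [← map_nsmul, nsmul_eq_mul, Ideal.Quotient.eq_zero_iff_mem, ← hb]
      exact Ideal.mem_span_singleton_self d
    obtain ⟨e, rfl⟩ := Ideal.mem_span_singleton.mp h6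
    have h7 : (p : B) * e = 1 := mul_left_cancel₀ hF' (by linear_combination -hb)
    exact (Ideal.Quotient.nontrivial_iff.mp (inferInstance : Nontrivial (B ⧸ P)))
      (Ideal.eq_top_of_isUnit_mem _ (Ideal.mem_span_singleton_self _) (IsUnit.of_mul_eq_one _ h7))
  let _ : Algebra (ZMod p) (B ⧸ P) := ZMod.algebra _ p
  let _ : Algebra (ZMod p)[X] (B ⧸ P) :=
    (eval₂RingHom (algebraMap (ZMod p) (B ⧸ P)) (Ideal.Quotient.mk P (algebraMap ℤ[X] B X))).toAlgebra
  let ρ : ℤ[X] →+* (ZMod p)[X] := mapRingHom (Int.castRingHom (ZMod p))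
  have hρ : (algebraMap (ZMod p)[X] (B ⧸ P)).comp ρ =
      (Ideal.Quotient.mk P).comp (algebraMap ℤ[X] B) := by
    refine Polynomial.ringHom_ext' (RingHom.ext_int _ _) ?_
    simp [ρ, RingHom.algebraMap_toAlgebra]
  have hρ' : ∀ q, algebraMap (ZMod p)[X] (B ⧸ P) (ρ q) = Ideal.Quotient.mk P (algebraMap ℤ[X] B q) :=
    fun q => congrArg (fun f => f q) hρ
  have hρsurj : Function.Surjective ρ := map_surjective _ (ZMod.ringHom_surjective _)
  have heval : ∀ (b : B) (q : ℤ[X][X]), aeval (Ideal.Quotient.mk P b) (q.map ρ) =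
      Ideal.Quotient.mk P (aeval b q) := by
    intro b q
    rw [aeval_def, eval₂_map, hρ, aeval_def, hom_eval₂]
  have hfaith : FaithfulSMul (ZMod p)[X] (B ⧸ P) := by
    rw [faithfulSMul_iff_algebraMap_injective, injective_iff_map_eq_zero]
    intro f hf
    obtain ⟨q, rfl⟩ := hρsurj f
    rw [hρ', Ideal.Quotient.eq_zero_iff_mem, hP, Ideal.mem_span_singleton] at hf
    obtain ⟨b, hb⟩ := hf
    have h3 : b ∈ LinearMap.range (Algebra.linearMap ℤ[X] B) := by
      rw [← Submodule.Quotient.mk_eq_zero]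
      refine h2 hp _ ?_
      rw [← Submodule.Quotient.mk_smul, Submodule.Quotient.mk_eq_zero, nsmul_eq_mul, ← hb]
      exact ⟨q, rfl⟩
    obtain ⟨c, rfl⟩ := h3
    have h4 : q = p * c := by
      apply FaithfulSMul.algebraMap_injective ℤ[X] B
      rw [hb, map_mul, map_natCast, Algebra.linearMap_apply]
    rw [h4, map_mul, map_natCast, CharP.cast_eq_zero, zero_mul]
  have hint : Algebra.IsIntegral (ZMod p)[X] (B ⧸ P) := by
    refine ⟨fun x => ?_⟩
    obtain ⟨b, rfl⟩ := Ideal.Quotient.mk_surjective x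
    obtain ⟨q, hq, hqb⟩ := Algebra.IsIntegral.isIntegral (R := ℤ[X]) b
    exact ⟨q.map ρ, hq.map _, (heval b q).trans (by rw [aeval_def, hqb, map_zero])⟩
  set ι := algebraMap (B ⧸ P) (FractionRing (B ⧸ P))
  have hι : Function.Injective ι := IsFractionRing.injective _ _
  have hmap : ∀ (b : B ⧸ P) (q : (ZMod p)[X][X]), aeval (ι b) q = ι (aeval b q) :=
    fun b q => aeval_algebraMap_apply _ _ _
  have hadj : ∀ x ∈ Algebra.adjoin (ZMod p)[X] {ι (Ideal.Quotient.mk P y)}, ∃ b, ι b = x := by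
    intro x hx
    rw [Algebra.adjoin_singleton_eq_range_aeval] at hx
    obtain ⟨q, rfl⟩ := hx
    exact ⟨_, (hmap _ _).symm⟩
  have hdE : ∀ b, ι (Ideal.Quotient.mk P d * b) ∈
      IntermediateField.adjoin (FractionRing (ZMod p)[X]) {ι (Ideal.Quotient.mk P y)} := by
    intro b
    obtain ⟨b, rfl⟩ := Ideal.Quotient.mk_surjective b
    have h3 := hdB b
    rw [Algebra.adjoin_singleton_eq_range_aeval] at h3
    obtain ⟨q, hq⟩ := h3
    have hq' : aeval y q = d * b := hq
    rw [← map_mul, ← hq', ← heval, ← hmap,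
      ← aeval_map_algebraMap (FractionRing (ZMod p)[X])]
    exact IntermediateField.algebra_adjoin_le_adjoin _ _ (aeval_mem_adjoin_singleton _ _)
  -- A fraction `a / b` equals `da / db`, and both `da` and `db` are polynomials in the class of
  -- `y`.
  have hE : Algebra.adjoin (FractionRing (ZMod p)[X]) {ι (Ideal.Quotient.mk P y)} = ⊤ := by
    have hyint : IsIntegral (ZMod p)[X] (ι (Ideal.Quotient.mk P y)) :=
      (Algebra.IsIntegral.isIntegral _).algebraMap
    rw [← IntermediateField.adjoin_simple_toSubalgebra_of_isAlgebraic
      (hyint.tower_top (A := FractionRing (ZMod p)[X])).isAlgebraic, eq_top_iff]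
    rintro x -
    obtain ⟨a, b, hb, rfl⟩ := IsFractionRing.div_surjective (A := B ⧸ P) x
    have h3 : ι (Ideal.Quotient.mk P d) ≠ 0 := fun h => hd0 (hι (by rw [h, map_zero]))
    rw [← mul_div_mul_left _ _ h3, ← map_mul, ← map_mul]
    exact IntermediateField.div_mem _ (hdE a) (hdE b)
  have hzint : IsIntegral (ZMod p)[X] z := isIntegral_trans z hz
  -- The value of the derivative of `F` modulo `p` at the class of `y` is the class of `d`, which is
  -- nonzero. So the trace argument applies over `𝔽_p[X]` with the same denominator, despite
  -- positive characteristic.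
  have := derivative_mul_mem_adjoin (ZMod p)[X] (FractionRing (ZMod p)[X])
    (y := ι (Ideal.Quotient.mk P y)) (F := F.map ρ) (z := z) (hF.map _)
    (by rw [hmap, heval, hFy, map_zero, map_zero])
    (by
      rw [hmap, derivative_map, heval]
      exact fun h => hd0 (hι (by rw [h, map_zero])))
    hE hzint
  rw [hmap, derivative_map, heval] at this
  exact hadj _ this

end

/-- Each of finitely many generators `z` of `B` over ℤ satisfies `g(z) ∈ J` for some `g` with `u g +
v g' = n ≠ 0`. If `p` divides none of the integers `n`, then `g'(z)` is a unit modulo `J + pB`, and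
`B / (J + pB)` is unramified over `𝔽_p`, hence reduced. -/
theorem eventually_ideal_map_isRadical {B : Type} [CommRing B] [IsDomain B] [Algebra ℤ[X] B]
    [Module.Finite ℤ[X] B] [FaithfulSMul ℤ[X] B] {d : B} (hd : d ≠ 0) :
    ∀ᶠ p : ℕ in atTop, p.Prime →
      ((Ideal.span {d}).radical.map (Ideal.Quotient.mk (Ideal.span {(p : B)}))).IsRadical := by
  set J := (Ideal.span {d}).radical with hJ
  have hft : Algebra.FiniteType ℤ B := Algebra.FiniteType.trans (S := ℤ[X]) inferInstance inferInstance
  obtain ⟨s, hs⟩ := hft.out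
  have hred : IsReduced (B ⧸ J) :=
    (Ideal.isRadical_iff_quotient_reduced J).mp (Ideal.radical_isRadical _)
  have hz : ∀ z : B, ∃ g u v : ℤ[X], ∃ n : ℤ, n ≠ 0 ∧ eval₂ (Int.castRingHom B) z g ∈ J ∧
      u * g + v * derivative g = C n := by
    intro z
    obtain ⟨f, hf, hfz⟩ := exists_aeval_mem_span hd z
    have h1 : ∀ q : ℤ[X], eval₂ (Int.castRingHom (B ⧸ J)) (Ideal.Quotient.mk J z) q =
        Ideal.Quotient.mk J (eval₂ (Int.castRingHom B) z q) := by
      intro q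
      rw [hom_eval₂]
      congr 1
    obtain ⟨g, u, v, n, hn, hg, h⟩ :=
      exists_separable_eval₂_eq_zero (z := Ideal.Quotient.mk J z) hf
        (by rw [h1, Ideal.Quotient.eq_zero_iff_mem]; exact Ideal.le_radical hfz)
    rw [h1, Ideal.Quotient.eq_zero_iff_mem] at hg
    exact ⟨g, u, v, n, hn, hg, h⟩
  choose g u v n hn hg huv using hz
  have hev : ∀ᶠ p : ℕ in atTop, ∀ z ∈ s, ¬ (p : ℤ) ∣ n z := by
    rw [Filter.eventually_all_finset]
    intro z _
    filter_upwards [eventually_gt_atTop (n z).natAbs] with p hp hdvd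
    have := Nat.le_of_dvd (Int.natAbs_pos.mpr (hn z)) (Int.natCast_dvd.mp hdvd)
    omega
  filter_upwards [hev] with p hp hprime
  have : Fact p.Prime := ⟨hprime⟩
  set P := Ideal.span {(p : B)}
  suffices h : IsReduced (B ⧸ (J ⊔ P)) by
    rw [← Ideal.isRadical_iff_quotient_reduced] at h
    rintro x ⟨m, hm⟩
    obtain ⟨b, rfl⟩ := Ideal.Quotient.mk_surjective x
    rw [← map_pow, ← Ideal.mem_comap, Ideal.comap_map_of_surjective' _ Ideal.Quotient.mk_surjective,
      Ideal.mk_ker] at hm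
    have h1 := h ⟨m, hm⟩
    rw [← Ideal.mk_ker (I := P), ← Ideal.comap_map_of_surjective' _ Ideal.Quotient.mk_surjective]
      at h1
    exact h1
  set Q := B ⧸ (J ⊔ P)
  let π : B →+* Q := Ideal.Quotient.mk (J ⊔ P)
  have hπ : Function.Surjective π := Ideal.Quotient.mk_surjective
  rcases subsingleton_or_nontrivial Q with hQ | hQ
  · exact ⟨fun x _ => Subsingleton.elim _ _⟩
  have hQp : CharP Q p := by
    rw [CharP.charP_iff_prime_eq_zero hprime, ← map_natCast π]
    exact Ideal.Quotient.eq_zero_iff_mem.mpr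
        (Ideal.mem_sup_right (Ideal.mem_span_singleton_self _))
  let _ : Algebra (ZMod p) Q := ZMod.algebra Q p
  have heval : ∀ (z : B) (q : ℤ[X]), aeval (π z) (q.map (Int.castRingHom (ZMod p))) =
      π (eval₂ (Int.castRingHom B) z q) := by
    intro z q
    rw [aeval_def, eval₂_map, hom_eval₂]
    congr 1
    exact RingHom.ext_int _ _
  refine isReduced_of_adjoin_eq_top (k := ZMod p) (s := π '' s) (s.finite_toSet.image _) ?_ ?_
  · rw [eq_top_iff]
    rintro x -
    obtain ⟨b, rfl⟩ := hπ x
    have hb : b ∈ Algebra.adjoin ℤ (s : Set B) := hs ▸ trivial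
    induction hb using Algebra.adjoin_induction with
    | mem x hx => exact Algebra.subset_adjoin ⟨x, hx, rfl⟩
    | algebraMap r =>
      rw [show π (algebraMap ℤ B r) = ((r : ℤ) : Q) by simp]
      exact intCast_mem _ r
    | add x y _ _ hx hy => rw [map_add]; exact add_mem hx hy
    | mul x y _ _ hx hy => rw [map_mul]; exact mul_mem hx hy
  · rintro _ ⟨z, hz, rfl⟩
    refine ⟨(g z).map (Int.castRingHom (ZMod p)), ?_, ?_⟩
    · rw [heval]
      exact Ideal.Quotient.eq_zero_iff_mem.mpr (Ideal.mem_sup_left (hg z))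
    · have h1 := congrArg (fun q => aeval (π z) (q.map (Int.castRingHom (ZMod p)))) (huv z)
      simp only [Polynomial.map_add, Polynomial.map_mul, map_add, map_mul, map_C, aeval_C] at h1
      rw [heval z (g z), show π (eval₂ (Int.castRingHom B) z (g z)) = 0 from
        Ideal.Quotient.eq_zero_iff_mem.mpr (Ideal.mem_sup_left (hg z)), mul_zero, zero_add,
        ← derivative_map] at h1
      refine isUnit_of_mul_isUnit_right (h1 ▸ IsUnit.map _ (IsUnit.mk0 _ ?_))
      rw [eq_intCast, Ne, ZMod.intCast_zmod_eq_zero_iff_dvd _ p]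
      exact hp z hz

/-- A normal domain that is finite over `ℤ[X]` has normal reductions at almost all primes where its
reduction is a domain. -/
theorem eventually_isIntegrallyClosed {B : Type} [CommRing B] [IsDomain B] [Algebra ℤ[X] B]
    [Module.Finite ℤ[X] B] [FaithfulSMul ℤ[X] B] [IsIntegrallyClosed B] :
    ∀ᶠ p : ℕ in atTop, p.Prime → IsDomain (B ⧸ Ideal.span {(p : B)}) →
      IsIntegrallyClosed (B ⧸ Ideal.span {(p : B)}) := by
  have hN : IsNoetherianRing B := isNoetherian_of_tower ℤ[X] inferInstance
  obtain ⟨d, hd, hden⟩ := exists_eventually_mul_mem (B := B)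
  set J := (Ideal.span {d}).radical with hJ
  obtain ⟨N, hJN⟩ := Ideal.exists_radical_pow_le_of_fg (Ideal.span {d}) (IsNoetherian.noetherian _)
  have hdJ : d ∈ J := Ideal.le_radical (Ideal.mem_span_singleton_self d)
  obtain ⟨S, hS⟩ := IsNoetherian.noetherian J
  -- The elements `w` with `wJ ⊆ dJ` are the kernel of a linear map: multiplication of the
  -- generators of `J` by `w`, with values in copies of `J / dJ`.
  let φ : B →ₗ[B] (S → J ⧸ (Ideal.span {d} • (⊤ : Submodule B J))) :=
    LinearMap.pi fun i => (Submodule.mkQ _).comp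
      (LinearMap.toSpanSingleton B J ⟨i.1, hS ▸ Submodule.subset_span i.2⟩)
  have hφ : ∀ w i, φ w i = Submodule.Quotient.mk (w • ⟨i.1, hS ▸ Submodule.subset_span i.2⟩) :=
    fun w i => rfl
  have hsmul : ∀ x : J, x ∈ Ideal.span {d} • (⊤ : Submodule B J) ↔ ∃ j' ∈ J, (x : B) = d * j' := by
    intro x
    rw [Submodule.ideal_span_singleton_smul, Submodule.mem_smul_pointwise_iff_exists]
    constructor
    · rintro ⟨y, -, rfl⟩
      exact ⟨y, y.2, rfl⟩
    · rintro ⟨j', hj', h⟩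
      exact ⟨⟨j', hj'⟩, trivial, Subtype.ext h.symm⟩
  have hker : ∀ w, φ w = 0 → d ∣ w := by
    intro w hw
    have h1 : ∀ j ∈ J, ∃ j' ∈ J, w * j = d * j' := by
      intro j hj
      rw [← hS] at hj
      induction hj using Submodule.span_induction with
      | mem x hx =>
        have := congrFun hw ⟨x, hx⟩
        rw [hφ, Pi.zero_apply, Submodule.Quotient.mk_eq_zero, hsmul] at this
        exact this
      | zero => exact ⟨0, J.zero_mem, by simp⟩
      | add x y _ _ hx hy =>
        obtain ⟨a, ha, ha'⟩ := hx
        obtain ⟨b, hb, hb'⟩ := hy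
        exact ⟨a + b, J.add_mem ha hb, by rw [mul_add, mul_add, ha', hb']⟩
      | smul c x _ hx =>
        obtain ⟨a, ha, ha'⟩ := hx
        exact ⟨c * a, J.mul_mem_left _ ha, by rw [smul_eq_mul, mul_left_comm, ha']; ring⟩
    let K := FractionRing B
    have hinj : Function.Injective (algebraMap B K) := IsFractionRing.injective B K
    have hdK : algebraMap B K d ≠ 0 := fun h => hd (hinj (by rw [h, map_zero]))
    -- The fraction `w / d` maps the nonzero finitely generated module `J` into itself, hence is
    -- integral and lies in the normal ring `B`.
    have hint : IsIntegral B (algebraMap B K w / algebraMap B K d) := by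
      refine isIntegral_of_smul_mem_submodule (Submodule.map (Algebra.linearMap B K) J) ?_ ?_ _ ?_
      · rw [Submodule.ne_bot_iff]
        exact ⟨_, ⟨d, hdJ, rfl⟩, hdK⟩
      · exact (IsNoetherian.noetherian J).map _
      · rintro _ ⟨j, hj, rfl⟩
        obtain ⟨j', hj', h⟩ := h1 j hj
        refine ⟨j', hj', ?_⟩
        rw [Algebra.linearMap_apply, Algebra.linearMap_apply, smul_eq_mul, div_mul_eq_mul_div,
          eq_div_iff hdK, ← map_mul, ← map_mul, h, mul_comm]
    obtain ⟨b, hb⟩ := IsIntegrallyClosed.algebraMap_eq_of_integral hint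
    refine ⟨b, hinj ?_⟩
    rw [map_mul, hb, mul_div_cancel₀ _ hdK]
  filter_upwards [hden, eventually_ideal_map_isRadical hd, eventually_torsionFree B (B ⧸ J),
    eventually_torsionFree B (_ ⧸ LinearMap.range φ), eventually_torsionFree B (B ⧸ Ideal.span {d})]
    with p h1 h2 h3 h4 h5 hp hdom
  set P := Ideal.span {(p : B)} with hP
  have hsurj : Function.Surjective (Ideal.Quotient.mk P) := Ideal.Quotient.mk_surjective
  have hpJ : ∀ b : B, (p : B) * b ∈ J → b ∈ J := by
    intro b hb
    rw [← Ideal.Quotient.eq_zero_iff_mem]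
    refine h3 hp _ ?_
    rw [← map_nsmul, nsmul_eq_mul, Ideal.Quotient.eq_zero_iff_mem]
    exact hb
  refine isIntegrallyClosed_of_colon (d := Ideal.Quotient.mk P d) ?_ (h2 hp) (n := N) ?_
    (h1 hp) ?_
  · intro h
    rw [Ideal.Quotient.eq_zero_iff_mem, hP, Ideal.mem_span_singleton] at h
    obtain ⟨b, hb⟩ := h
    have h6 : b ∈ Ideal.span {d} := by
      rw [← Ideal.Quotient.eq_zero_iff_mem]
      refine h5 hp _ ?_
      rw [← map_nsmul, nsmul_eq_mul, Ideal.Quotient.eq_zero_iff_mem, ← hb]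
      exact Ideal.mem_span_singleton_self d
    obtain ⟨e, rfl⟩ := Ideal.mem_span_singleton.mp h6
    have h7 : (p : B) * e = 1 := mul_left_cancel₀ hd (by linear_combination -hb)
    exact (Ideal.Quotient.nontrivial_iff.mp (inferInstance : Nontrivial (B ⧸ P)))
      (Ideal.eq_top_of_isUnit_mem _ (Ideal.mem_span_singleton_self _) (IsUnit.of_mul_eq_one _ h7))
  · rw [← Ideal.map_pow, ← Set.image_singleton, ← Ideal.map_span]
    exact Ideal.map_mono hJN
  · intro w hw
    obtain ⟨w, rfl⟩ := hsurj w
    -- A relation `wJ ⊆ dJ` modulo `p` says that `wi` is in `dJ + pB`; since `B / J` has no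
    -- `p`-torsion, it is in `dJ + pJ`. So `φ w` is `p` times a vector, which lies in the range of
    -- `φ` because the cokernel has no `p`-torsion. Correcting `w` by a multiple of `p` then moves
    -- it into the kernel.
    have h6 : ∀ i : S, ∃ b : J, φ w i = p • (Submodule.Quotient.mk b) := by
      intro i
      have hi : i.1 ∈ J := hS ▸ Submodule.subset_span i.2
      obtain ⟨j', hj', h⟩ := hw _ (Ideal.mem_map_of_mem _ hi)
      obtain ⟨j'', hj'', rfl⟩ := (Ideal.mem_map_iff_of_surjective _ hsurj).mp hj'
      rw [← map_mul, ← map_mul, Ideal.Quotient.eq, hP, Ideal.mem_span_singleton] at h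
      obtain ⟨b, hb⟩ := h
      have hbJ : b ∈ J := hpJ b (by
        rw [← hb]
        exact J.sub_mem (J.mul_mem_left _ hi) (J.mul_mem_left _ hj''))
      refine ⟨⟨b, hbJ⟩, ?_⟩
      rw [hφ, ← Submodule.Quotient.mk_smul, Submodule.Quotient.eq, hsmul]
      refine ⟨j'', hj'', ?_⟩
      rw [AddSubgroupClass.coe_sub]
      change w * i.1 - p • b = d * j''
      rw [nsmul_eq_mul]
      linear_combination hb
    choose b hb using h6
    have h7 : (fun i => Submodule.Quotient.mk (b i) :
        S → J ⧸ (Ideal.span {d} • (⊤ : Submodule B J))) ∈ LinearMap.range φ := by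
      rw [← Submodule.Quotient.mk_eq_zero]
      refine h4 hp _ ?_
      rw [← Submodule.Quotient.mk_smul, Submodule.Quotient.mk_eq_zero]
      exact ⟨w, funext hb⟩
    obtain ⟨w', hw'⟩ := h7
    obtain ⟨e, he⟩ := hker (w - p • w') (by
      rw [map_sub, map_nsmul, hw', sub_eq_zero]
      exact funext hb)
    refine ⟨Ideal.Quotient.mk P e, ?_⟩
    rw [← map_mul, ← he, Ideal.Quotient.eq, hP, Ideal.mem_span_singleton]
    exact ⟨w', by rw [nsmul_eq_mul]; ring⟩

end AdjointCurve

/-! ### Conductors and their reduction for orders over `ℤ[X]` -/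

namespace AdjointCurve

open Polynomial Filter

/-- The conductor can be computed in any fraction field. -/
theorem mem_conductorIdeal_iff {A : Type*} (K : Type*) [CommRing A] [IsDomain A] [Field K]
    [Algebra A K] [IsFractionRing A K] {a : A} :
    a ∈ conductorIdeal A ↔
      ∀ z : K, IsIntegral A z → ∃ c : A, algebraMap A K c = algebraMap A K a * z := by
  let e := FractionRing.algEquiv A K
  constructor
  · intro h z hz
    obtain ⟨c, hc⟩ := h (e.symm z) ((isIntegral_algEquiv e.symm).mpr hz)
    refine ⟨c, ?_⟩
    have := congrArg e hc
    simpa using this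
  · intro h z hz
    obtain ⟨c, hc⟩ := h (e z) ((isIntegral_algEquiv e).mpr hz)
    refine ⟨c, e.injective ?_⟩
    simpa using hc

section

variable {A B : Type*} [CommRing A] [CommRing B] [IsDomain B] [Algebra A B]
  [FaithfulSMul A B]

/-- An extension with a common denominator has the same fraction field. -/
theorem isFractionRing_of_mul_mem {h : A} (h0 : h ≠ 0)
    (hB : ∀ b : B, ∃ a, algebraMap A B a = algebraMap A B h * b) :
    IsFractionRing A (FractionRing B) := by
  have hinj : Function.Injective (algebraMap A (FractionRing B)) := by
    rw [IsScalarTower.algebraMap_eq A B (FractionRing B)]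
    exact (IsFractionRing.injective B _).comp (FaithfulSMul.algebraMap_injective A B)
  have hne : ∀ a : A, a ≠ 0 → algebraMap A (FractionRing B) a ≠ 0 :=
    fun a ha h => ha (hinj (by rw [h, map_zero]))
  refine IsFractionRing.of_field A (FractionRing B) fun z => ?_
  obtain ⟨x, y, hy, rfl⟩ := IsFractionRing.div_surjective (A := B) z
  obtain ⟨a, ha⟩ := hB x
  obtain ⟨b, hb⟩ := hB y
  refine ⟨a, b, ?_⟩
  have h1 := hne h h0
  rw [IsScalarTower.algebraMap_apply A B (FractionRing B)] at h1
  rw [IsScalarTower.algebraMap_apply A B (FractionRing B) a,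
    IsScalarTower.algebraMap_apply A B (FractionRing B) b, ha, hb, map_mul, map_mul,
    mul_div_mul_left _ _ h1]

variable [Algebra.IsIntegral A B] [IsIntegrallyClosed B]

/-- The conductor in terms of a normal extension with a common denominator. -/
theorem mem_conductorIdeal_iff_of_mul_mem [IsDomain A] {h : A} (h0 : h ≠ 0)
    (hB : ∀ b : B, ∃ a, algebraMap A B a = algebraMap A B h * b) {a : A} :
    a ∈ conductorIdeal A ↔ ∀ b : B, ∃ c, algebraMap A B c = algebraMap A B a * b := by
  have := isFractionRing_of_mul_mem h0 hB
  rw [mem_conductorIdeal_iff (FractionRing B)]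
  constructor
  · intro H b
    obtain ⟨c, hc⟩ := H (algebraMap B _ b) ((Algebra.IsIntegral.isIntegral b).algebraMap)
    refine ⟨c, IsFractionRing.injective B (FractionRing B) ?_⟩
    rw [map_mul, ← IsScalarTower.algebraMap_apply, ← IsScalarTower.algebraMap_apply, hc]
  · intro H z hz
    obtain ⟨b, rfl⟩ := IsIntegrallyClosed.algebraMap_eq_of_integral (hz.tower_top (A := B))
    obtain ⟨c, hc⟩ := H b
    exact ⟨c, by rw [IsScalarTower.algebraMap_apply A B, hc, map_mul,
      ← IsScalarTower.algebraMap_apply]⟩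

/-- The common denominator identifies the two fraction fields, so the normal integral extension `B`
is itself the normalization of `A`. -/
theorem finite_integralClosure_of_mul_mem [Module.Finite A B] {h : A} (h0 : h ≠ 0)
    (hB : ∀ b : B, ∃ a, algebraMap A B a = algebraMap A B h * b) :
    Module.Finite A (integralClosure A (FractionRing A)) := by
  have := isFractionRing_of_mul_mem h0 hB
  have : IsIntegralClosure B A (FractionRing B) := IsIntegralClosure.of_isIntegrallyClosed ..
  exact Module.Finite.equiv ((IsIntegralClosure.equiv A (integralClosure A (FractionRing B))
    (FractionRing B) B).symm.trans
    (FractionRing.algEquiv A (FractionRing B)).symm.mapIntegralClosure).toLinearEquiv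

end

section

attribute [local instance] FractionRing.liftAlgebra

/-- Finiteness of the normalization of a domain that is finite over a normal Noetherian domain
of characteristic zero. -/
theorem exists_normalization (R A : Type*) [CommRing R] [IsDomain R] [CharZero R]
    [IsIntegrallyClosed R] [IsNoetherianRing R] [CommRing A] [IsDomain A] [Algebra R A]
    [Module.Finite R A] [FaithfulSMul R A] :
    Module.Finite R (integralClosure A (FractionRing A)) ∧
      IsIntegrallyClosed (integralClosure A (FractionRing A)) := by
  have : CharZero (FractionRing R) :=
    charZero_of_injective_algebraMap (IsFractionRing.injective R (FractionRing R))
  have hfin : FiniteDimensional (FractionRing R) (FractionRing A) :=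
    .of_isLocalization R A (nonZeroDivisors R)
  -- By transitivity, integral over `A` is the same as integral over `R`. The normalization is thus
  -- an integral closure in a finite extension that is separable, the characteristic being zero.
  have : IsIntegralClosure (integralClosure A (FractionRing A)) R (FractionRing A) :=
    ⟨Subtype.val_injective, fun {z} => ⟨fun h => ⟨⟨z, h.tower_top⟩, rfl⟩,
      fun ⟨y, e⟩ => e ▸ isIntegral_trans _ y.2⟩⟩
  exact ⟨IsIntegralClosure.finite R (FractionRing R) (FractionRing A) _,
    integralClosure.isIntegrallyClosedOfFiniteExtension (FractionRing A)⟩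

end

/-- A module-finite extension inside the fraction field has a common denominator. -/
theorem exists_mul_mem_of_finite (A : Type*) [CommRing A] [IsDomain A]
    (S : Subalgebra A (FractionRing A)) [Module.Finite A S] :
    ∃ h : A, h ≠ 0 ∧ ∀ b : S, ∃ a, algebraMap A S a = algebraMap A S h * b := by
  obtain ⟨s, hs⟩ := Module.Finite.fg_top (R := A) (M := S)
  obtain ⟨h, hh⟩ := IsLocalization.exist_integer_multiples (nonZeroDivisors A) s
    (fun b => (b : FractionRing A))
  refine ⟨h, nonZeroDivisors.ne_zero h.2, fun b => ?_⟩
  have hb : b ∈ Submodule.span A (s : Set S) := hs ▸ trivial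
  induction hb using Submodule.span_induction with
  | mem x hx =>
    obtain ⟨a, ha⟩ := hh x hx
    refine ⟨a, Subtype.ext ?_⟩
    rw [← Algebra.smul_def]
    exact ha
  | zero => exact ⟨0, by simp⟩
  | add x y _ _ hx hy =>
    obtain ⟨a, ha⟩ := hx
    obtain ⟨b, hb⟩ := hy
    exact ⟨a + b, by rw [map_add, ha, hb, mul_add]⟩
  | smul c x _ hx =>
    obtain ⟨a, ha⟩ := hx
    exact ⟨c * a, by rw [map_mul, ha, Algebra.smul_def]; ring⟩

/-- Here `B` is the normalization of `A`, and the conductor is the kernel of `φ : A → M ^ s`, where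
`M = B / A` and `s` generates `B`. For almost all `p` the ring `B / p` is the normalization of `A /
p`: injectivity comes from `M` having no `p`-torsion, normality from
`eventually_isIntegrallyClosed`. Since the cokernel of `φ` has no `p`-torsion either, elements of
the reduced conductor lift. -/
theorem eventually_conductorIdeal_of_mul_mem {A B : Type} [CommRing A] [IsDomain A]
    [Algebra ℤ[X] A] [Module.Finite ℤ[X] A] [CommRing B] [IsDomain B] [Algebra ℤ[X] B]
    [Algebra A B] [IsScalarTower ℤ[X] A B] [Module.Finite ℤ[X] B] [FaithfulSMul ℤ[X] B]
    [FaithfulSMul A B] [IsIntegrallyClosed B] {h : A} (h0 : h ≠ 0)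
    (hmul : ∀ b : B, ∃ a, algebraMap A B a = algebraMap A B h * b) :
    ∀ᶠ p : ℕ in atTop, p.Prime → ∀ (A' : Type) [CommRing A'] [IsDomain A'] (π : A →+* A'),
      Function.Surjective π → RingHom.ker π = Ideal.span {(p : A)} →
        Module.Finite A' (integralClosure A' (FractionRing A')) ∧
        ∀ a, π a ∈ conductorIdeal A' ↔ ∃ c ∈ conductorIdeal A, π c = π a := by
  have hfinA : Module.Finite A B := Module.Finite.of_restrictScalars_finite ℤ[X] A B
  have hNA : IsNoetherianRing A := isNoetherian_of_tower ℤ[X] inferInstance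
  obtain ⟨s, hs⟩ := Module.Finite.fg_top (R := A) (M := B)
  let M := B ⧸ LinearMap.range (Algebra.linearMap A B)
  let φ : A →ₗ[A] (s → M) := LinearMap.pi fun i => LinearMap.toSpanSingleton A M (Submodule.Quotient.mk i.1)
  have hφ : ∀ a i, φ a i = Submodule.Quotient.mk (a • i.1) := fun a i => rfl
  have hM : ∀ x : B, (Submodule.Quotient.mk x : M) = 0 ↔ ∃ c, algebraMap A B c = x := by
    intro x
    rw [Submodule.Quotient.mk_eq_zero]
    rfl
  have hker : ∀ a, φ a = 0 → a ∈ conductorIdeal A := by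
    intro a ha
    rw [mem_conductorIdeal_iff_of_mul_mem (B := B) h0 hmul]
    intro b
    have hb : b ∈ Submodule.span A (s : Set B) := hs ▸ trivial
    simp only [← Algebra.smul_def]
    induction hb using Submodule.span_induction with
    | mem x hx =>
      have := congrFun ha ⟨x, hx⟩
      rwa [hφ, Pi.zero_apply, hM] at this
    | zero => exact ⟨0, by simp⟩
    | add x y _ _ hx hy =>
      obtain ⟨a, ha⟩ := hx
      obtain ⟨b, hb⟩ := hy
      exact ⟨a + b, by rw [map_add, ha, hb, smul_add]⟩
    | smul c x _ hx =>
      obtain ⟨b, hb⟩ := hx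
      exact ⟨c * b, by rw [map_mul, hb, ← Algebra.smul_def, smul_comm]⟩
  filter_upwards [eventually_isIntegrallyClosed (B := B), eventually_torsionFree A M,
    eventually_torsionFree A (_ ⧸ LinearMap.range φ),
    eventually_torsionFree A (B ⧸ Ideal.span {algebraMap A B h}),
    eventually_torsionFree A (A ⧸ Ideal.span {h})]
    with p h1 h2 h3 h4 h5 hp A' _ _ π hπ hπk
  set P := Ideal.span {(p : B)} with hP
  have hker_le : RingHom.ker π ≤ RingHom.ker ((Ideal.Quotient.mk P).comp (algebraMap A B)) := by
    rw [hπk, Ideal.span_singleton_le_iff_mem, RingHom.mem_ker, RingHom.comp_apply, map_natCast,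
      Ideal.Quotient.eq_zero_iff_mem]
    exact Ideal.mem_span_singleton_self _
  let j : A' →+* B ⧸ P := RingHom.liftOfSurjective π hπ ⟨_, hker_le⟩
  have hj : ∀ a, j (π a) = Ideal.Quotient.mk P (algebraMap A B a) :=
    fun a => RingHom.liftOfRightInverse_comp_apply _ _ _ _ a
  have hjinj : Function.Injective j := by
    rw [injective_iff_map_eq_zero]
    intro x hx
    obtain ⟨a, rfl⟩ := hπ x
    rw [hj, Ideal.Quotient.eq_zero_iff_mem, hP, Ideal.mem_span_singleton] at hx
    obtain ⟨b, hb⟩ := hx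
    obtain ⟨c, rfl⟩ : ∃ c, algebraMap A B c = b := by
      rw [← hM]
      refine h2 hp _ ?_
      rw [← Submodule.Quotient.mk_smul, hM, nsmul_eq_mul]
      exact ⟨a, hb⟩
    rw [← RingHom.mem_ker, hπk, Ideal.mem_span_singleton]
    refine ⟨c, FaithfulSMul.algebraMap_injective A B ?_⟩
    rw [hb, map_mul, map_natCast]
  have hh : ∀ b : B, Ideal.Quotient.mk P (algebraMap A B h * b) = 0 → Ideal.Quotient.mk P b = 0 := by
    intro b hb
    rw [Ideal.Quotient.eq_zero_iff_mem, hP, Ideal.mem_span_singleton] at hb ⊢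
    obtain ⟨c, hc⟩ := hb
    have h6 : c ∈ Ideal.span {algebraMap A B h} := by
      rw [← Ideal.Quotient.eq_zero_iff_mem]
      refine h4 hp _ ?_
      rw [← map_nsmul, nsmul_eq_mul, Ideal.Quotient.eq_zero_iff_mem, ← hc]
      exact Ideal.mul_mem_right _ _ (Ideal.mem_span_singleton_self _)
    obtain ⟨e, rfl⟩ := Ideal.mem_span_singleton.mp h6
    have h7 : algebraMap A B h ≠ 0 :=
      fun h' => h0 (FaithfulSMul.algebraMap_injective A B (by rw [h', map_zero]))
    exact ⟨e, mul_left_cancel₀ h7 (by linear_combination hc)⟩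
  have hh0 : π h ≠ 0 := by
    intro h'
    rw [← RingHom.mem_ker, hπk, Ideal.mem_span_singleton] at h'
    obtain ⟨b, hb⟩ := h'
    have h6 : b ∈ Ideal.span {h} := by
      rw [← Ideal.Quotient.eq_zero_iff_mem]
      refine h5 hp _ ?_
      rw [← map_nsmul, nsmul_eq_mul, Ideal.Quotient.eq_zero_iff_mem, ← hb]
      exact Ideal.mem_span_singleton_self _
    obtain ⟨e, rfl⟩ := Ideal.mem_span_singleton.mp h6
    have h7 : (p : A) * e = 1 := mul_left_cancel₀ h0 (by linear_combination -hb)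
    have h8 : (p : A) ∈ RingHom.ker π := hπk ▸ Ideal.mem_span_singleton_self _
    have := congrArg π h7
    rw [map_mul, RingHom.mem_ker.mp h8, zero_mul, map_one] at this
    exact zero_ne_one this
  let _ : Algebra A' (B ⧸ P) := RingHom.toAlgebra (R := A') (S := B ⧸ P) j
  have hjalg : ∀ x, algebraMap A' (B ⧸ P) x = j x := fun x => rfl
  have hmul' : ∀ b : B ⧸ P, ∃ a, algebraMap A' (B ⧸ P) a = algebraMap A' (B ⧸ P) (π h) * b := by
    intro b
    obtain ⟨b, rfl⟩ := Ideal.Quotient.mk_surjective b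
    obtain ⟨a, ha⟩ := hmul b
    exact ⟨π a, by rw [hjalg, hjalg, hj, hj, ha, map_mul]⟩
  have hfaith : FaithfulSMul A' (B ⧸ P) := (faithfulSMul_iff_algebraMap_injective _ _).mpr hjinj
  -- Multiplication by `h` is injective on `B / p` and has its values in the domain `A'`.
  have hdom : IsDomain (B ⧸ P) := by
    have hnt : Nontrivial (B ⧸ P) := hjinj.nontrivial
    have : NoZeroDivisors (B ⧸ P) := by
      refine ⟨fun {x y} hxy => ?_⟩
      obtain ⟨a, ha⟩ := hmul' x
      obtain ⟨b, hb⟩ := hmul' y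
      have hab : a * b = 0 := by
        apply hjinj
        rw [map_mul, ← hjalg, ← hjalg, ha, hb, map_zero]
        linear_combination (algebraMap A' (B ⧸ P) (π h) * algebraMap A' (B ⧸ P) (π h)) * hxy
      have key : ∀ (x : B ⧸ P) a, algebraMap A' (B ⧸ P) a = algebraMap A' (B ⧸ P) (π h) * x →
          a = 0 → x = 0 := by
        rintro x a ha rfl
        obtain ⟨x, rfl⟩ := Ideal.Quotient.mk_surjective x
        apply hh
        rw [map_mul, ← hj, ← hjalg, ← ha, map_zero]
      exact (mul_eq_zero.mp hab).imp (key x a ha) (key y b hb)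
    exact NoZeroDivisors.to_isDomain _
  have hcl' := h1 hp hdom
  have hfin' : Module.Finite A' (B ⧸ P) := by
    classical
    refine ⟨⟨s.image (Ideal.Quotient.mk P), ?_⟩⟩
    rw [eq_top_iff]
    rintro x -
    obtain ⟨b, rfl⟩ := Ideal.Quotient.mk_surjective x
    have hb : b ∈ Submodule.span A (s : Set B) := hs ▸ trivial
    induction hb using Submodule.span_induction with
    | mem x hx => exact Submodule.subset_span (by simpa using ⟨x, hx, rfl⟩)
    | zero => rw [map_zero]; exact zero_mem _
    | add x y _ _ hx hy => rw [map_add]; exact add_mem hx hy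
    | smul c x _ hx =>
      rw [Algebra.smul_def, map_mul, ← hj, ← hjalg, ← Algebra.smul_def]
      exact Submodule.smul_mem _ _ hx
  refine ⟨finite_integralClosure_of_mul_mem (B := B ⧸ P) hh0 hmul', fun a => ?_⟩
  rw [mem_conductorIdeal_iff_of_mul_mem (B := B ⧸ P) hh0 hmul']
  constructor
  · intro H
    have h6 : ∀ i : s, ∃ b : B, φ a i = p • (Submodule.Quotient.mk b) := by
      intro i
      obtain ⟨c, hc⟩ := H (Ideal.Quotient.mk P i)
      obtain ⟨c, rfl⟩ := hπ c
      rw [hjalg, hjalg, hj, hj, ← map_mul, eq_comm, Ideal.Quotient.eq, hP,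
        Ideal.mem_span_singleton] at hc
      obtain ⟨b, hb⟩ := hc
      refine ⟨b, ?_⟩
      rw [hφ, ← Submodule.Quotient.mk_smul, ← sub_eq_zero, ← Submodule.Quotient.mk_sub, hM]
      refine ⟨c, ?_⟩
      rw [Algebra.smul_def, nsmul_eq_mul, ← hb]
      ring
    choose b hb using h6
    obtain ⟨w, hw⟩ : (fun i => Submodule.Quotient.mk (b i) : s → M) ∈ LinearMap.range φ := by
      rw [← Submodule.Quotient.mk_eq_zero]
      refine h3 hp _ ?_
      rw [← Submodule.Quotient.mk_smul, Submodule.Quotient.mk_eq_zero]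
      exact ⟨a, funext hb⟩
    -- Since `φ a = p φ w`, the element `a - pw` is in the conductor and has the same reduction as
    -- `a`.
    refine ⟨a - p • w, hker _ ?_, ?_⟩
    · rw [map_sub, map_nsmul, hw, sub_eq_zero]
      exact funext hb
    · rw [map_sub, sub_eq_self, nsmul_eq_mul, ← RingHom.mem_ker, hπk]
      exact Ideal.mul_mem_right _ _ (Ideal.mem_span_singleton_self _)
  · rintro ⟨c, hc, hca⟩ b
    obtain ⟨b, rfl⟩ := Ideal.Quotient.mk_surjective b
    rw [mem_conductorIdeal_iff_of_mul_mem (B := B) h0 hmul] at hc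
    obtain ⟨e, he⟩ := hc b
    exact ⟨π e, by rw [← hca, hjalg, hjalg, hj, hj, he, map_mul]⟩

/-- The conductor of a domain that is finite over `ℤ[X]` commutes with reduction modulo almost all
primes for which the reduction is a domain. -/
theorem eventually_conductorIdeal {A : Type} [CommRing A] [IsDomain A] [Algebra ℤ[X] A]
    [Module.Finite ℤ[X] A] [FaithfulSMul ℤ[X] A] :
    ∀ᶠ p : ℕ in atTop, p.Prime → ∀ (A' : Type) [CommRing A'] [IsDomain A'] (π : A →+* A'),
      Function.Surjective π → RingHom.ker π = Ideal.span {(p : A)} →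
        Module.Finite A' (integralClosure A' (FractionRing A')) ∧
        ∀ a, π a ∈ conductorIdeal A' ↔ ∃ c ∈ conductorIdeal A, π c = π a := by
  obtain ⟨hfin, hcl⟩ := exists_normalization ℤ[X] A
  have hfinA : Module.Finite A (integralClosure A (FractionRing A)) :=
    Module.Finite.of_restrictScalars_finite ℤ[X] A _
  have : FaithfulSMul ℤ[X] (integralClosure A (FractionRing A)) := by
    rw [faithfulSMul_iff_algebraMap_injective, IsScalarTower.algebraMap_eq ℤ[X] A]
    exact (FaithfulSMul.algebraMap_injective A _).comp (FaithfulSMul.algebraMap_injective ℤ[X] A)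
  obtain ⟨h, h0, hmul⟩ := exists_mul_mem_of_finite A (integralClosure A (FractionRing A))
  exact eventually_conductorIdeal_of_mul_mem h0 hmul

end AdjointCurve

/-! ### Integral polynomials, orders in `ℚ[X] / J` and their reductions -/

namespace AdjointCurve

open Filter

section Reduction

variable {σ : Type}

theorem mem_reduction_iff {p : ℕ} {J : Ideal (MvPolynomial σ ℚ)} {f : MvPolynomial σ (ZMod p)} :
    f ∈ reduction p J ↔ ∃ F : MvPolynomial σ ℤ, MvPolynomial.map (Int.castRingHom ℚ) F ∈ J ∧
      MvPolynomial.map (Int.castRingHom (ZMod p)) F = f := by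
  rw [reduction, Ideal.mem_map_iff_of_surjective _
    (MvPolynomial.map_surjective _ (ZMod.ringHom_surjective _))]
  rfl

theorem map_mem_reduction_iff {p : ℕ} {J : Ideal (MvPolynomial σ ℚ)} {f : MvPolynomial σ ℤ} :
    MvPolynomial.map (Int.castRingHom (ZMod p)) f ∈ reduction p J ↔
      ∃ F G : MvPolynomial σ ℤ, MvPolynomial.map (Int.castRingHom ℚ) F ∈ J ∧ f = F + p * G := by
  rw [mem_reduction_iff]
  constructor
  · rintro ⟨F, hF, h⟩
    rw [← sub_eq_zero, ← map_sub, ← MvPolynomial.C_dvd_iff_zmod] at h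
    obtain ⟨G, hG⟩ := h
    refine ⟨F, -G, hF, ?_⟩
    rw [map_natCast] at hG
    linear_combination -hG
  · rintro ⟨F, G, hF, rfl⟩
    refine ⟨F, hF, ?_⟩
    simp

theorem reduction_mono (p : ℕ) {J₁ J₂ : Ideal (MvPolynomial σ ℚ)} (h : J₁ ≤ J₂) :
    reduction p J₁ ≤ reduction p J₂ :=
  Ideal.map_mono (Ideal.comap_mono h)

/-- Clearing the denominators of a rational polynomial. -/
theorem exists_mvPolynomial_map_eq (f : MvPolynomial σ ℚ) :
    ∃ n : ℕ, n ≠ 0 ∧ ∃ F : MvPolynomial σ ℤ, MvPolynomial.map (Int.castRingHom ℚ) F = n * f := by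
  induction f using MvPolynomial.induction_on with
  | C a =>
    refine ⟨a.den, a.den_ne_zero, MvPolynomial.C a.num, ?_⟩
    rw [MvPolynomial.map_C, ← map_natCast MvPolynomial.C, ← map_mul, mul_comm, Rat.mul_den_eq_num]
    rfl
  | add f g hf hg =>
    obtain ⟨n, hn, F, hF⟩ := hf
    obtain ⟨m, hm, G, hG⟩ := hg
    exact ⟨n * m, mul_ne_zero hn hm, m * F + n * G, by
      simp only [map_add, map_mul, map_natCast, hF, hG, Nat.cast_mul]; ring⟩
  | mul_X f i hf =>
    obtain ⟨n, hn, F, hF⟩ := hf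
    exact ⟨n, hn, F * MvPolynomial.X i, by simp only [map_mul, hF, MvPolynomial.map_X]; ring⟩

/-- The polynomials with integral coefficients as elements of `ℚ[X] / J`. -/
noncomputable def intEval (J : Ideal (MvPolynomial σ ℚ)) :
    MvPolynomial σ ℤ →+* MvPolynomial σ ℚ ⧸ J :=
  (Ideal.Quotient.mk J).comp (MvPolynomial.map (Int.castRingHom ℚ))

/-- The reduction of the polynomials with integral coefficients in `𝔽_p[X] / J_p`. -/
noncomputable def redEval (p : ℕ) (J : Ideal (MvPolynomial σ ℚ)) :
    MvPolynomial σ ℤ →+* MvPolynomial σ (ZMod p) ⧸ reduction p J :=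
  (Ideal.Quotient.mk (reduction p J)).comp (MvPolynomial.map (Int.castRingHom (ZMod p)))

theorem redEval_surjective (p : ℕ) (J : Ideal (MvPolynomial σ ℚ)) :
    Function.Surjective (redEval p J) :=
  Ideal.Quotient.mk_surjective.comp (MvPolynomial.map_surjective _ (ZMod.ringHom_surjective _))

theorem intEval_eq_zero_iff {J : Ideal (MvPolynomial σ ℚ)} {f : MvPolynomial σ ℤ} :
    intEval J f = 0 ↔ MvPolynomial.map (Int.castRingHom ℚ) f ∈ J :=
  Ideal.Quotient.eq_zero_iff_mem

theorem redEval_eq_zero_iff {p : ℕ} {J : Ideal (MvPolynomial σ ℚ)} {f : MvPolynomial σ ℤ} :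
    redEval p J f = 0 ↔ ∃ F G : MvPolynomial σ ℤ, intEval J F = 0 ∧ f = F + p * G := by
  simp only [intEval_eq_zero_iff]
  exact Ideal.Quotient.eq_zero_iff_mem.trans map_mem_reduction_iff

theorem exists_intEval_eq (J : Ideal (MvPolynomial σ ℚ)) (a : MvPolynomial σ ℚ ⧸ J) :
    ∃ n : ℕ, n ≠ 0 ∧ ∃ F, intEval J F = n * a := by
  obtain ⟨f, rfl⟩ := Ideal.Quotient.mk_surjective a
  obtain ⟨n, hn, F, hF⟩ := exists_mvPolynomial_map_eq f
  exact ⟨n, hn, F, by rw [intEval, RingHom.comp_apply, hF, map_mul, map_natCast]⟩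

/-- A subring of `ℚ[X] / J` that contains multiples of the generators contains multiples of all
integral polynomials. -/
theorem exists_pow_mul_mem {J : Ideal (MvPolynomial σ ℚ)} {S : Subring (MvPolynomial σ ℚ ⧸ J)}
    {N : ℕ} (hN : ∀ i, (N : MvPolynomial σ ℚ ⧸ J) * intEval J (MvPolynomial.X i) ∈ S)
    (f : MvPolynomial σ ℤ) : ∃ k : ℕ, (N : MvPolynomial σ ℚ ⧸ J) ^ k * intEval J f ∈ S := by
  have hNS : (N : MvPolynomial σ ℚ ⧸ J) ∈ S := natCast_mem S N
  induction f using MvPolynomial.induction_on with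
  | C a => exact ⟨0, by simp [intEval]⟩
  | add f g hf hg =>
    obtain ⟨k, hk⟩ := hf
    obtain ⟨l, hl⟩ := hg
    refine ⟨k + l, ?_⟩
    have := add_mem (mul_mem (pow_mem hNS l) hk) (mul_mem (pow_mem hNS k) hl)
    rw [map_add]
    convert this using 1
    ring
  | mul_X f i hf =>
    obtain ⟨k, hk⟩ := hf
    refine ⟨k + 1, ?_⟩
    rw [map_mul]
    convert mul_mem hk (hN i) using 1
    ring

/-- Reduction modulo `p` of an order in `ℚ[X] / J`. -/
theorem exists_reductionHom {J : Ideal (MvPolynomial σ ℚ)} {S : Subring (MvPolynomial σ ℚ ⧸ J)}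
    (hS : S ≤ (intEval J).range) {N : ℕ}
    (hN : ∀ i, (N : MvPolynomial σ ℚ ⧸ J) * intEval J (MvPolynomial.X i) ∈ S) {p : ℕ}
    (hp : p.Prime) (hpN : ¬ p ∣ N) :
    ∃ π : S →+* MvPolynomial σ (ZMod p) ⧸ reduction p J, Function.Surjective π ∧
      RingHom.ker π = Ideal.span {(p : S)} ∧
      ∀ f (h : intEval J f ∈ S), π ⟨intEval J f, h⟩ = redEval p J f := by
  have hker : RingHom.ker (intEval J).rangeRestrict ≤ RingHom.ker (redEval p J) := by
    intro f hf
    rw [RingHom.mem_ker, redEval_eq_zero_iff]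
    exact ⟨f, 0, congrArg Subtype.val (RingHom.mem_ker.mp hf), by simp⟩
  let π₀ : (intEval J).range →+* MvPolynomial σ (ZMod p) ⧸ reduction p J :=
    RingHom.liftOfSurjective _ (intEval J).rangeRestrict_surjective ⟨_, hker⟩
  have hπ₀ : ∀ f, π₀ ((intEval J).rangeRestrict f) = redEval p J f :=
    fun f => RingHom.liftOfRightInverse_comp_apply _ _ _ _ f
  have hπ : ∀ f (h : intEval J f ∈ S), (π₀.comp (Subring.inclusion hS)) ⟨intEval J f, h⟩ =
      redEval p J f := fun f h => hπ₀ f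
  have hcop : Nat.Coprime p N := (Nat.Prime.coprime_iff_not_dvd hp).mpr hpN
  -- The order `S` contains only multiples `N ^ k f` of integral polynomials. A Bézout relation
  -- between `N ^ k` and `p` stands in for the inverse of `N ^ k`.
  have hbez : ∀ k : ℕ, ∃ u v : ℤ, u * (N : ℤ) ^ k + v * (p : ℤ) = 1 := by
    intro k
    have h1 : IsCoprime ((N : ℤ) ^ k) (p : ℤ) :=
      (Nat.isCoprime_iff_coprime.mpr hcop.symm).pow_left
    exact h1
  have hredp : redEval p J (p : MvPolynomial σ ℤ) = 0 :=
    redEval_eq_zero_iff.mpr ⟨0, 1, map_zero _, by simp⟩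
  refine ⟨π₀.comp (Subring.inclusion hS), ?_, ?_, hπ⟩
  · intro x
    obtain ⟨f, rfl⟩ := redEval_surjective p J x
    obtain ⟨k, hk⟩ := exists_pow_mul_mem hN f
    obtain ⟨u, v, huv⟩ := hbez k
    have hk' : intEval J (N ^ k * f) ∈ S := by simpa using hk
    refine ⟨u * ⟨_, hk'⟩, ?_⟩
    rw [map_mul, hπ, map_intCast, map_mul, ← mul_assoc, map_pow, map_natCast]
    have : (u : MvPolynomial σ (ZMod p) ⧸ reduction p J) * (N : MvPolynomial σ (ZMod p) ⧸ reduction p J) ^ k = 1 := by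
      have := congrArg (Int.cast : ℤ → MvPolynomial σ (ZMod p) ⧸ reduction p J) huv
      rw [map_natCast] at hredp
      push_cast at this
      rwa [hredp, mul_zero, add_zero] at this
    rw [this, one_mul]
  · ext ⟨a, ha⟩
    obtain ⟨f, rfl⟩ := hS ha
    rw [RingHom.mem_ker, hπ, redEval_eq_zero_iff, Ideal.mem_span_singleton]
    constructor
    · rintro ⟨F, G, hF, rfl⟩
      obtain ⟨k, hk⟩ := exists_pow_mul_mem hN G
      obtain ⟨u, v, huv⟩ := hbez k
      -- The given element of `S` is `pG`, so `G = u (N ^ k G) + v (pG)` lies in `S` itself.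
      refine ⟨u * ⟨_, hk⟩ + v * ⟨_, ha⟩, Subtype.ext ?_⟩
      have huv' := congrArg (Int.cast : ℤ → MvPolynomial σ ℚ ⧸ J) huv
      push_cast at huv' ⊢
      rw [map_add, hF, zero_add, map_mul, map_natCast]
      linear_combination (-(p : MvPolynomial σ ℚ ⧸ J) * intEval J G) * huv'
    · rintro ⟨⟨b, hb⟩, h⟩
      obtain ⟨G, rfl⟩ := hS hb
      refine ⟨f - p * G, G, ?_, by ring⟩
      rw [map_sub, map_mul, map_natCast, sub_eq_zero]
      exact congrArg Subtype.val h

theorem isIntegral_natAbs_mul {R A : Type*} [CommRing R] [CommRing A] [Algebra R A] (c : ℤ) {a : A}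
    (h : IsIntegral R ((c : A) * a)) : IsIntegral R ((c.natAbs : A) * a) := by
  rcases Int.natAbs_eq c with hc' | hc'
  · rwa [hc', Int.cast_natCast] at h
  · rw [hc', Int.cast_neg, Int.cast_natCast, neg_mul] at h
    simpa only [neg_neg] using h.neg

/-- An integral version of Noether normalization. -/
theorem exists_integral_model [Finite σ] (J : Ideal (MvPolynomial σ ℚ)) {n : ℕ}
    (g : MvPolynomial (Fin n) ℚ →ₐ[ℚ] MvPolynomial σ ℚ ⧸ J) (hg : Function.Injective g)
    (hint : g.toRingHom.IsIntegral) :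
    ∃ (u : Fin n → MvPolynomial σ ℤ) (N : ℕ), N ≠ 0 ∧
      Function.Injective (MvPolynomial.eval₂Hom (Int.castRingHom (MvPolynomial σ ℚ ⧸ J))
        fun i => intEval J (u i)) ∧
      ∀ i : σ, (MvPolynomial.eval₂Hom (Int.castRingHom (MvPolynomial σ ℚ ⧸ J))
        fun i => intEval J (u i)).IsIntegralElem
          ((N : MvPolynomial σ ℚ ⧸ J) * intEval J (MvPolynomial.X i)) := by
  cases nonempty_fintype σ
  choose m hm F hF using fun i => exists_intEval_eq J (g (MvPolynomial.X i))
  have hM : ∏ i, m i ≠ 0 := Finset.prod_ne_zero_iff.mpr fun i _ => hm i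
  set M := ∏ i, m i
  have hM' : (M : ℚ) ≠ 0 := Nat.cast_ne_zero.mpr hM
  -- Replacing each variable by its `M`-fold is an automorphism over ℚ; it moves the images of the
  -- variables into the image of the integral polynomials without affecting injectivity or
  -- integrality.
  let sc : ℚ → MvPolynomial (Fin n) ℚ →ₐ[ℚ] MvPolynomial (Fin n) ℚ :=
    fun c => MvPolynomial.aeval fun i => MvPolynomial.C c * MvPolynomial.X i
  have hsc : ∀ c d, c * d = 1 → (sc c).comp (sc d) = AlgHom.id ℚ _ := by
    intro c d hcd
    refine MvPolynomial.algHom_ext fun i => ?_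
    simp only [sc, AlgHom.comp_apply, MvPolynomial.aeval_X, map_mul, MvPolynomial.algHom_C,
      MvPolynomial.algebraMap_eq, AlgHom.id_apply]
    rw [← mul_assoc, ← map_mul, mul_comm d, hcd, map_one, one_mul]
  have h1 : ∀ x, sc M (sc (M : ℚ)⁻¹ x) = x :=
    fun x => congrArg (fun f => f x) (hsc M (M : ℚ)⁻¹ (mul_inv_cancel₀ hM'))
  have h2 : ∀ x, sc (M : ℚ)⁻¹ (sc M x) = x :=
    fun x => congrArg (fun f => f x) (hsc (M : ℚ)⁻¹ M (inv_mul_cancel₀ hM'))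
  let g' : MvPolynomial (Fin n) ℚ →+* MvPolynomial σ ℚ ⧸ J := (g.comp (sc M)).toRingHom
  have hg'inj : Function.Injective g' := hg.comp (Function.LeftInverse.injective h2)
  have hg'int : g'.IsIntegral :=
    RingHom.IsIntegral.trans (sc M).toRingHom g.toRingHom
      (RingHom.isIntegral_of_surjective _ (Function.RightInverse.surjective h1)) hint
  choose u hu using fun i => show ∃ u, intEval J u = g' (MvPolynomial.X i) by
    obtain ⟨c, hc⟩ : m i ∣ M := Finset.dvd_prod_of_mem m (Finset.mem_univ i)
    refine ⟨c * F i, ?_⟩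
    rw [map_mul, map_natCast, hF, ← mul_assoc]
    change _ = g (sc M (MvPolynomial.X i))
    rw [MvPolynomial.aeval_X, map_mul, hc, MvPolynomial.algHom_C]
    push_cast
    ring
  set γ := MvPolynomial.eval₂Hom (Int.castRingHom (MvPolynomial σ ℚ ⧸ J)) fun i => intEval J (u i)
    with hγ
  have hγ' : γ = g'.comp (MvPolynomial.map (Int.castRingHom ℚ)) := by
    refine MvPolynomial.ringHom_ext (fun a => by simp) fun i => ?_
    rw [RingHom.comp_apply, MvPolynomial.map_X, ← hu, hγ, MvPolynomial.eval₂Hom_X']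
  have hγint : ∀ a, ∃ N : ℕ, N ≠ 0 ∧ γ.IsIntegralElem (N * a) := by
    intro a
    let _ : Algebra (MvPolynomial (Fin n) ℚ) (MvPolynomial σ ℚ ⧸ J) := RingHom.toAlgebra g'
    let _ : Algebra (MvPolynomial (Fin n) ℤ) (MvPolynomial σ ℚ ⧸ J) := RingHom.toAlgebra γ
    let _ : Algebra (MvPolynomial (Fin n) ℤ) (MvPolynomial (Fin n) ℚ) :=
      MvPolynomial.algebraMvPolynomial
    have : IsScalarTower (MvPolynomial (Fin n) ℤ) (MvPolynomial (Fin n) ℚ)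
        (MvPolynomial σ ℚ ⧸ J) := IsScalarTower.of_algebraMap_eq' hγ'
    -- The ring `ℚ[Y]` is the localization of `ℤ[Y]` at the nonzero integers, so an element integral
    -- over `ℚ[Y]` has a nonzero integral multiple that is integral over `ℤ[Y]`.
    obtain ⟨⟨_, c, hc, rfl⟩, h⟩ := IsIntegral.exists_multiple_integral_of_isLocalization
      ((nonZeroDivisors ℤ).map (MvPolynomial.C (σ := Fin n))) (Rₘ := MvPolynomial (Fin n) ℚ) a
      (hg'int a)
    refine ⟨c.natAbs, Int.natAbs_ne_zero.mpr (nonZeroDivisors.ne_zero hc), ?_⟩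
    have h' : IsIntegral (MvPolynomial (Fin n) ℤ) ((c : MvPolynomial σ ℚ ⧸ J) * a) := by
      rw [Submonoid.smul_def, Algebra.smul_def] at h
      have h3 : algebraMap (MvPolynomial (Fin n) ℤ) (MvPolynomial σ ℚ ⧸ J)
        (MvPolynomial.C c) = c := MvPolynomial.eval₂Hom_C _ _ c
      rwa [h3] at h
    change IsIntegral (MvPolynomial (Fin n) ℤ) _
    exact isIntegral_natAbs_mul c h'
  choose k hk hk' using fun i => hγint (intEval J (MvPolynomial.X i))
  refine ⟨u, ∏ i, k i, Finset.prod_ne_zero_iff.mpr fun i _ => hk i, ?_, fun i => ?_⟩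
  · change Function.Injective γ
    rw [hγ']
    exact hg'inj.comp (MvPolynomial.map_injective _ Int.cast_injective)
  · obtain ⟨c, hc⟩ : k i ∣ ∏ i, k i := Finset.dvd_prod_of_mem k (Finset.mem_univ i)
    rw [hc]
    have : γ.IsIntegralElem (γ (c : MvPolynomial (Fin n) ℤ)) := γ.isIntegralElem_map
    have h3 := this.mul γ (hk' i)
    rw [map_natCast, ← mul_assoc, mul_comm (c : MvPolynomial σ ℚ ⧸ J), ← Nat.cast_mul] at h3
    exact h3

end Reduction

end AdjointCurve

/-! ### From the conductor of an order to the conductor of an affine chart -/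

namespace AdjointCurve

open Filter Polynomial

section Order

variable {S A : Type} [CommRing S] [CommRing A] [Algebra ℚ A] [Algebra S A]
  [FaithfulSMul S A]

theorem isLocalization_of_natCast_mul
    (hmul : ∀ a : A, ∃ n : ℕ, n ≠ 0 ∧ ∃ s : S, algebraMap S A s = n * a) :
    IsLocalization (Algebra.algebraMapSubmonoid S (nonZeroDivisors ℤ)) A := by
  have hinj := FaithfulSMul.algebraMap_injective S A
  refine ⟨?_, fun a => ?_, fun {x y} h => ⟨1, by rw [hinj h]⟩⟩
  · rintro ⟨_, n, hn, rfl⟩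
    have h1 : IsUnit (algebraMap ℚ A (n : ℚ)) :=
      (IsUnit.mk0 (n : ℚ) (Int.cast_ne_zero.mpr (nonZeroDivisors.ne_zero hn))).map _
    simpa using h1
  · obtain ⟨n, hn, s, hs⟩ := hmul a
    refine ⟨⟨s, algebraMap ℤ S n, n, mem_nonZeroDivisors_of_ne_zero (by exact_mod_cast hn), rfl⟩, ?_⟩
    simp [hs, mul_comm]

variable [IsDomain A]

theorem isFractionRing_of_natCast_mul
    (hmul : ∀ a : A, ∃ n : ℕ, n ≠ 0 ∧ ∃ s : S, algebraMap S A s = n * a) :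
    IsFractionRing S (FractionRing A) := by
  have : CharZero A := algebraRat.charZero A
  have : CharZero (FractionRing A) :=
    charZero_of_injective_algebraMap (IsFractionRing.injective A (FractionRing A))
  have : FaithfulSMul S (FractionRing A) := .trans S A _
  refine IsFractionRing.of_field S (FractionRing A) fun z => ?_
  obtain ⟨x, y, hy, rfl⟩ := IsFractionRing.div_surjective (A := A) z
  obtain ⟨n, hn, s, hs⟩ := hmul x
  obtain ⟨m, hm, t, ht⟩ := hmul y
  refine ⟨m * s, n * t, ?_⟩
  have hn' : (n : FractionRing A) ≠ 0 := Nat.cast_ne_zero.mpr hn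
  have hm' : (m : FractionRing A) ≠ 0 := Nat.cast_ne_zero.mpr hm
  rw [map_mul, map_mul, IsScalarTower.algebraMap_apply S A (FractionRing A) s,
    IsScalarTower.algebraMap_apply S A (FractionRing A) t, hs, ht]
  simp only [map_natCast, map_mul]
  rw [← mul_assoc, ← mul_assoc, mul_comm (n : FractionRing A) m,
    mul_div_mul_left _ _ (mul_ne_zero hm' hn')]

/-- An element integral over `A` becomes integral over `S` after multiplication by a nonzero
integer, and that integer is invertible in `A`. -/
theorem algebraMap_mem_conductorIdeal [IsDomain S]
    (hmul : ∀ a : A, ∃ n : ℕ, n ≠ 0 ∧ ∃ s : S, algebraMap S A s = n * a) {s : S}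
    (hs : s ∈ conductorIdeal S) : algebraMap S A s ∈ conductorIdeal A := by
  have := isFractionRing_of_natCast_mul hmul
  have := isLocalization_of_natCast_mul hmul
  rw [mem_conductorIdeal_iff (FractionRing A)] at hs ⊢
  intro z hz
  obtain ⟨⟨_, n, hn, rfl⟩, h⟩ := IsIntegral.exists_multiple_integral_of_isLocalization
    (Algebra.algebraMapSubmonoid S (nonZeroDivisors ℤ)) z hz
  obtain ⟨c, hc⟩ := hs _ h
  have h1 : IsUnit (algebraMap ℚ A (n : ℚ)) :=
      (IsUnit.mk0 (n : ℚ) (Int.cast_ne_zero.mpr (nonZeroDivisors.ne_zero hn))).map _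
  obtain ⟨u, hu⟩ := h1.exists_left_inv
  refine ⟨u * algebraMap S A c, ?_⟩
  rw [map_mul, ← IsScalarTower.algebraMap_apply, ← IsScalarTower.algebraMap_apply, hc,
    Submonoid.smul_def, Algebra.smul_def]
  have h2 := congrArg (algebraMap A (FractionRing A)) hu
  simp only [map_mul, map_one, map_intCast, eq_intCast] at h2 ⊢
  linear_combination (algebraMap S (FractionRing A) s * z) * h2

/-- The normalization of `S` is finite, so one integer clears the denominators of the products of
`s` with all its generators. -/
theorem exists_natCast_mul_mem_conductorIdeal [IsDomain S] [Algebra ℤ[X] S] [Module.Finite ℤ[X] S]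
    [FaithfulSMul ℤ[X] S]
    (hmul : ∀ a : A, ∃ n : ℕ, n ≠ 0 ∧ ∃ s : S, algebraMap S A s = n * a) {s : S}
    (hs : algebraMap S A s ∈ conductorIdeal A) :
    ∃ n : ℕ, n ≠ 0 ∧ (n : S) * s ∈ conductorIdeal S := by
  have := isFractionRing_of_natCast_mul hmul
  have h1 := (exists_normalization ℤ[X] S).1
  have h2 : Module.Finite S (integralClosure S (FractionRing S)) :=
    Module.Finite.of_restrictScalars_finite ℤ[X] _ _
  have h3 : Module.Finite S (integralClosure S (FractionRing A)) :=
    Module.Finite.equiv (FractionRing.algEquiv S (FractionRing A)).mapIntegralClosure.toLinearEquiv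
  obtain ⟨k, z, hz⟩ := Module.Finite.exists_fin (R := S) (M := integralClosure S (FractionRing A))
  rw [mem_conductorIdeal_iff (FractionRing A)] at hs
  have key : ∀ z : FractionRing A, IsIntegral S z → ∃ n : ℕ, n ≠ 0 ∧ ∃ c : S,
      algebraMap S (FractionRing A) c = algebraMap S (FractionRing A) (n * s) * z := by
    intro z hz
    obtain ⟨a, ha⟩ := hs z hz.tower_top
    obtain ⟨n, hn, t, ht⟩ := hmul a
    refine ⟨n, hn, t, ?_⟩
    rw [IsScalarTower.algebraMap_apply S A (FractionRing A), ht, map_mul, ha, map_mul,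
      ← IsScalarTower.algebraMap_apply]
    simp only [map_natCast]
    ring
  choose n hn c hc using fun i => key (z i) (z i).2
  refine ⟨∏ i, n i, Finset.prod_ne_zero_iff.mpr fun i _ => hn i, ?_⟩
  rw [mem_conductorIdeal_iff (FractionRing A)]
  intro w hw
  obtain ⟨w, rfl⟩ : ∃ w' : integralClosure S (FractionRing A), (w' : FractionRing A) = w :=
    ⟨⟨w, hw⟩, rfl⟩
  have hw' : w ∈ Submodule.span S (Set.range z) := hz ▸ Submodule.mem_top
  induction hw' using Submodule.span_induction with
  | mem x hx =>
    obtain ⟨i, rfl⟩ := hx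
    obtain ⟨d, hd⟩ : n i ∣ ∏ i, n i := Finset.dvd_prod_of_mem n (Finset.mem_univ i)
    refine ⟨d * c i, ?_⟩
    rw [hd, map_mul, hc]
    simp only [map_mul, map_natCast, Nat.cast_mul]
    ring
  | zero => exact ⟨0, by simp⟩
  | add x y _ _ hx hy =>
    obtain ⟨a, ha⟩ := hx x.2
    obtain ⟨b, hb⟩ := hy y.2
    exact ⟨a + b, by rw [map_add, ha, hb, Subalgebra.coe_add]; ring⟩
  | smul t x _ hx =>
    obtain ⟨a, ha⟩ := hx x.2
    refine ⟨t * a, ?_⟩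
    rw [map_mul, ha, Subalgebra.coe_smul, Algebra.smul_def]
    ring

/-- The powers of `p` in the multiplier can be cancelled, because `S` modulo its conductor has no
`p`-torsion for almost all `p`. -/
theorem eventually_exists_not_dvd_mul_mem_conductorIdeal [IsDomain S] [Algebra ℤ[X] S]
    [Module.Finite ℤ[X] S] [FaithfulSMul ℤ[X] S]
    (hmul : ∀ a : A, ∃ n : ℕ, n ≠ 0 ∧ ∃ s : S, algebraMap S A s = n * a) :
    ∀ᶠ p : ℕ in atTop, p.Prime → ∀ s : S, algebraMap S A s ∈ conductorIdeal A →
      ∃ n : ℕ, ¬ p ∣ n ∧ (n : S) * s ∈ conductorIdeal S := by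
  have : IsNoetherianRing S := IsNoetherianRing.of_finite ℤ[X] S
  filter_upwards [eventually_torsionFree S (S ⧸ conductorIdeal S)] with p hp hpp s hs
  obtain ⟨n, hn, h⟩ := exists_natCast_mul_mem_conductorIdeal hmul hs
  obtain ⟨e, n', hn', rfl⟩ := Nat.exists_eq_pow_mul_and_not_dvd hn p hpp.ne_one
  refine ⟨n', hn', ?_⟩
  clear hn
  induction e with
  | zero => simpa using h
  | succ e ih =>
    refine ih ?_
    rw [← Ideal.Quotient.eq_zero_iff_mem]
    refine hp hpp _ ?_
    rw [nsmul_eq_mul, ← map_natCast (Ideal.Quotient.mk (conductorIdeal S)), ← map_mul,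
      Ideal.Quotient.eq_zero_iff_mem]
    convert h using 1
    push_cast
    ring

end Order

/-- Conductors commute with reduction, for one affine chart. -/
theorem eventually_chart {σ : Type} [Finite σ] (J : Ideal (MvPolynomial σ ℚ)) [J.IsPrime]
    (g : MvPolynomial (Fin 1) ℚ →ₐ[ℚ] MvPolynomial σ ℚ ⧸ J) (hg : Function.Injective g)
    (hint : g.toRingHom.IsIntegral) :
    ∀ᶠ p : ℕ in atTop, p.Prime → (reduction p J).IsPrime →
      Module.Finite (MvPolynomial σ (ZMod p) ⧸ reduction p J)
        (integralClosure (MvPolynomial σ (ZMod p) ⧸ reduction p J)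
          (FractionRing (MvPolynomial σ (ZMod p) ⧸ reduction p J))) ∧
      (conductorIdeal (MvPolynomial σ (ZMod p) ⧸ reduction p J)).comap (Ideal.Quotient.mk _) =
        reduction p ((conductorIdeal (MvPolynomial σ ℚ ⧸ J)).comap (Ideal.Quotient.mk _)) := by
  obtain ⟨u, N, hN0, hinj, hi⟩ := exists_integral_model J g hg hint
  let A := MvPolynomial σ ℚ ⧸ J
  let γ : ℤ[X] →+* A := eval₂RingHom (Int.castRingHom A) (intEval J (u 0))
  have hγ₁ : γ = (MvPolynomial.eval₂Hom (Int.castRingHom A) fun i => intEval J (u i)).comp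
      (eval₂RingHom MvPolynomial.C (MvPolynomial.X 0)) := by
    refine Polynomial.ringHom_ext (fun a => by simp [γ]) (by simp [γ])
  have hγ₂ : (MvPolynomial.eval₂Hom (Int.castRingHom A) fun i => intEval J (u i)) = γ.comp
      (MvPolynomial.eval₂Hom Polynomial.C fun _ => Polynomial.X) := by
    refine MvPolynomial.ringHom_ext (fun a => by simp [γ]) fun i => ?_
    rw [Subsingleton.elim i 0]
    simp [γ]
  have hγinj : Function.Injective γ := by
    rw [hγ₁]
    refine hinj.comp (Function.LeftInverse.injective
      (g := (MvPolynomial.eval₂Hom Polynomial.C fun _ => Polynomial.X)) fun x => ?_)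
    rw [← RingHom.comp_apply]
    conv_rhs => rw [← RingHom.id_apply x]
    congr 1
    exact Polynomial.ringHom_ext (fun a => by simp) (by simp)
  let _ : Algebra ℤ[X] A := γ.toAlgebra
  have : FaithfulSMul ℤ[X] A := (faithfulSMul_iff_algebraMap_injective _ _).mpr hγinj
  -- The multiples `N X_i`, unlike the `X_i` in general, are integral over `ℤ[X]`; so `S` is finite
  -- over `ℤ[X]`.
  let S : Subalgebra ℤ[X] A :=
    Algebra.adjoin ℤ[X] (Set.range fun i => (N : A) * intEval J (MvPolynomial.X i))
  have : Module.Finite ℤ[X] S := by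
    refine Algebra.finite_adjoin_of_finite_of_isIntegral (Set.finite_range _) ?_
    rintro _ ⟨i, rfl⟩
    have := hi i
    rw [hγ₂] at this
    exact this.of_comp
  have hSle : S.toSubring ≤ (intEval J).range := by
    change ∀ x ∈ S, x ∈ (intEval J).range
    intro x hx
    induction hx using Algebra.adjoin_induction with
    | mem x hx =>
      obtain ⟨i, rfl⟩ := hx
      exact ⟨(N : MvPolynomial σ ℤ) * MvPolynomial.X i, by rw [map_mul, map_natCast]⟩
    | algebraMap f =>
      refine ⟨eval₂ MvPolynomial.C (u 0) f, ?_⟩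
      rw [hom_eval₂]
      exact congrArg (fun h => eval₂ h (intEval J (u 0)) f) (RingHom.ext_int _ _)
    | add x y _ _ hx hy => exact add_mem hx hy
    | mul x y _ _ hx hy => exact mul_mem hx hy
  have hNS : ∀ i, (N : A) * intEval J (MvPolynomial.X i) ∈ S.toSubring :=
    fun i => Algebra.subset_adjoin ⟨i, rfl⟩
  have hmul : ∀ a : A, ∃ n : ℕ, n ≠ 0 ∧ ∃ s : S, algebraMap S A s = n * a := by
    intro a
    obtain ⟨n, hn, F, hF⟩ := exists_intEval_eq J a
    obtain ⟨k, hk⟩ := exists_pow_mul_mem hNS F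
    refine ⟨N ^ k * n, mul_ne_zero (pow_ne_zero _ hN0) hn, ⟨_, hk⟩, ?_⟩
    change (N : A) ^ k * intEval J F = _
    rw [hF, ← mul_assoc, Nat.cast_mul, Nat.cast_pow]
  filter_upwards [eventually_conductorIdeal (A := S),
    eventually_exists_not_dvd_mul_mem_conductorIdeal hmul, eventually_gt_atTop N]
    with p hp1 hp2 hpN hpp hprime
  have hpN' : ¬ p ∣ N := fun h => by have := Nat.le_of_dvd (Nat.pos_of_ne_zero hN0) h; omega
  have := Fact.mk hpp
  obtain ⟨π, hπ, hker, hπe⟩ := exists_reductionHom hSle hNS hpp hpN'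
  obtain ⟨hfin, hcond⟩ := hp1 hpp _ (π : S →+* _) hπ hker
  have hunit : ∀ n : ℕ, ¬ p ∣ n → IsUnit (n : MvPolynomial σ (ZMod p)) := by
    intro n hn
    have h1 : IsUnit (n : ZMod p) :=
      IsUnit.mk0 _ (by rwa [Ne, ZMod.natCast_eq_zero_iff])
    simpa using h1.map (MvPolynomial.C (σ := σ))
  have hunit' : ∀ n : ℕ, ¬ p ∣ n → IsUnit (n : MvPolynomial σ (ZMod p) ⧸ reduction p J) :=
    fun n hn => by simpa using (hunit n hn).map (Ideal.Quotient.mk (reduction p J))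
  refine ⟨hfin, ?_⟩
  ext f
  obtain ⟨F, rfl⟩ := MvPolynomial.map_surjective (σ := σ) (Int.castRingHom (ZMod p))
    (ZMod.ringHom_surjective _) f
  -- The class of `F` need not lie in `S`, but that of `N ^ k * F` does, and the factor is a unit
  -- modulo `p`.
  obtain ⟨k, hk⟩ := exists_pow_mul_mem hNS F
  have hk' : intEval J (N ^ k * F) ∈ S.toSubring := by simpa using hk
  have hred : redEval p J (N ^ k * F) = (N : MvPolynomial σ (ZMod p) ⧸ reduction p J) ^ k *
    redEval p J F := by simp
  have hiff : redEval p J F ∈ conductorIdeal (MvPolynomial σ (ZMod p) ⧸ reduction p J) ↔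
      π ⟨_, hk'⟩ ∈ conductorIdeal (MvPolynomial σ (ZMod p) ⧸ reduction p J) := by
    rw [hπe, hred, Ideal.unit_mul_mem_iff_mem _ ((hunit' N hpN').pow k)]
  change redEval p J F ∈ conductorIdeal (MvPolynomial σ (ZMod p) ⧸ reduction p J) ↔ _
  constructor
  · intro h
    obtain ⟨c, hc, hcs⟩ := (hcond ⟨_, hk'⟩).mp (hiff.mp h)
    have hcA := algebraMap_mem_conductorIdeal hmul hc
    obtain ⟨G, hG⟩ := hSle c.2
    have hcG : c = ⟨intEval J G, hG ▸ c.2⟩ := Subtype.ext hG.symm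
    have h1 : redEval p J G = redEval p J ((N : MvPolynomial σ ℤ) ^ k * F) := by
      rw [← hπe _ hk', ← hπe G (hG ▸ c.2)]
      rw [hcG] at hcs
      exact hcs
    have h2 : MvPolynomial.map (Int.castRingHom (ZMod p)) ((N : MvPolynomial σ ℤ) ^ k * F) -
        MvPolynomial.map (Int.castRingHom (ZMod p)) G ∈
        reduction p ((conductorIdeal (MvPolynomial σ ℚ ⧸ J)).comap (Ideal.Quotient.mk J)) := by
      refine reduction_mono p ?_ (Ideal.Quotient.eq.mp h1.symm)
      intro x hx
      rw [Ideal.mem_comap, Ideal.Quotient.eq_zero_iff_mem.mpr hx]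
      exact zero_mem _
    have h3 : MvPolynomial.map (Int.castRingHom (ZMod p)) G ∈
        reduction p ((conductorIdeal (MvPolynomial σ ℚ ⧸ J)).comap (Ideal.Quotient.mk J)) := by
      rw [mem_reduction_iff]
      refine ⟨G, ?_, rfl⟩
      change intEval J G ∈ conductorIdeal _
      rw [hG]
      exact hcA
    have h4 := add_mem h2 h3
    rw [sub_add_cancel, map_mul, map_pow, map_natCast,
      Ideal.unit_mul_mem_iff_mem _ ((hunit N hpN').pow k)] at h4
    exact h4
  · intro h
    obtain ⟨G, hG, hGF⟩ := mem_reduction_iff.mp h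
    have hFG : redEval p J F = redEval p J G := by
      rw [redEval, RingHom.comp_apply, ← hGF]
      rfl
    obtain ⟨l, hl⟩ := exists_pow_mul_mem hNS G
    have hl' : intEval J (N ^ l * G) ∈ S.toSubring := by simpa using hl
    -- Membership in the conductor of the ℚ-algebra gives membership in that of `S` only up to an
    -- integer, here one that is a unit modulo `p`.
    obtain ⟨n, hn, hns⟩ := hp2 hpp ⟨_, hl'⟩ (by
      change intEval J (N ^ l * G) ∈ conductorIdeal _
      rw [map_mul]
      exact Ideal.mul_mem_left _ _ hG)
    have h1 := (hcond _).mpr ⟨_, hns, rfl⟩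
    change π (n * ⟨_, hl'⟩) ∈ _ at h1
    rw [map_mul, hπe, map_natCast, Ideal.unit_mul_mem_iff_mem _ (hunit' n hn), map_mul, map_pow,
      map_natCast, Ideal.unit_mul_mem_iff_mem _ ((hunit' N hpN').pow l)] at h1
    rw [hFG]
    exact h1

end AdjointCurve

/-! ### Dehomogenization: ideals of affine charts -/

namespace AdjointCurve

open MvPolynomial

attribute [local instance] MvPolynomial.gradedAlgebra

section Dehomogenization

theorem eval₂_mul_of_isHomogeneous {σ R S : Type*} [CommRing R] [CommRing S] {f : MvPolynomial σ R}
    {n : ℕ} (hf : f.IsHomogeneous n) (φ : R →+* S) (c : S) (x : σ → S) :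
    f.eval₂ φ (fun j => c * x j) = c ^ n * f.eval₂ φ x := by
  rw [eval₂_eq, eval₂_eq, Finset.mul_sum]
  refine Finset.sum_congr rfl fun d hd => ?_
  rw [Finset.prod_congr rfl fun i _ => mul_pow c (x i) (d i), Finset.prod_mul_distrib,
    Finset.prod_pow_eq_pow_sum, ← hf.degree_eq_sum_deg_support hd]
  ring

theorem map_homogeneousComponent {σ R S : Type*} [CommRing R] [CommRing S] (φ : R →+* S) (n : ℕ)
    (f : MvPolynomial σ R) :
    homogeneousComponent n (map φ f) = map φ (homogeneousComponent n f) := by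
  ext d
  simp only [coeff_homogeneousComponent, coeff_map]
  split_ifs <;> simp

/-- Homogenization with respect to the variable `X i`. -/
theorem exists_isHomogeneous_sub_mem {σ R : Type*} [CommRing R] (i : σ) (f : MvPolynomial σ R) :
    ∃ (n : ℕ) (F : MvPolynomial σ R), F.IsHomogeneous n ∧
      F - f ∈ Ideal.span {(X i - 1 : MvPolynomial σ R)} := by
  refine ⟨f.totalDegree, ∑ d ∈ Finset.range (f.totalDegree + 1),
    X i ^ (f.totalDegree - d) * homogeneousComponent d f, .sum _ _ _ fun d hd => ?_, ?_⟩
  · have h := (isHomogeneous_X_pow (R := R) i (f.totalDegree - d)).mul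
      (homogeneousComponent_isHomogeneous d f)
    rwa [Nat.sub_add_cancel (Nat.lt_succ_iff.mp (Finset.mem_range.mp hd))] at h
  · rw [← congrArg (_ - ·) (sum_homogeneousComponent f), ← Finset.sum_sub_distrib]
    refine sum_mem fun d _ => ?_
    rw [← sub_one_mul]
    refine Ideal.mul_mem_right _ _ (Ideal.mem_span_singleton.mpr ?_)
    simpa using sub_dvd_pow_sub_pow (X i : MvPolynomial σ R) 1 (f.totalDegree - d)

variable {σ k : Type} [Field k]

/-- The ideal of the affine chart `X i = 1` of the scheme given by `J`. -/
noncomputable def chartIdeal (J : Ideal (MvPolynomial σ k)) (i : σ) : Ideal (MvPolynomial σ k) :=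
  J ⊔ Ideal.span {X i - 1}

theorem le_chartIdeal (J : Ideal (MvPolynomial σ k)) (i : σ) : J ≤ chartIdeal J i := le_sup_left

theorem span_le_chartIdeal (J : Ideal (MvPolynomial σ k)) (i : σ) :
    Ideal.span {X i - 1} ≤ chartIdeal J i := le_sup_right

theorem mul_pow_sub_mem_chartIdeal (J : Ideal (MvPolynomial σ k)) (i : σ) (n : ℕ)
    (f : MvPolynomial σ k) : X i ^ n * f - f ∈ chartIdeal J i := by
  refine span_le_chartIdeal J i ?_
  rw [← sub_one_mul]
  refine Ideal.mul_mem_right _ _ (Ideal.mem_span_singleton.mpr ?_)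
  simpa using sub_dvd_pow_sub_pow (X i : MvPolynomial σ k) 1 n

theorem pow_mul_mem_iff_of_chartIdeal_le {J C : Ideal (MvPolynomial σ k)} {i : σ}
    (h : chartIdeal J i ≤ C) {n : ℕ} {f : MvPolynomial σ k} : X i ^ n * f ∈ C ↔ f ∈ C := by
  have h1 := h (mul_pow_sub_mem_chartIdeal J i n f)
  exact ⟨fun h2 => by simpa using sub_mem h2 h1, fun h2 => Ideal.mul_mem_left _ _ h2⟩

theorem isHomogeneous_of_homogeneousComponent_mem {J : Ideal (MvPolynomial σ k)}
    (h : ∀ f ∈ J, ∀ n, homogeneousComponent n f ∈ J) :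
    J.IsHomogeneous (homogeneousSubmodule σ k) := by
  intro n f hf
  exact (decomposition.decompose'_apply f n).symm ▸ h f hf n

/-- The substitution `X_j ↦ X_j / X_i` kills `X_i - 1`, carries `J` into its extension to the
localization at `X_i`, and sends `f` to `f / X_i ^ n`. Hence `f` lies in that extension. -/
theorem mem_chartIdeal_iff {J : Ideal (MvPolynomial σ k)}
    (hJ : J.IsHomogeneous (homogeneousSubmodule σ k)) {i : σ} {n : ℕ} {f : MvPolynomial σ k}
    (hf : f.IsHomogeneous n) : f ∈ chartIdeal J i ↔ ∃ m, X i ^ m * f ∈ J := by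
  constructor
  · intro h
    let L := Localization.Away (X i : MvPolynomial σ k)
    let Φ : MvPolynomial σ k →+* L := eval₂Hom (algebraMap k L) fun j =>
      IsLocalization.Away.invSelf (X i : MvPolynomial σ k) * algebraMap (MvPolynomial σ k) L (X j)
    have hev : ∀ h : MvPolynomial σ k,
        h.eval₂ (algebraMap k L) (fun j => algebraMap (MvPolynomial σ k) L (X j)) =
        algebraMap _ L h := by
      intro h
      conv_rhs => rw [← eval₂_eta h, ← coe_eval₂Hom, ← RingHom.comp_apply]
      rw [← coe_eval₂Hom]
      congr 1
      refine MvPolynomial.ringHom_ext (fun a => ?_) fun j => ?_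
      · simp only [eval₂Hom_C, RingHom.comp_apply]
        exact IsScalarTower.algebraMap_apply k (MvPolynomial σ k) L a
      · simp
    have hΦ : ∀ {d : ℕ} {h : MvPolynomial σ k}, h.IsHomogeneous d →
        Φ h = IsLocalization.Away.invSelf (X i : MvPolynomial σ k) ^ d * algebraMap _ L h :=
      fun hh => (eval₂_mul_of_isHomogeneous hh _ _ _).trans (by rw [hev])
    have hle : chartIdeal J i ≤ (J.map (algebraMap _ L)).comap Φ := by
      refine sup_le (fun g hg => ?_) ?_
      · rw [Ideal.mem_comap, ← sum_homogeneousComponent g, map_sum]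
        refine sum_mem fun d _ => ?_
        rw [hΦ (homogeneousComponent_isHomogeneous d g)]
        exact Ideal.mul_mem_left _ _ (Ideal.mem_map_of_mem _ (homogeneousComponent_mem_of_mem hJ hg d))
      · rw [Ideal.span_singleton_le_iff_mem, Ideal.mem_comap, map_sub, map_one,
          hΦ (isHomogeneous_X k i), pow_one, mul_comm, IsLocalization.Away.mul_invSelf, sub_self]
        exact zero_mem _
    have h1 := hle h
    rw [Ideal.mem_comap, hΦ hf] at h1
    have h2 := Ideal.mul_mem_left _ (algebraMap _ L (X i : MvPolynomial σ k) ^ n) h1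
    rw [← mul_assoc, ← mul_pow, IsLocalization.Away.mul_invSelf, one_pow, one_mul,
      IsLocalization.algebraMap_mem_map_algebraMap_iff
        (Submonoid.powers (X i : MvPolynomial σ k))] at h2
    obtain ⟨_, ⟨m, rfl⟩, hm⟩ := h2
    exact ⟨m, hm⟩
  · rintro ⟨m, hm⟩
    exact (pow_mul_mem_iff_of_chartIdeal_le le_rfl).mp (le_chartIdeal J i hm)

theorem mem_chartIdeal_iff_of_isPrime {J : Ideal (MvPolynomial σ k)}
    (hJ : J.IsHomogeneous (homogeneousSubmodule σ k)) (hp : J.IsPrime) {i : σ} (hi : X i ∉ J)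
    {n : ℕ} {f : MvPolynomial σ k} (hf : f.IsHomogeneous n) : f ∈ chartIdeal J i ↔ f ∈ J := by
  refine ⟨fun h => ?_, fun h => le_chartIdeal J i h⟩
  obtain ⟨m, hm⟩ := (mem_chartIdeal_iff hJ hf).mp h
  exact (hp.mem_or_mem hm).resolve_left fun h => hi (hp.mem_of_pow_mem _ h)

/-- Modulo `X_i - 1` every polynomial is homogeneous, and for homogeneous polynomials membership in
the chart ideal is membership in `J`. -/
theorem chartIdeal_isPrime {J : Ideal (MvPolynomial σ k)}
    (hJ : J.IsHomogeneous (homogeneousSubmodule σ k)) (hp : J.IsPrime) {i : σ} (hi : X i ∉ J) :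
    (chartIdeal J i).IsPrime := by
  have hiff := @mem_chartIdeal_iff_of_isPrime _ _ _ J hJ hp i hi
  refine ⟨fun h => hp.ne_top ?_, fun {f g} h => ?_⟩
  · rw [Ideal.eq_top_iff_one] at h ⊢
    exact (hiff (isHomogeneous_one σ k)).mp h
  · obtain ⟨n, F, hF, hf⟩ := exists_isHomogeneous_sub_mem i f
    obtain ⟨m, G, hG, hg⟩ := exists_isHomogeneous_sub_mem i g
    have hf' := span_le_chartIdeal J i hf
    have hg' := span_le_chartIdeal J i hg
    have h1 : F * G ∈ chartIdeal J i := by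
      have h2 := add_mem (add_mem (Ideal.mul_mem_left _ F hg') (Ideal.mul_mem_left _ g hf')) h
      convert h2 using 1
      ring
    rcases hp.mem_or_mem ((hiff (hF.mul hG)).mp h1) with h2 | h2
    · left
      simpa using sub_mem (le_chartIdeal J i h2) hf'
    · right
      simpa using sub_mem (le_chartIdeal J i h2) hg'

theorem reduction_isHomogeneous {J : Ideal (MvPolynomial σ ℚ)} {p : ℕ} [Fact p.Prime]
    (hJ : J.IsHomogeneous (homogeneousSubmodule σ ℚ)) :
    (reduction p J).IsHomogeneous (homogeneousSubmodule σ (ZMod p)) := by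
  refine isHomogeneous_of_homogeneousComponent_mem fun f hf n => ?_
  obtain ⟨F, hF, rfl⟩ := mem_reduction_iff.mp hf
  rw [map_homogeneousComponent]
  refine mem_reduction_iff.mpr ⟨_, ?_, rfl⟩
  rw [← map_homogeneousComponent]
  exact homogeneousComponent_mem_of_mem hJ hF n

/-- The homogenization of an integral lift has integral coefficients and serves over ℚ and over
`𝔽_p` simultaneously. -/
theorem reduction_chartIdeal {J : Ideal (MvPolynomial σ ℚ)}
    (hJ : J.IsHomogeneous (homogeneousSubmodule σ ℚ)) (i : σ) (p : ℕ) [Fact p.Prime] :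
    reduction p (chartIdeal J i) = chartIdeal (reduction p J) i := by
  refine le_antisymm (fun f hf => ?_) (sup_le (reduction_mono p le_sup_left) ?_)
  · obtain ⟨F, hF, rfl⟩ := mem_reduction_iff.mp hf
    obtain ⟨n, H, hH, h⟩ := exists_isHomogeneous_sub_mem i F
    have hmap : ∀ {R : Type} [Field R] (φ : ℤ →+* R) (J : Ideal (MvPolynomial σ R)),
        map φ H - map φ F ∈ chartIdeal J i := by
      intro R _ φ J
      have h1 := Ideal.mem_map_of_mem (map φ) h
      rw [Ideal.map_span, Set.image_singleton] at h1
      simpa using span_le_chartIdeal J i (by simpa using h1)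
    have h2 := add_mem (hmap (Int.castRingHom ℚ) J) hF
    rw [sub_add_cancel] at h2
    obtain ⟨m, hm⟩ := (mem_chartIdeal_iff hJ (hH.map _)).mp h2
    have h3 : X i ^ m * map (Int.castRingHom (ZMod p)) H ∈ reduction p J :=
      mem_reduction_iff.mpr ⟨X i ^ m * H, by simpa using hm, by simp⟩
    have h4 := (pow_mul_mem_iff_of_chartIdeal_le le_rfl).mp (le_chartIdeal _ i h3)
    simpa using sub_mem h4 (hmap (Int.castRingHom (ZMod p)) (reduction p J))
  · rw [Ideal.span_singleton_le_iff_mem]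
    refine mem_reduction_iff.mpr ⟨X i - 1, ?_, by simp⟩
    simpa using span_le_chartIdeal J i (Ideal.mem_span_singleton_self _)

end Dehomogenization

end AdjointCurve

/-! ### Dimension of the cone and of the charts -/

namespace AdjointCurve

open MvPolynomial

attribute [local instance] MvPolynomial.gradedAlgebra

section Dimension

theorem ringKrullDim_le_of_isIntegral (R S : Type*) [CommRing R] [CommRing S] [Algebra R S]
    [Algebra.IsIntegral R S] : ringKrullDim S ≤ ringKrullDim R :=
  Order.krullDim_le_of_strictMono (PrimeSpectrum.comap (algebraMap R S))
    fun _ _ h => Ideal.IsIntegral.comap_lt_comap h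

/-- Chains of primes of `R` lift by lying over and going up; in `S` inclusions of primes stay strict
under contraction. -/
theorem ringKrullDim_eq_of_isIntegral (R S : Type*) [CommRing R] [CommRing S] [IsDomain S]
    [Algebra R S] [Algebra.IsIntegral R S] [FaithfulSMul R S] : ringKrullDim S = ringKrullDim R := by
  refine le_antisymm (ringKrullDim_le_of_isIntegral R S) (iSup_le fun l => ?_)
  obtain ⟨Q, hQ, h⟩ := Ideal.exists_ideal_over_prime_of_isIntegral_of_isDomain (S := S)
    l.head.asIdeal (by
      rw [(RingHom.injective_iff_ker_eq_bot _).mp (FaithfulSMul.algebraMap_injective R S)]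
      exact bot_le)
  have : Q.LiesOver l.head.asIdeal := ⟨h.symm⟩
  obtain ⟨L, hL, -⟩ := Ideal.exists_ltSeries_of_hasGoingUp l Q
  rw [← hL]
  exact Order.LTSeries.length_le_krullDim L

theorem ringKrullDim_eq_of_noether {k A : Type*} [Field k] [CommRing A] [IsDomain A] [Algebra k A]
    {n : ℕ}
    (g : MvPolynomial (Fin n) k →ₐ[k] A) (hg : Function.Injective g) (hint : g.toRingHom.IsIntegral) :
    ringKrullDim A = n := by
  let _ : Algebra (MvPolynomial (Fin n) k) A := g.toRingHom.toAlgebra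
  have : Algebra.IsIntegral (MvPolynomial (Fin n) k) A := ⟨hint⟩
  have : FaithfulSMul (MvPolynomial (Fin n) k) A := (faithfulSMul_iff_algebraMap_injective _ _).mpr hg
  rw [ringKrullDim_eq_of_isIntegral (MvPolynomial (Fin n) k) A,
    MvPolynomial.ringKrullDim_of_isNoetherianRing, ringKrullDim_eq_zero_of_field]
  simp

theorem trdeg_eq_of_noether {k A : Type} [Field k] [CommRing A] [IsDomain A] [Algebra k A] {n : ℕ}
    (g : MvPolynomial (Fin n) k →ₐ[k] A) (hg : Function.Injective g) (hint : g.toRingHom.IsIntegral) :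
    Algebra.trdeg k A = n := by
  let _ : Algebra (MvPolynomial (Fin n) k) A := g.toRingHom.toAlgebra
  have : IsScalarTower k (MvPolynomial (Fin n) k) A := .of_algebraMap_eq fun x => (g.commutes x).symm
  have : Algebra.IsIntegral (MvPolynomial (Fin n) k) A := ⟨hint⟩
  have : FaithfulSMul (MvPolynomial (Fin n) k) A := (faithfulSMul_iff_algebraMap_injective _ _).mpr hg
  rw [← trdeg_add_eq k (MvPolynomial (Fin n) k),
    trdeg_eq_zero (R := MvPolynomial (Fin n) k),
    MvPolynomial.trdeg_of_isDomain]
  simp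

/-- The image of `S` contains `T` and `T a` for generators `a` of `A`, so `A[T]` is algebraic over
`S`. -/
theorem trdeg_eq_trdeg_add_one {k S A : Type} [Field k] [CommRing S] [CommRing A] [IsDomain A]
    [Algebra k S] [Algebra k A] (ψ : S →ₐ[k] Polynomial A) (hψ : Function.Injective ψ)
    (hX : ∃ s, ψ s = Polynomial.X) {t : Set A} (ht : Algebra.adjoin k t = ⊤)
    (hXt : ∀ a ∈ t, ∃ s, ψ s = Polynomial.X * Polynomial.C a) :
    Algebra.trdeg k S = Algebra.trdeg k A + 1 := by
  let _ : Algebra S (Polynomial A) := RingHom.toAlgebra (R := S) (S := Polynomial A) ψ.toRingHom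
  have : IsScalarTower k S (Polynomial A) := .of_algebraMap_eq fun x => (ψ.commutes x).symm
  have : FaithfulSMul S (Polynomial A) := (faithfulSMul_iff_algebraMap_injective _ _).mpr hψ
  have : IsDomain S := hψ.isDomain ψ.toRingHom
  have halg : ∀ s, IsAlgebraic S (ψ s) := fun s => isAlgebraic_algebraMap (A := Polynomial A) s
  have hX' : IsAlgebraic S (Polynomial.X : Polynomial A) := by
    obtain ⟨s, hs⟩ := hX
    exact hs ▸ halg s
  have hC : ∀ a : A, IsAlgebraic S (Polynomial.C a) := by
    intro a
    induction (ht ▸ Algebra.mem_top : a ∈ Algebra.adjoin k t) using Algebra.adjoin_induction with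
    | mem a ha =>
      obtain ⟨s, hs⟩ := hXt a ha
      exact IsAlgebraic.of_mul (y := Polynomial.X)
        (mem_nonZeroDivisors_of_ne_zero Polynomial.X_ne_zero) hX' (hs ▸ halg s)
    | algebraMap c => exact (ψ.commutes c) ▸ halg _
    | add a b _ _ ha hb => exact (map_add Polynomial.C a b).symm ▸ ha.add hb
    | mul a b _ _ ha hb => exact (map_mul Polynomial.C a b).symm ▸ ha.mul hb
  have : Algebra.IsAlgebraic S (Polynomial A) := by
    refine ⟨fun q => ?_⟩
    induction q using Polynomial.induction_on' with
    | add f g hf hg => exact hf.add hg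
    | monomial n a =>
      rw [← Polynomial.C_mul_X_pow_eq_monomial]
      exact (hC a).mul (hX'.pow n)
  have h1 := trdeg_add_eq k S (A := Polynomial A)
  rw [trdeg_eq_zero (R := S), add_zero, ← trdeg_add_eq k A (A := Polynomial A),
    Polynomial.trdeg_of_isDomain] at h1
  exact h1

variable {σ k : Type} [Field k]

/-- The homogeneous coordinate ring in the Rees algebra of an affine chart. -/
noncomputable def coneHom (J : Ideal (MvPolynomial σ k)) (i : σ) :
    MvPolynomial σ k →ₐ[k] Polynomial (MvPolynomial σ k ⧸ chartIdeal J i) :=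
  aeval fun j => Polynomial.X * Polynomial.C (Ideal.Quotient.mk (chartIdeal J i) (X j))

theorem coneHom_of_isHomogeneous (J : Ideal (MvPolynomial σ k)) (i : σ) {n : ℕ}
    {f : MvPolynomial σ k} (hf : f.IsHomogeneous n) :
    coneHom J i f = Polynomial.X ^ n * Polynomial.C (Ideal.Quotient.mk (chartIdeal J i) f) := by
  refine (eval₂_mul_of_isHomogeneous hf (algebraMap k _) Polynomial.X fun j =>
    Polynomial.C (Ideal.Quotient.mk (chartIdeal J i) (X j))).trans ?_
  congr 1
  have : (Polynomial.C.comp (Ideal.Quotient.mk (chartIdeal J i))) = eval₂Hom (algebraMap k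
      (Polynomial (MvPolynomial σ k ⧸ chartIdeal J i)))
      fun j => Polynomial.C (Ideal.Quotient.mk (chartIdeal J i) (X j)) := by
    refine MvPolynomial.ringHom_ext (fun a => ?_) fun j => ?_
    · simp only [RingHom.comp_apply, eval₂Hom_C]
      rfl
    · simp
  exact (congrArg (fun h => h f) this).symm

/-- The exponent of the polynomial variable records the degree, so the homogeneous components can be
tested separately on the chart. -/
theorem coneHom_eq_zero_iff {J : Ideal (MvPolynomial σ k)}
    (hJ : J.IsHomogeneous (homogeneousSubmodule σ k)) (hp : J.IsPrime) {i : σ} (hi : X i ∉ J)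
    {f : MvPolynomial σ k} : coneHom J i f = 0 ↔ f ∈ J := by
  have hsum : coneHom J i f = ∑ d ∈ Finset.range (f.totalDegree + 1),
      Polynomial.X ^ d * Polynomial.C (Ideal.Quotient.mk (chartIdeal J i)
        (homogeneousComponent d f)) := by
    conv_lhs => rw [← sum_homogeneousComponent f]
    rw [map_sum]
    exact Finset.sum_congr rfl fun d _ =>
      coneHom_of_isHomogeneous J i (homogeneousComponent_isHomogeneous d f)
  constructor
  · intro h
    rw [← sum_homogeneousComponent f]
    refine sum_mem fun d hd => ?_
    rw [hsum] at h
    have h1 := congrArg (fun q => Polynomial.coeff q d) h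
    simp only [Polynomial.finsetSum_coeff, Polynomial.coeff_X_pow_mul', Polynomial.coeff_C,
      Polynomial.coeff_zero] at h1
    rw [Finset.sum_eq_single_of_mem d hd, if_pos le_rfl, if_pos (Nat.sub_self d),
      Ideal.Quotient.eq_zero_iff_mem] at h1
    · exact (mem_chartIdeal_iff_of_isPrime hJ hp hi (homogeneousComponent_isHomogeneous d f)).mp h1
    · intro e _ hne
      split_ifs with h2 h3
      · omega
      · rfl
      · rfl
  · intro h
    rw [hsum]
    refine Finset.sum_eq_zero fun d _ => ?_
    rw [Ideal.Quotient.eq_zero_iff_mem.mpr (le_chartIdeal J i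
      (homogeneousComponent_mem_of_mem hJ h d)), map_zero, mul_zero]

theorem trdeg_quotient_eq {J : Ideal (MvPolynomial σ k)}
    (hJ : J.IsHomogeneous (homogeneousSubmodule σ k)) (hp : J.IsPrime) {i : σ} (hi : X i ∉ J) :
    Algebra.trdeg k (MvPolynomial σ k ⧸ J) =
      Algebra.trdeg k (MvPolynomial σ k ⧸ chartIdeal J i) + 1 := by
  have := chartIdeal_isPrime hJ hp hi
  let A := MvPolynomial σ k ⧸ chartIdeal J i
  let ψ : (MvPolynomial σ k ⧸ J) →ₐ[k] Polynomial A :=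
    Ideal.Quotient.liftₐ J (coneHom J i) fun f hf => (coneHom_eq_zero_iff hJ hp hi).mpr hf
  have hψ : ∀ f, ψ (Ideal.Quotient.mk J f) = coneHom J i f := fun f => rfl
  have hinj : Function.Injective ψ := by
    rw [injective_iff_map_eq_zero]
    intro a ha
    obtain ⟨f, rfl⟩ := Ideal.Quotient.mk_surjective a
    rw [hψ, coneHom_eq_zero_iff hJ hp hi] at ha
    exact Ideal.Quotient.eq_zero_iff_mem.mpr ha
  have hone : (Ideal.Quotient.mk (chartIdeal J i) (X i)) = 1 := by
    rw [← map_one (Ideal.Quotient.mk _), Ideal.Quotient.eq]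
    exact span_le_chartIdeal J i (Ideal.mem_span_singleton_self _)
  refine trdeg_eq_trdeg_add_one ψ hinj ⟨Ideal.Quotient.mk J (X i), ?_⟩
    (t := Set.range fun j => Ideal.Quotient.mkₐ k (chartIdeal J i) (X j)) ?_ ?_
  · rw [hψ, coneHom, aeval_X, hone, map_one, mul_one]
  · rw [Set.range_comp', ← AlgHom.map_adjoin, adjoin_range_X, Algebra.map_top, AlgHom.range_eq_top]
    exact Ideal.Quotient.mkₐ_surjective k _
  · rintro _ ⟨j, rfl⟩
    exact ⟨Ideal.Quotient.mk J (X j), by rw [hψ, coneHom, aeval_X]; rfl⟩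

theorem X_notMem_of_nondegenerate {J : Ideal (MvPolynomial σ k)}
    (h : ∀ l ∈ J, l.IsHomogeneous 1 → l = 0) (i : σ) : X i ∉ J :=
  fun hi => X_ne_zero i (h _ hi (isHomogeneous_X k i))

/-- The affine charts of a projective curve are finite over the affine line. -/
theorem exists_noether_chart [Finite σ] {J : Ideal (MvPolynomial σ k)}
    (hJ : J.IsHomogeneous (homogeneousSubmodule σ k)) (hp : J.IsPrime) {i : σ} (hi : X i ∉ J)
    (hdim : ringKrullDim (MvPolynomial σ k ⧸ J) = 2) :
    ∃ g : MvPolynomial (Fin 1) k →ₐ[k] MvPolynomial σ k ⧸ chartIdeal J i,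
      Function.Injective g ∧ g.toRingHom.IsIntegral := by
  have := chartIdeal_isPrime hJ hp hi
  -- Noether normalization makes dimension and transcendence degree of the cone agree, both being
  -- two. The transcendence degree drops by one on the chart, which fixes the number of variables
  -- there.
  obtain ⟨n, g, hg, hgint⟩ := exists_integral_inj_algHom_of_fg k (MvPolynomial σ k ⧸ J)
  obtain ⟨m, h, hh, hhint⟩ := exists_integral_inj_algHom_of_fg k (MvPolynomial σ k ⧸ chartIdeal J i)
  have h1 := ringKrullDim_eq_of_noether g hg hgint
  rw [hdim] at h1
  have h2 := trdeg_quotient_eq hJ hp hi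
  rw [trdeg_eq_of_noether g hg hgint, trdeg_eq_of_noether h hh hhint] at h2
  have h3 : n = 2 := by exact_mod_cast h1.symm
  have h4 : n = m + 1 := by exact_mod_cast h2
  obtain rfl : m = 1 := by omega
  exact ⟨h, hh, hhint⟩

end Dimension

end AdjointCurve

/-! ### Conductors of local rings -/

namespace AdjointCurve

section LocalConductor

/-- Otherwise the colon ideal of `a` into `C` would be contained in a maximal ideal. -/
theorem mem_of_forall_prime {A : Type*} [CommRing A] {C : Ideal A} {a : A}
    (h : ∀ Q : Ideal A, Q.IsPrime → ∃ s, s ∉ Q ∧ s * a ∈ C) : a ∈ C := by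
  by_contra ha
  let D : Ideal A := C.colon {a}
  have hD : ∀ {s}, s ∈ D ↔ s * a ∈ C := fun {s} => by
    simp only [D, Submodule.mem_colon_singleton, smul_eq_mul]
  obtain ⟨Q, hQ, hDQ⟩ := D.exists_le_maximal (fun h => ha (by
    have := hD.mp ((Ideal.eq_top_iff_one D).mp h)
    rwa [one_mul] at this))
  obtain ⟨s, hs, hsa⟩ := h Q hQ.isPrime
  exact hs (hDQ (hD.mpr hsa))

variable {A L : Type*} [CommRing A] [CommRing L] [IsDomain L] [Algebra A L]

theorem isFractionRing_of_isLocalization (M : Submonoid A) [IsLocalization M L] [FaithfulSMul A L] :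
    IsFractionRing A (FractionRing L) := by
  have : FaithfulSMul A (FractionRing L) := .trans A L _
  refine IsFractionRing.of_field A (FractionRing L) fun z => ?_
  obtain ⟨x, y, hy, rfl⟩ := IsFractionRing.div_surjective (A := L) z
  obtain ⟨⟨a, s⟩, ha⟩ := IsLocalization.surj M x
  obtain ⟨⟨b, t⟩, hb⟩ := IsLocalization.surj M y
  refine ⟨a * t, b * s, ?_⟩
  have hs : algebraMap L (FractionRing L) (algebraMap A L s) ≠ 0 :=
    ((IsLocalization.map_units L s).map _).ne_zero
  have ht : algebraMap L (FractionRing L) (algebraMap A L t) ≠ 0 :=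
    ((IsLocalization.map_units L t).map _).ne_zero
  simp only [map_mul, IsScalarTower.algebraMap_apply A L (FractionRing L), ← ha, ← hb]
  rw [mul_assoc, mul_assoc, mul_comm (algebraMap L (FractionRing L) (algebraMap A L t)),
    mul_div_mul_right _ _ (mul_ne_zero hs ht)]

variable [IsDomain A]

/-- The conductor commutes with localization. -/
theorem algebraMap_mem_conductorIdeal_iff (M : Submonoid A) [IsLocalization M L]
    [FaithfulSMul A L]
    [Module.Finite A (integralClosure A (FractionRing A))] {a : A} :
    algebraMap A L a ∈ conductorIdeal L ↔ ∃ s ∈ M, s * a ∈ conductorIdeal A := by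
  have := isFractionRing_of_isLocalization (L := L) M
  have h3 : Module.Finite A (integralClosure A (FractionRing L)) :=
    Module.Finite.equiv (FractionRing.algEquiv A (FractionRing L)).mapIntegralClosure.toLinearEquiv
  obtain ⟨k, z, hz⟩ := Module.Finite.exists_fin (R := A) (M := integralClosure A (FractionRing L))
  rw [mem_conductorIdeal_iff (FractionRing L)]
  constructor
  · intro ha
    -- Each integral `z` needs its own denominator `s`; as the normalization is finite, the product
    -- over its generators serves for all.
    have key : ∀ z : FractionRing L, IsIntegral A z → ∃ s ∈ M, ∃ c : A,
        algebraMap A (FractionRing L) c = algebraMap A (FractionRing L) (s * a) * z := by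
      intro z hz
      obtain ⟨l, hl⟩ := ha z hz.tower_top
      obtain ⟨⟨c, s⟩, hc⟩ := IsLocalization.surj M l
      refine ⟨s, s.2, c, ?_⟩
      rw [IsScalarTower.algebraMap_apply A L (FractionRing L), ← hc, map_mul, hl, map_mul,
        ← IsScalarTower.algebraMap_apply, ← IsScalarTower.algebraMap_apply]
      ring
    choose s hs c hc using fun i => key (z i) (z i).2
    refine ⟨∏ i, s i, prod_mem fun i _ => hs i, ?_⟩
    rw [mem_conductorIdeal_iff (FractionRing L)]
    intro w hw
    obtain ⟨w, rfl⟩ : ∃ w' : integralClosure A (FractionRing L), (w' : FractionRing L) = w :=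
      ⟨⟨w, hw⟩, rfl⟩
    have hw' : w ∈ Submodule.span A (Set.range z) := hz ▸ Submodule.mem_top
    induction hw' using Submodule.span_induction with
    | mem x hx =>
      obtain ⟨i, rfl⟩ := hx
      obtain ⟨d, hd⟩ : s i ∣ ∏ i, s i := Finset.dvd_prod_of_mem s (Finset.mem_univ i)
      refine ⟨d * c i, ?_⟩
      rw [hd, map_mul, hc]
      simp only [map_mul]
      ring
    | zero => exact ⟨0, by simp⟩
    | add x y _ _ hx hy =>
      obtain ⟨a, ha⟩ := hx x.2
      obtain ⟨b, hb⟩ := hy y.2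
      exact ⟨a + b, by rw [map_add, ha, hb, Subalgebra.coe_add]; ring⟩
    | smul t x _ hx =>
      obtain ⟨a, ha⟩ := hx x.2
      refine ⟨t * a, ?_⟩
      rw [map_mul, ha, Subalgebra.coe_smul, Algebra.smul_def]
      ring
  · rintro ⟨s, hs, hsa⟩ w hw
    rw [mem_conductorIdeal_iff (FractionRing L)] at hsa
    obtain ⟨t, ht⟩ := IsIntegral.exists_multiple_integral_of_isLocalization M w hw
    obtain ⟨c, hc⟩ := hsa _ ht
    obtain ⟨u, hu⟩ := (IsLocalization.map_units L (⟨s, hs⟩ * t)).exists_left_inv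
    refine ⟨u * algebraMap A L c, ?_⟩
    have h1 := congrArg (algebraMap L (FractionRing L)) hu
    rw [map_mul, ← IsScalarTower.algebraMap_apply, ← IsScalarTower.algebraMap_apply, hc,
      Submonoid.smul_def, Algebra.smul_def]
    simp only [map_mul, map_one, Submonoid.coe_mul, ← IsScalarTower.algebraMap_apply] at h1 ⊢
    linear_combination (algebraMap A (FractionRing L) a * w) * h1

/-- A regular local ring of dimension at most one is integrally closed. -/
theorem conductorIdeal_eq_top_of_isRegularLocalRing [IsRegularLocalRing L]
    (hdim : ringKrullDim L ≤ 1) : conductorIdeal L = ⊤ := by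
  have h1 := (IsRegularLocalRing.iff_finrank_cotangentSpace (R := L)).mp inferInstance
  have h2 : Module.finrank (IsLocalRing.ResidueField L) (IsLocalRing.CotangentSpace L) ≤ 1 := by
    rw [← h1] at hdim
    exact_mod_cast hdim
  -- Cotangent dimension at most one characterizes fields and discrete valuation rings among
  -- Noetherian local domains; these are integrally closed.
  have h3 := ((tfae_of_isNoetherianRing_of_isLocalRing_of_isDomain L).out 5 3).mp h2
  have h4 := h3.1
  rw [Ideal.eq_top_iff_one, mem_conductorIdeal_iff (FractionRing L)]
  intro z hz
  obtain ⟨c, hc⟩ := IsIntegrallyClosed.isIntegral_iff.mp hz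
  exact ⟨c, by rw [hc, map_one, one_mul]⟩

end LocalConductor

end AdjointCurve

/-! ### The local ring of a curve as a localization of a chart -/

namespace AdjointCurve

open MvPolynomial

attribute [local instance] MvPolynomial.gradedAlgebra

section LocalRing

variable {r : ℕ} {k : Type} [Field k] (P : ProjectiveSpectrum (grading r k))

/-- The fraction `F / G` in the local ring of projective space at `P`. -/
noncomputable def fracAt {n : ℕ} {F G : MvPolynomial (Fin (r + 1)) k} (hF : F.IsHomogeneous n)
    (hG : G.IsHomogeneous n) (hGP : G ∉ P.asHomogeneousIdeal.toIdeal) : ambientLocalRing P :=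
  HomogeneousLocalization.mk ⟨n, ⟨F, hF⟩, ⟨G, hG⟩, hGP⟩

variable {P}

theorem val_fracAt {n : ℕ} {F G : MvPolynomial (Fin (r + 1)) k} (hF : F.IsHomogeneous n)
    (hG : G.IsHomogeneous n) (hGP : G ∉ P.asHomogeneousIdeal.toIdeal) :
    (fracAt P hF hG hGP).val = Localization.mk F ⟨G, hGP⟩ := rfl

theorem exists_eq_fracAt (y : ambientLocalRing P) :
    ∃ (n : ℕ) (F G : MvPolynomial (Fin (r + 1)) k) (hF : F.IsHomogeneous n)
      (hG : G.IsHomogeneous n) (hGP : G ∉ P.asHomogeneousIdeal.toIdeal),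
      y = fracAt P hF hG hGP := by
  obtain ⟨⟨n, F, G, h⟩, rfl⟩ := HomogeneousLocalization.mk_surjective y
  exact ⟨n, F, G, F.2, G.2, h, rfl⟩

theorem exists_homogeneousComponent_notMem {P : HomogeneousIdeal (grading r k)}
    {s : MvPolynomial (Fin (r + 1)) k} (hs : s ∉ P.toIdeal) :
    ∃ d, homogeneousComponent d s ∉ P.toIdeal := by
  by_contra! h
  exact hs ((mem_iff_homogeneousComponent_mem P.isHomogeneous s).mpr h)

theorem homogeneousComponent_mul_of_isHomogeneous {σ : Type} {n d : ℕ} {s F : MvPolynomial σ k}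
    (hF : F.IsHomogeneous n) :
    homogeneousComponent (d + n) (s * F) = homogeneousComponent d s * F := by
  have h := DirectSum.coe_decompose_mul_add_of_right_mem (homogeneousSubmodule σ k) (i := d)
    (a := s) (b := F) (j := n) hF
  simp only [← decomposition.decompose'_apply]
  exact h

/-- The multiplier in the localization may be replaced by a homogeneous component outside the prime,
since `J` is homogeneous. -/
theorem fracAt_mem_idealAt_iff {J : Ideal (MvPolynomial (Fin (r + 1)) k)}
    (hJ : J.IsHomogeneous (grading r k)) {n : ℕ} {F G : MvPolynomial (Fin (r + 1)) k}
    (hF : F.IsHomogeneous n) (hG : G.IsHomogeneous n)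
    (hGP : G ∉ P.asHomogeneousIdeal.toIdeal) :
    fracAt P hF hG hGP ∈ idealAt J P ↔
      ∃ (d : ℕ) (S : MvPolynomial (Fin (r + 1)) k), S.IsHomogeneous d ∧
        S ∉ P.asHomogeneousIdeal.toIdeal ∧ S * F ∈ J := by
  rw [idealAt, Ideal.mem_comap, HomogeneousLocalization.algebraMap_apply, val_fracAt,
    Localization.mk_eq_mk', IsLocalization.mk'_mem_map_algebraMap_iff]
  constructor
  · rintro ⟨s, hs, h⟩
    obtain ⟨d, hd⟩ := exists_homogeneousComponent_notMem hs
    refine ⟨d, _, homogeneousComponent_isHomogeneous d s, hd, ?_⟩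
    rw [← homogeneousComponent_mul_of_isHomogeneous hF]
    exact homogeneousComponent_mem_of_mem hJ h _
  · rintro ⟨d, S, -, hS, h⟩
    exact ⟨S, hS, h⟩

theorem exists_X_notMem (P : ProjectiveSpectrum (grading r k)) :
    ∃ i, X i ∉ P.asHomogeneousIdeal.toIdeal := by
  by_contra! h
  refine P.not_irrelevant_le fun f hf => ?_
  have h1 : Ideal.span (X '' Set.univ) ≤ P.asHomogeneousIdeal.toIdeal := by
    rw [Ideal.span_le]
    rintro _ ⟨i, -, rfl⟩
    exact h i
  refine h1 ((mem_ideal_span_X_image).mpr fun m hm => ?_)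
  by_contra! h2
  have h3 : m = 0 := Finsupp.ext fun i => h2 i trivial
  have h4 : (homogeneousComponent 0 f) = 0 := by
    rw [← decomposition.decompose'_apply]
    exact (HomogeneousIdeal.mem_irrelevant_iff (grading r k) f).mp hf
  rw [homogeneousComponent_zero, C_eq_zero] at h4
  rw [h3, mem_support_iff] at hm
  exact hm h4

variable (P) in
/-- The map from the polynomial ring to the local ring of projective space at `P` that is given
by the affine chart `X i = 1`. -/
noncomputable def chartHom {i : Fin (r + 1)} (hi : X i ∉ P.asHomogeneousIdeal.toIdeal) :
    MvPolynomial (Fin (r + 1)) k →+* ambientLocalRing P :=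
  eval₂Hom ((HomogeneousLocalization.fromZeroRingHom (grading r k)
      P.asHomogeneousIdeal.toIdeal.primeCompl).comp (algebraMap k (grading r k 0)))
    fun j => fracAt P (isHomogeneous_X k j) (isHomogeneous_X k i) hi

theorem pow_notMem {i : Fin (r + 1)} (hi : X i ∉ P.asHomogeneousIdeal.toIdeal) (n : ℕ) :
    X i ^ n ∉ P.asHomogeneousIdeal.toIdeal := fun h => hi (P.isPrime.mem_of_pow_mem n h)

theorem isHomogeneous_X_pow' (i : Fin (r + 1)) (n : ℕ) :
    (X i ^ n : MvPolynomial (Fin (r + 1)) k).IsHomogeneous n := isHomogeneous_X_pow i n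

theorem chartHom_of_isHomogeneous {i : Fin (r + 1)} (hi : X i ∉ P.asHomogeneousIdeal.toIdeal)
    {n : ℕ} {F : MvPolynomial (Fin (r + 1)) k} (hF : F.IsHomogeneous n) :
    chartHom P hi F = fracAt P hF (isHomogeneous_X_pow' i n) (pow_notMem hi n) := by
  apply HomogeneousLocalization.val_injective
  let L := Localization.AtPrime P.asHomogeneousIdeal.toIdeal
  have h1 : (algebraMap (ambientLocalRing P) L).comp (chartHom P hi) =
      eval₂Hom ((algebraMap (MvPolynomial (Fin (r + 1)) k) L).comp C) fun j =>
        Localization.mk 1 ⟨X i, hi⟩ * algebraMap (MvPolynomial (Fin (r + 1)) k) L (X j) := by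
    refine MvPolynomial.ringHom_ext (fun a => ?_) fun j => ?_
    · simp only [chartHom, RingHom.comp_apply, eval₂Hom_C]
      rfl
    · simp only [chartHom, RingHom.comp_apply, eval₂Hom_X']
      rw [← Localization.mk_one_eq_algebraMap, Localization.mk_mul, one_mul, mul_one]
      rfl
  have h2 : eval₂Hom ((algebraMap (MvPolynomial (Fin (r + 1)) k) L).comp C) (fun j =>
      algebraMap (MvPolynomial (Fin (r + 1)) k) L (X j)) = algebraMap _ L :=
    MvPolynomial.ringHom_ext (fun a => by simp) fun j => by simp
  refine (congrArg (fun h => h F) h1).trans ?_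
  refine (eval₂_mul_of_isHomogeneous hF _ _ _).trans ?_
  rw [← coe_eval₂Hom, h2, val_fracAt, Localization.mk_pow, ← Localization.mk_one_eq_algebraMap,
    Localization.mk_mul, one_pow, one_mul, mul_one]
  rfl

theorem fracAt_mul {n m : ℕ} {F G F' G' : MvPolynomial (Fin (r + 1)) k} (hF : F.IsHomogeneous n)
    (hG : G.IsHomogeneous n) (hGP : G ∉ P.asHomogeneousIdeal.toIdeal) (hF' : F'.IsHomogeneous m)
    (hG' : G'.IsHomogeneous m) (hGP' : G' ∉ P.asHomogeneousIdeal.toIdeal)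
    (h : G * G' ∉ P.asHomogeneousIdeal.toIdeal) :
    fracAt P hF hG hGP * fracAt P hF' hG' hGP' = fracAt P (hF.mul hF') (hG.mul hG') h := rfl

theorem fracAt_self {n : ℕ} {G : MvPolynomial (Fin (r + 1)) k} (hG : G.IsHomogeneous n)
    (hGP : G ∉ P.asHomogeneousIdeal.toIdeal) : fracAt P hG hG hGP = 1 := by
  apply HomogeneousLocalization.val_injective
  rw [val_fracAt, HomogeneousLocalization.val_one]
  exact Localization.mk_self (⟨G, hGP⟩ : P.asHomogeneousIdeal.toIdeal.primeCompl)

theorem fracAt_eq {n m : ℕ} {F G F' G' : MvPolynomial (Fin (r + 1)) k} (hF : F.IsHomogeneous n)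
    (hG : G.IsHomogeneous n) (hGP : G ∉ P.asHomogeneousIdeal.toIdeal) (hF' : F'.IsHomogeneous m)
    (hG' : G'.IsHomogeneous m) (hGP' : G' ∉ P.asHomogeneousIdeal.toIdeal) (h : G' * F = G * F') :
    fracAt P hF hG hGP = fracAt P hF' hG' hGP' := by
  apply HomogeneousLocalization.val_injective
  rw [val_fracAt, val_fracAt, Localization.mk_eq_mk_iff, Localization.r_iff_exists]
  exact ⟨1, by simp [h]⟩

theorem isUnit_fracAt {n : ℕ} {F G : MvPolynomial (Fin (r + 1)) k} (hF : F.IsHomogeneous n)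
    (hG : G.IsHomogeneous n) (hGP : G ∉ P.asHomogeneousIdeal.toIdeal)
    (hFP : F ∉ P.asHomogeneousIdeal.toIdeal) : IsUnit (fracAt P hF hG hGP) := by
  refine IsUnit.of_mul_eq_one (fracAt P hG hF hFP) ?_
  rw [fracAt_mul _ _ _ _ _ _ fun h => (P.isPrime.mem_or_mem h).elim hGP hFP,
    ← fracAt_self (hG.mul hF) fun h => (P.isPrime.mem_or_mem h).elim hGP hFP]
  exact fracAt_eq _ _ _ _ _ _ (by ring)

variable {I : Ideal (MvPolynomial (Fin (r + 1)) k)}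

theorem idealAt_mono {J J' : Ideal (MvPolynomial (Fin (r + 1)) k)} (h : J ≤ J') :
    idealAt J P ≤ idealAt J' P := Ideal.comap_mono (Ideal.map_mono h)

theorem chartHom_X_self {i : Fin (r + 1)} (hi : X i ∉ P.asHomogeneousIdeal.toIdeal) :
    chartHom P hi (X i) = 1 := by
  rw [chartHom, eval₂Hom_X', fracAt_self]

theorem fracAt_mem_idealAt {J : Ideal (MvPolynomial (Fin (r + 1)) k)} {n : ℕ}
    {F G : MvPolynomial (Fin (r + 1)) k} (hF : F.IsHomogeneous n) (hG : G.IsHomogeneous n)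
    (hGP : G ∉ P.asHomogeneousIdeal.toIdeal) (h : F ∈ J) : fracAt P hF hG hGP ∈ idealAt J P := by
  rw [idealAt, Ideal.mem_comap, HomogeneousLocalization.algebraMap_apply, val_fracAt,
    Localization.mk_eq_mk', IsLocalization.mk'_mem_map_algebraMap_iff]
  exact ⟨1, one_mem _, by rwa [one_mul]⟩

theorem chartIdeal_le_comap (hI : I.IsHomogeneous (grading r k)) {i : Fin (r + 1)}
    (hi : X i ∉ P.asHomogeneousIdeal.toIdeal) :
    chartIdeal I i ≤ (idealAt I P).comap (chartHom P hi) := by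
  refine sup_le (fun f hf => ?_) ?_
  · rw [Ideal.mem_comap, ← sum_homogeneousComponent f, map_sum]
    refine sum_mem fun d _ => ?_
    rw [chartHom_of_isHomogeneous hi (homogeneousComponent_isHomogeneous d f)]
    exact fracAt_mem_idealAt _ _ _ (homogeneousComponent_mem_of_mem hI hf d)
  · rw [Ideal.span_singleton_le_iff_mem, Ideal.mem_comap, map_sub, map_one, chartHom_X_self, sub_self]
    exact zero_mem _

variable (P) in
/-- The map from the coordinate ring of an affine chart to the local ring at `P`. -/
noncomputable def chartQuotientHom (hI : I.IsHomogeneous (grading r k)) {i : Fin (r + 1)}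
    (hi : X i ∉ P.asHomogeneousIdeal.toIdeal) :
    MvPolynomial (Fin (r + 1)) k ⧸ chartIdeal I i →+* localRing I P :=
  Ideal.quotientMap (idealAt I P) (chartHom P hi) (chartIdeal_le_comap hI hi)

theorem chartQuotientHom_mk (hI : I.IsHomogeneous (grading r k)) {i : Fin (r + 1)}
    (hi : X i ∉ P.asHomogeneousIdeal.toIdeal) {n : ℕ} {F : MvPolynomial (Fin (r + 1)) k}
    (hF : F.IsHomogeneous n) :
    chartQuotientHom P hI hi (Ideal.Quotient.mk _ F) = Ideal.Quotient.mk (idealAt I P)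
      (fracAt P hF (isHomogeneous_X_pow' i n) (pow_notMem hi n)) := by
  rw [← chartHom_of_isHomogeneous hi hF]
  rfl

/-- Every element of the coordinate ring of a chart is the class of a homogeneous polynomial. -/
theorem exists_isHomogeneous_mk_eq {σ : Type} (J : Ideal (MvPolynomial σ k)) (i : σ)
    (a : MvPolynomial σ k ⧸ chartIdeal J i) :
    ∃ (n : ℕ) (F : MvPolynomial σ k), F.IsHomogeneous n ∧ Ideal.Quotient.mk _ F = a := by
  obtain ⟨f, rfl⟩ := Ideal.Quotient.mk_surjective a
  obtain ⟨n, F, hF, h⟩ := exists_isHomogeneous_sub_mem i f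
  exact ⟨n, F, hF, Ideal.Quotient.eq.mpr (span_le_chartIdeal J i h)⟩

theorem isUnit_chartQuotientHom_iff (hI : I.IsHomogeneous (grading r k))
    (hIP : I ≤ P.asHomogeneousIdeal.toIdeal) {i : Fin (r + 1)}
    (hi : X i ∉ P.asHomogeneousIdeal.toIdeal) {n : ℕ} {F : MvPolynomial (Fin (r + 1)) k}
    (hF : F.IsHomogeneous n) :
    IsUnit (chartQuotientHom P hI hi (Ideal.Quotient.mk _ F)) ↔
      F ∉ P.asHomogeneousIdeal.toIdeal := by
  rw [chartQuotientHom_mk hI hi hF]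
  refine ⟨fun h hFP => ?_, fun h => (isUnit_fracAt _ _ _ h).map _⟩
  obtain ⟨y, hy⟩ := h.exists_left_inv
  obtain ⟨y, rfl⟩ := Ideal.Quotient.mk_surjective y
  rw [← map_mul, ← map_one (Ideal.Quotient.mk _), Ideal.Quotient.eq] at hy
  have h1 := idealAt_mono hIP hy
  have h2 : (1 : ambientLocalRing P) ∈ idealAt P.asHomogeneousIdeal.toIdeal P := by
    have h3 := sub_mem (Ideal.mul_mem_left _ y (fracAt_mem_idealAt hF (isHomogeneous_X_pow' i n)
      (pow_notMem hi n) hFP)) h1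
    simpa using h3
  rw [← fracAt_self (isHomogeneous_one (Fin (r + 1)) k) (fun h => P.isPrime.ne_top
    ((Ideal.eq_top_iff_one _).mpr h)), fracAt_mem_idealAt_iff P.asHomogeneousIdeal.isHomogeneous] at h2
  obtain ⟨d, S, -, hS, h⟩ := h2
  exact hS (by rwa [mul_one] at h)

theorem chartQuotientHom_injective (hI : I.IsHomogeneous (grading r k)) (hp : I.IsPrime)
    (hIP : I ≤ P.asHomogeneousIdeal.toIdeal) {i : Fin (r + 1)}
    (hi : X i ∉ P.asHomogeneousIdeal.toIdeal) :
    Function.Injective (chartQuotientHom P hI hi) := by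
  rw [injective_iff_map_eq_zero]
  intro a ha
  obtain ⟨n, F, hF, rfl⟩ := exists_isHomogeneous_mk_eq I i a
  rw [chartQuotientHom_mk hI hi hF, Ideal.Quotient.eq_zero_iff_mem, fracAt_mem_idealAt_iff hI] at ha
  obtain ⟨d, S, -, hS, h⟩ := ha
  rw [Ideal.Quotient.eq_zero_iff_mem]
  exact le_chartIdeal I i ((hp.mem_or_mem h).resolve_left fun h => hS (hIP h))

/-- A fraction `F / G` of degree `n` is the quotient of `F / X_i ^ n` by `G / X_i ^ n`. Inverting
everything that becomes a unit avoids naming the prime of the chart that belongs to `P`. -/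
theorem isLocalization_chartQuotientHom (hI : I.IsHomogeneous (grading r k)) (hp : I.IsPrime)
    (hIP : I ≤ P.asHomogeneousIdeal.toIdeal) {i : Fin (r + 1)}
    (hi : X i ∉ P.asHomogeneousIdeal.toIdeal) :
    letI := (chartQuotientHom P hI hi).toAlgebra
    IsLocalization ((IsUnit.submonoid (localRing I P)).comap (chartQuotientHom P hI hi))
      (localRing I P) := by
  let _ := (chartQuotientHom P hI hi).toAlgebra
  refine ⟨fun a => a.2, fun z => ?_,
    fun {x y} h => ⟨1, by rw [chartQuotientHom_injective hI hp hIP hi h]⟩⟩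
  obtain ⟨z, rfl⟩ := Ideal.Quotient.mk_surjective z
  obtain ⟨n, F, G, hF, hG, hGP, rfl⟩ := exists_eq_fracAt z
  refine ⟨⟨Ideal.Quotient.mk _ F, Ideal.Quotient.mk _ G,
    (isUnit_chartQuotientHom_iff hI hIP hi hG).mpr hGP⟩, ?_⟩
  change _ * chartQuotientHom P hI hi (Ideal.Quotient.mk _ G) =
    chartQuotientHom P hI hi (Ideal.Quotient.mk _ F)
  rw [chartQuotientHom_mk hI hi hF, chartQuotientHom_mk hI hi hG, ← map_mul,
    fracAt_mul _ _ _ _ _ _ fun h => (P.isPrime.mem_or_mem h).elim hGP (pow_notMem hi n)]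
  congr 1
  exact fracAt_eq _ _ _ _ _ _ (by ring)

theorem localRing_isDomain (hI : I.IsHomogeneous (grading r k)) (hp : I.IsPrime)
    (hIP : I ≤ P.asHomogeneousIdeal.toIdeal) : IsDomain (localRing I P) := by
  obtain ⟨i, hi⟩ := exists_X_notMem P
  have := chartIdeal_isPrime hI hp fun h => hi (hIP h)
  let _ := (chartQuotientHom P hI hi).toAlgebra
  have := isLocalization_chartQuotientHom hI hp hIP hi
  refine IsLocalization.isDomain_of_le_nonZeroDivisors (localRing I P)
    (M := (IsUnit.submonoid (localRing I P)).comap (chartQuotientHom P hI hi)) fun a ha => ?_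
  obtain ⟨n, F, hF, rfl⟩ := exists_isHomogeneous_mk_eq I i a
  have h1 := (isUnit_chartQuotientHom_iff hI hIP hi hF).mp ha
  refine mem_nonZeroDivisors_of_ne_zero fun h => h1 (hIP ?_)
  rw [Ideal.Quotient.eq_zero_iff_mem] at h
  exact (mem_chartIdeal_iff_of_isPrime hI hp (fun h => hi (hIP h)) hF).mp h

theorem ringKrullDim_localRing_le (hI : I.IsHomogeneous (grading r k)) (hp : I.IsPrime)
    (hIP : I ≤ P.asHomogeneousIdeal.toIdeal) {i : Fin (r + 1)}
    (hi : X i ∉ P.asHomogeneousIdeal.toIdeal) :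
    ringKrullDim (localRing I P) ≤ ringKrullDim (MvPolynomial (Fin (r + 1)) k ⧸ chartIdeal I i) := by
  let _ := (chartQuotientHom P hI hi).toAlgebra
  have := isLocalization_chartQuotientHom hI hp hIP hi
  refine Order.krullDim_le_of_strictMono (PrimeSpectrum.comap (chartQuotientHom P hI hi))
    (Monotone.strictMono_of_injective (fun _ _ h => Ideal.comap_mono h) ?_)
  exact PrimeSpectrum.localization_comap_injective (localRing I P)
    ((IsUnit.submonoid (localRing I P)).comap (chartQuotientHom P hI hi))

/-- The ideal of the conductor of an affine chart. -/
noncomputable def chartConductor (I : Ideal (MvPolynomial (Fin (r + 1)) k)) (i : Fin (r + 1)) :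
    Ideal (MvPolynomial (Fin (r + 1)) k) :=
  (conductorIdeal (MvPolynomial (Fin (r + 1)) k ⧸ chartIdeal I i)).comap (Ideal.Quotient.mk _)

theorem chartIdeal_le_chartConductor (I : Ideal (MvPolynomial (Fin (r + 1)) k)) (i : Fin (r + 1)) :
    chartIdeal I i ≤ chartConductor I i := by
  intro f hf
  rw [chartConductor, Ideal.mem_comap, Ideal.Quotient.eq_zero_iff_mem.mpr hf]
  exact zero_mem _

/-- Up to the unit given by `G`, the fraction is the image of `F` from the chart ring, and the
conductor commutes with localization. -/
theorem mk_fracAt_mem_conductorIdeal_iff (hI : I.IsHomogeneous (grading r k)) (hp : I.IsPrime)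
    (hIP : I ≤ P.asHomogeneousIdeal.toIdeal) {i : Fin (r + 1)}
    (hi : X i ∉ P.asHomogeneousIdeal.toIdeal)
    (hfin : Module.Finite (MvPolynomial (Fin (r + 1)) k ⧸ chartIdeal I i)
      (integralClosure (MvPolynomial (Fin (r + 1)) k ⧸ chartIdeal I i)
        (FractionRing (MvPolynomial (Fin (r + 1)) k ⧸ chartIdeal I i))))
    {n : ℕ} {F G : MvPolynomial (Fin (r + 1)) k} (hF : F.IsHomogeneous n) (hG : G.IsHomogeneous n)
    (hGP : G ∉ P.asHomogeneousIdeal.toIdeal) :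
    Ideal.Quotient.mk (idealAt I P) (fracAt P hF hG hGP) ∈ conductorIdeal (localRing I P) ↔
      ∃ (d : ℕ) (S : MvPolynomial (Fin (r + 1)) k), S.IsHomogeneous d ∧
        S ∉ P.asHomogeneousIdeal.toIdeal ∧ S * F ∈ chartConductor I i := by
  have := chartIdeal_isPrime hI hp fun h => hi (hIP h)
  have := localRing_isDomain hI hp hIP
  let _ := (chartQuotientHom P hI hi).toAlgebra
  have hloc := isLocalization_chartQuotientHom hI hp hIP hi
  have : FaithfulSMul (MvPolynomial (Fin (r + 1)) k ⧸ chartIdeal I i) (localRing I P) :=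
    (faithfulSMul_iff_algebraMap_injective _ _).mpr (chartQuotientHom_injective hI hp hIP hi)
  have h1 : Ideal.Quotient.mk (idealAt I P) (fracAt P hF hG hGP) *
      chartQuotientHom P hI hi (Ideal.Quotient.mk _ G) =
        chartQuotientHom P hI hi (Ideal.Quotient.mk _ F) := by
    rw [chartQuotientHom_mk hI hi hF, chartQuotientHom_mk hI hi hG, ← map_mul,
      fracAt_mul _ _ _ _ _ _ fun h => (P.isPrime.mem_or_mem h).elim hGP (pow_notMem hi n)]
    congr 1
    exact fracAt_eq _ _ _ _ _ _ (by ring)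
  rw [← Ideal.mul_unit_mem_iff_mem _ ((isUnit_chartQuotientHom_iff hI hIP hi hG).mpr hGP), h1]
  refine (algebraMap_mem_conductorIdeal_iff (L := localRing I P)
    ((IsUnit.submonoid (localRing I P)).comap (chartQuotientHom P hI hi))).trans ?_
  constructor
  · rintro ⟨s, hs, h⟩
    obtain ⟨d, S, hS, rfl⟩ := exists_isHomogeneous_mk_eq I i s
    exact ⟨d, S, hS, (isUnit_chartQuotientHom_iff hI hIP hi hS).mp hs, h⟩
  · rintro ⟨d, S, hS, hSP, h⟩
    exact ⟨_, (isUnit_chartQuotientHom_iff hI hIP hi hS).mpr hSP, h⟩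

end LocalRing

end AdjointCurve

/-! ### The Gorenstein adjoint ideal and the chart conductors -/

namespace AdjointCurve

open MvPolynomial

attribute [local instance] MvPolynomial.gradedAlgebra

section GorensteinAdjoint

variable {r : ℕ} {k : Type} [Field k] {I : Ideal (MvPolynomial (Fin (r + 1)) k)}

theorem mem_homogeneousCore_iff {C : Ideal (MvPolynomial (Fin (r + 1)) k)} {n : ℕ}
    {F : MvPolynomial (Fin (r + 1)) k} (hF : F.IsHomogeneous n) :
    F ∈ (C.homogeneousCore (grading r k)).toIdeal ↔ F ∈ C :=
  ⟨fun h => Ideal.toIdeal_homogeneousCore_le _ C h,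
    fun h => Ideal.mem_homogeneousCore_of_homogeneous_of_mem ⟨n, hF⟩ h⟩

/-- The point of projective space given by a prime ideal that does not contain the variable
`X i`. -/
noncomputable def pointOfPrime (Q : Ideal (MvPolynomial (Fin (r + 1)) k)) [hQ : Q.IsPrime]
    {i : Fin (r + 1)} (hi : X i ∉ Q) : ProjectiveSpectrum (grading r k) where
  asHomogeneousIdeal := Q.homogeneousCore (grading r k)
  isPrime := hQ.homogeneousCore
  not_irrelevant_le h := hi (Ideal.toIdeal_homogeneousCore_le _ Q
    (h (HomogeneousIdeal.mem_irrelevant_of_mem _ zero_lt_one (isHomogeneous_X k i))))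

theorem mem_pointOfPrime_iff (Q : Ideal (MvPolynomial (Fin (r + 1)) k)) [Q.IsPrime]
    {i : Fin (r + 1)} (hi : X i ∉ Q) {n : ℕ} {F : MvPolynomial (Fin (r + 1)) k}
    (hF : F.IsHomogeneous n) : F ∈ (pointOfPrime Q hi).asHomogeneousIdeal.toIdeal ↔ F ∈ Q :=
  mem_homogeneousCore_iff hF

theorem le_pointOfPrime (hI : I.IsHomogeneous (grading r k))
    (Q : Ideal (MvPolynomial (Fin (r + 1)) k)) [Q.IsPrime] {i : Fin (r + 1)} (hi : X i ∉ Q)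
    (h : I ≤ Q) : I ≤ (pointOfPrime Q hi).asHomogeneousIdeal.toIdeal := by
  have h1 := Ideal.homogeneousCore_mono (grading r k) h
  rw [← hI.toIdeal_homogeneousCore_eq_self]
  exact h1

theorem X_notMem_of_chartIdeal_le {Q : Ideal (MvPolynomial (Fin (r + 1)) k)} (hQ : Q.IsPrime)
    {i : Fin (r + 1)} (h : chartIdeal I i ≤ Q) : X i ∉ Q := by
  intro hi
  refine hQ.ne_top ((Ideal.eq_top_iff_one Q).mpr ?_)
  have h1 := h (span_le_chartIdeal I i (Ideal.mem_span_singleton_self _))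
  simpa using sub_mem hi h1

variable (hI : I.IsHomogeneous (grading r k)) (hp : I.IsPrime)
  (hfin : ∀ i, X i ∉ I → Module.Finite (MvPolynomial (Fin (r + 1)) k ⧸ chartIdeal I i)
    (integralClosure (MvPolynomial (Fin (r + 1)) k ⧸ chartIdeal I i)
      (FractionRing (MvPolynomial (Fin (r + 1)) k ⧸ chartIdeal I i))))
include hI hp hfin

/-- Suppose a prime `Q` contains the colon ideal of `F` into the conductor of chart `j` but not `X
i`. It gives a point on both charts. There the local conductor, computed on chart `i`, contains the
class of `F`; computed on chart `j`, it yields a multiplier outside `Q` that lies in the colon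
ideal. -/
theorem exists_pow_mul_mem_chartConductor {i j : Fin (r + 1)} {n : ℕ}
    {F : MvPolynomial (Fin (r + 1)) k} (hF : F.IsHomogeneous n) (h : F ∈ chartConductor I i) :
    ∃ m, X i ^ m * F ∈ chartConductor I j := by
  let D : Ideal (MvPolynomial (Fin (r + 1)) k) := (chartConductor I j).colon {F}
  have hD : ∀ {s}, s ∈ D ↔ s * F ∈ chartConductor I j := fun {s} => by
    simp only [D, Submodule.mem_colon_singleton, smul_eq_mul]
  suffices h1 : X i ∈ D.radical by
    obtain ⟨m, hm⟩ := h1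
    exact ⟨m, hD.mp hm⟩
  rw [Ideal.radical_eq_sInf, Ideal.mem_sInf]
  rintro Q ⟨hDQ, hQ⟩
  by_contra hi
  have hIQ : chartIdeal I j ≤ Q := fun f hf =>
    hDQ (hD.mpr (Ideal.mul_mem_right _ _ (chartIdeal_le_chartConductor I j hf)))
  have hj := X_notMem_of_chartIdeal_le hQ hIQ
  have hIP := le_pointOfPrime hI Q hi ((le_chartIdeal I j).trans hIQ)
  have hiP : X i ∉ (pointOfPrime Q hi).asHomogeneousIdeal.toIdeal :=
    fun h => hi ((mem_pointOfPrime_iff Q hi (isHomogeneous_X k i)).mp h)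
  have hjP : X j ∉ (pointOfPrime Q hi).asHomogeneousIdeal.toIdeal :=
    fun h => hj ((mem_pointOfPrime_iff Q hi (isHomogeneous_X k j)).mp h)
  have h2 := (mk_fracAt_mem_conductorIdeal_iff hI hp hIP hiP (hfin i fun h => hiP (hIP h)) hF
    (isHomogeneous_X_pow' i n) (pow_notMem hiP n)).mpr
      ⟨0, 1, isHomogeneous_one _ _, fun h => (pointOfPrime Q hi).isPrime.ne_top
        ((Ideal.eq_top_iff_one _).mpr h), by rwa [one_mul]⟩
  obtain ⟨d, S, hS, hSP, hSF⟩ := (mk_fracAt_mem_conductorIdeal_iff hI hp hIP hjP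
    (hfin j fun h => hjP (hIP h)) hF (isHomogeneous_X_pow' i n) (pow_notMem hiP n)).mp h2
  exact hSP ((mem_pointOfPrime_iff Q hi hS).mpr (hDQ (hD.mpr hSF)))

variable (hX : ∀ i, X i ∉ I)
  (hdim : ∀ i, ringKrullDim (MvPolynomial (Fin (r + 1)) k ⧸ chartIdeal I i) ≤ 1)
include hX hdim

/-- The Gorenstein adjoint ideal in terms of the conductors of the affine charts. -/
theorem gorensteinAdjointIdeal_eq : gorensteinAdjointIdeal I =
    ⨅ i, ((chartConductor I i).homogeneousCore (grading r k)).toIdeal := by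
  refine le_antisymm (sSup_le ?_) (le_sSup ⟨?_, ?_⟩)
  · rintro J ⟨hJ, hJP⟩
    refine le_iInf fun i => ?_
    rw [← hJ.toIdeal_homogeneousCore_eq_self]
    refine Ideal.homogeneousCore_mono _ fun f hf => ?_
    rw [← sum_homogeneousComponent f]
    refine sum_mem fun n _ => ?_
    have hF := homogeneousComponent_isHomogeneous n f
    have hFJ := homogeneousComponent_mem_of_mem hJ hf n
    generalize homogeneousComponent n f = F at hF hFJ
    -- Membership in the chart conductor is checked prime by prime. At a singular point the
    -- hypothesis on `J` applies; at a regular point of a curve the conductor is everything.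
    refine Ideal.mem_comap.mpr (mem_of_forall_prime fun Q hQ => ?_)
    let Q' := Q.comap (Ideal.Quotient.mk (chartIdeal I i))
    have hIQ : chartIdeal I i ≤ Q' := fun f hf => by
      rw [Ideal.mem_comap, Ideal.Quotient.eq_zero_iff_mem.mpr hf]
      exact zero_mem _
    have hQ' : Q'.IsPrime := inferInstance
    have hi := X_notMem_of_chartIdeal_le hQ' hIQ
    have hIP := le_pointOfPrime hI Q' hi ((le_chartIdeal I i).trans hIQ)
    have hiP : X i ∉ (pointOfPrime Q' hi).asHomogeneousIdeal.toIdeal :=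
      fun h => hi ((mem_pointOfPrime_iff Q' hi (isHomogeneous_X k i)).mp h)
    have hmem : Ideal.Quotient.mk (idealAt I (pointOfPrime Q' hi))
        (fracAt (pointOfPrime Q' hi) hF (isHomogeneous_X_pow' i n) (pow_notMem hiP n)) ∈
          conductorIdeal (localRing I (pointOfPrime Q' hi)) := by
      by_cases hsing : pointOfPrime Q' hi ∈ singularLocus I
      · rw [← hJP _ hsing]
        exact Ideal.mem_map_of_mem _ (fracAt_mem_idealAt _ _ _ hFJ)
      · have hreg : IsRegularLocalRing (localRing I (pointOfPrime Q' hi)) := by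
          by_contra h
          exact hsing ⟨hIP, h⟩
        have := localRing_isDomain hI hp hIP
        rw [conductorIdeal_eq_top_of_isRegularLocalRing
          ((ringKrullDim_localRing_le hI hp hIP hiP).trans (hdim i))]
        trivial
    obtain ⟨d, S, hS, hSP, hSF⟩ := (mk_fracAt_mem_conductorIdeal_iff hI hp hIP hiP
      (hfin i (hX i)) hF _ _).mp hmem
    exact ⟨_, fun h => hSP ((mem_pointOfPrime_iff Q' hi hS).mpr h), hSF⟩
  · exact Ideal.IsHomogeneous.iInf fun i => (Ideal.homogeneousCore _ _).isHomogeneous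
  · rintro P ⟨hIP, -⟩
    obtain ⟨i, hi⟩ := exists_X_notMem P
    have hKhom : (⨅ i, ((chartConductor I i).homogeneousCore (grading r k)).toIdeal).IsHomogeneous
        (grading r k) :=
      Ideal.IsHomogeneous.iInf fun i => (Ideal.homogeneousCore _ _).isHomogeneous
    have hIK : I ≤ ⨅ i, ((chartConductor I i).homogeneousCore (grading r k)).toIdeal := by
      refine le_iInf fun j => ?_
      have h : (I.homogeneousCore (grading r k)).toIdeal ≤ _ := Ideal.homogeneousCore_mono _
        ((le_chartIdeal I j).trans (chartIdeal_le_chartConductor I j))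
      rwa [hI.toIdeal_homogeneousCore_eq_self] at h
    refine le_antisymm ?_ fun z hz => ?_
    · rw [localIdeal, Ideal.map_le_iff_le_comap]
      intro y hy
      obtain ⟨n, F, G, hF, hG, hGP, rfl⟩ := exists_eq_fracAt y
      rw [fracAt_mem_idealAt_iff hKhom] at hy
      obtain ⟨d, S, hS, hSP, h⟩ := hy
      refine (mk_fracAt_mem_conductorIdeal_iff hI hp hIP hi (hfin i (hX i)) hF hG hGP).mpr
        ⟨d, S, hS, hSP, (mem_homogeneousCore_iff (hS.mul hF)).mp ?_⟩
      exact (Ideal.mem_iInf.mp h) i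
    · obtain ⟨y, rfl⟩ := Ideal.Quotient.mk_surjective z
      obtain ⟨n, F, G, hF, hG, hGP, rfl⟩ := exists_eq_fracAt y
      refine Ideal.mem_map_of_mem _ ?_
      obtain ⟨d, S, hS, hSP, h⟩ := (mk_fracAt_mem_conductorIdeal_iff hI hp hIP hi
        (hfin i (hX i)) hF hG hGP).mp hz
      -- The membership `SF` in the conductor of chart `i` extends to all charts after
      -- multiplication by one power of `X i`, which is invertible at `P`.
      choose m hm using fun j =>
        exists_pow_mul_mem_chartConductor hI hp hfin (j := j) (hS.mul hF) h
      rw [fracAt_mem_idealAt_iff hKhom]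
      refine ⟨_, X i ^ (∑ j, m j) * S, (isHomogeneous_X_pow' i _).mul hS,
        fun h => (P.isPrime.mem_or_mem h).elim (pow_notMem hi _) hSP, ?_⟩
      refine Ideal.mem_iInf.mpr fun j => ?_
      rw [mem_homogeneousCore_iff (((isHomogeneous_X_pow' i _).mul hS).mul hF), mul_assoc,
        ← Finset.sum_erase_add _ _ (Finset.mem_univ j), pow_add, mul_assoc]
      exact Ideal.mul_mem_left _ _ (hm j)

end GorensteinAdjoint

end AdjointCurve

/-! ### Ideal operations that commute with reduction -/

namespace AdjointCurve

open MvPolynomial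
open Filter hiding map

attribute [local instance] MvPolynomial.gradedAlgebra

section ReductionIdeals

variable {σ : Type} [Finite σ]

/-- Reduction modulo almost all primes preserves nonzerodivisors. -/
theorem eventually_mem_reduction_of_mul_mem (J : Ideal (MvPolynomial σ ℚ)) (x : MvPolynomial σ ℤ)
    (hx : ∀ f, map (Int.castRingHom ℚ) x * f ∈ J → f ∈ J) :
    ∀ᶠ p : ℕ in atTop, p.Prime → ∀ f, map (Int.castRingHom (ZMod p)) x * f ∈ reduction p J →
      f ∈ reduction p J := by
  let K := J.comap (map (Int.castRingHom ℚ))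
  -- If `x f = F + p E` with `F ∈ K`, then `pE`, hence `E`, lies in `K + (x)`. Writing `E = g + x e`
  -- gives `x (f - p e) ∈ K`, and `x` can be cancelled over ℚ.
  filter_upwards [eventually_torsionFree (MvPolynomial σ ℤ)
    (MvPolynomial σ ℤ ⧸ K ⊔ Ideal.span {x})] with p hp hpp f hf
  obtain ⟨f, rfl⟩ := map_surjective (σ := σ) (Int.castRingHom (ZMod p)) (ZMod.ringHom_surjective _) f
  rw [← map_mul, map_mem_reduction_iff] at hf
  obtain ⟨F, E, hF, h⟩ := hf
  have hE : Ideal.Quotient.mk (K ⊔ Ideal.span {x}) E = 0 := by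
    refine hp hpp _ ?_
    rw [nsmul_eq_mul, ← map_natCast (Ideal.Quotient.mk (K ⊔ Ideal.span {x})), ← map_mul,
      Ideal.Quotient.eq_zero_iff_mem]
    have h1 : (p : MvPolynomial σ ℤ) * E = x * f - F := by rw [h]; ring
    rw [h1]
    exact sub_mem (Ideal.mem_sup_right (Ideal.mul_mem_right _ _ (Ideal.mem_span_singleton_self x)))
      (Ideal.mem_sup_left hF)
  obtain ⟨g, hg, y, hy, rfl⟩ := Submodule.mem_sup.mp (Ideal.Quotient.eq_zero_iff_mem.mp hE)
  obtain ⟨e, rfl⟩ := Ideal.mem_span_singleton.mp hy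
  refine map_mem_reduction_iff.mpr ⟨f - p * e, e, hx _ ?_, by ring⟩
  have h2 : x * (f - p * e) = F + p * g := by linear_combination h
  rw [← map_mul, h2, map_add, map_mul, map_natCast]
  exact add_mem hF (Ideal.mul_mem_left _ _ hg)

/-- If integral lifts from the two ideals differ by `pE`, torsion-freeness modulo `K₁ + K₂` splits
`E`, and correcting by multiples of `p` makes the lifts equal. -/
theorem eventually_reduction_inf (J₁ J₂ : Ideal (MvPolynomial σ ℚ)) :
    ∀ᶠ p : ℕ in atTop, p.Prime → reduction p (J₁ ⊓ J₂) = reduction p J₁ ⊓ reduction p J₂ := by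
  let K₁ := J₁.comap (map (Int.castRingHom ℚ))
  let K₂ := J₂.comap (map (Int.castRingHom ℚ))
  filter_upwards [eventually_torsionFree (MvPolynomial σ ℤ)
    (MvPolynomial σ ℤ ⧸ K₁ ⊔ K₂)] with p hp hpp
  refine le_antisymm (le_inf (reduction_mono p inf_le_left) (reduction_mono p inf_le_right)) ?_
  rintro f ⟨h1, h2⟩
  obtain ⟨F₁, hF₁, rfl⟩ := mem_reduction_iff.mp h1
  obtain ⟨F₂, E, hF₂, h⟩ := map_mem_reduction_iff.mp h2
  have hE : Ideal.Quotient.mk (K₁ ⊔ K₂) E = 0 := by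
    refine hp hpp _ ?_
    rw [nsmul_eq_mul, ← map_natCast (Ideal.Quotient.mk (K₁ ⊔ K₂)), ← map_mul,
      Ideal.Quotient.eq_zero_iff_mem]
    have h1 : (p : MvPolynomial σ ℤ) * E = F₁ - F₂ := by rw [h]; ring
    rw [h1]
    exact sub_mem (Ideal.mem_sup_left hF₁) (Ideal.mem_sup_right hF₂)
  obtain ⟨g₁, hg₁, g₂, hg₂, rfl⟩ := Submodule.mem_sup.mp (Ideal.Quotient.eq_zero_iff_mem.mp hE)
  refine map_mem_reduction_iff.mpr ⟨F₁ - p * g₁, g₁, ⟨?_, ?_⟩, by ring⟩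
  · rw [map_sub, map_mul]
    exact sub_mem hF₁ (Ideal.mul_mem_left _ _ hg₁)
  · have h3 : F₁ - p * g₁ = F₂ + p * g₂ := by linear_combination h
    rw [h3, map_add, map_mul]
    exact add_mem hF₂ (Ideal.mul_mem_left _ _ hg₂)

theorem reduction_top {σ : Type} (p : ℕ) : reduction p (⊤ : Ideal (MvPolynomial σ ℚ)) = ⊤ := by
  rw [reduction, Ideal.comap_top, Ideal.map_top]

theorem eventually_reduction_iInf {ι : Type} [Finite ι] (J : ι → Ideal (MvPolynomial σ ℚ)) :
    ∀ᶠ p : ℕ in atTop, p.Prime → reduction p (⨅ i, J i) = ⨅ i, reduction p (J i) := by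
  classical
  cases nonempty_fintype ι
  suffices h : ∀ s : Finset ι, ∀ᶠ p : ℕ in atTop, p.Prime →
      reduction p (s.inf J) = s.inf fun i => reduction p (J i) by
    simpa only [Finset.inf_univ_eq_iInf] using h Finset.univ
  intro s
  induction s using Finset.induction_on with
  | empty => simp [reduction_top]
  | insert i s _ ih =>
    filter_upwards [ih, eventually_reduction_inf (J i) (s.inf J)] with p h1 h2 hp
    rw [Finset.inf_insert, Finset.inf_insert, h2 hp, h1 hp]

/-- Since `X i - 1 ∈ C`, the variable `X i` is a nonzerodivisor modulo the homogeneous core, and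
remains so modulo almost all `p`. A form in the reduction of `C` lifts to an integral polynomial
whose homogenization lies in the core; the two agree modulo `p` up to powers of `X i`, which can be
cancelled. -/
theorem eventually_reduction_homogeneousCore {r : ℕ}
    {C : Ideal (MvPolynomial (Fin (r + 1)) ℚ)} {i : Fin (r + 1)} (hC : X i - 1 ∈ C) :
    ∀ᶠ p : ℕ in atTop, ∀ [Fact p.Prime],
      reduction p (C.homogeneousCore (grading r ℚ)).toIdeal =
        ((reduction p C).homogeneousCore (grading r (ZMod p))).toIdeal := by
  have hchart : chartIdeal ⊥ i ≤ C := sup_le bot_le ((Ideal.span_singleton_le_iff_mem _).mpr hC)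
  have hsat : ∀ f, map (Int.castRingHom ℚ) (X i) * f ∈ (C.homogeneousCore (grading r ℚ)).toIdeal →
      f ∈ (C.homogeneousCore (grading r ℚ)).toIdeal := by
    intro f hf
    rw [map_X] at hf
    rw [mem_iff_homogeneousComponent_mem (HomogeneousIdeal.isHomogeneous _)]
    intro n
    have h1 := homogeneousComponent_mem_of_mem (HomogeneousIdeal.isHomogeneous _) hf (n + 1)
    rw [mul_comm, homogeneousComponent_mul_of_isHomogeneous (isHomogeneous_X ℚ i), mul_comm] at h1
    have hF := homogeneousComponent_isHomogeneous n f
    rw [mem_homogeneousCore_iff ((isHomogeneous_X ℚ i).mul hF)] at h1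
    rw [mem_homogeneousCore_iff hF]
    rw [← pow_one (X i)] at h1
    exact (pow_mul_mem_iff_of_chartIdeal_le hchart).mp h1
  filter_upwards [eventually_mem_reduction_of_mul_mem _ _ hsat] with p hp hpp
  refine le_antisymm ?_ fun f hf => ?_
  · have h1 := Ideal.homogeneousCore_mono (grading r (ZMod p))
      (reduction_mono p (Ideal.toIdeal_homogeneousCore_le (grading r ℚ) C))
    have h2 := (reduction_isHomogeneous (p := p)
      (C.homogeneousCore (grading r ℚ)).isHomogeneous).toIdeal_homogeneousCore_eq_self
    rw [← h2]
    exact h1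
  · rw [mem_iff_homogeneousComponent_mem (reduction_isHomogeneous (HomogeneousIdeal.isHomogeneous _))]
    intro n
    have hf' := (mem_homogeneousCore_iff (homogeneousComponent_isHomogeneous n f)).mp
      (homogeneousComponent_mem_of_mem (HomogeneousIdeal.isHomogeneous _) hf n)
    have hfn := homogeneousComponent_isHomogeneous n f
    generalize homogeneousComponent n f = f at hf' hfn
    obtain ⟨F, hF, rfl⟩ := mem_reduction_iff.mp hf'
    obtain ⟨d, H, hH, h⟩ := exists_isHomogeneous_sub_mem i F
    have hmap : ∀ {R : Type} [Field R] (φ : ℤ →+* R),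
        map φ H - map φ F ∈ chartIdeal ⊥ i := by
      intro R _ φ
      have h1 := Ideal.mem_map_of_mem (map φ) h
      rw [Ideal.map_span, Set.image_singleton] at h1
      simpa using span_le_chartIdeal ⊥ i (by simpa using h1)
    have h2 := add_mem (hchart (hmap (Int.castRingHom ℚ))) hF
    rw [sub_add_cancel] at h2
    have h3 : map (Int.castRingHom (ZMod p)) H ∈
        reduction p (C.homogeneousCore (grading r ℚ)).toIdeal :=
      mem_reduction_iff.mpr ⟨H, (mem_homogeneousCore_iff (hH.map _)).mpr h2, rfl⟩
    have h4 : X i ^ n * map (Int.castRingHom (ZMod p)) H -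
        X i ^ d * map (Int.castRingHom (ZMod p)) F ∈ chartIdeal ⊥ i := by
      have h5 := mul_pow_sub_mem_chartIdeal ⊥ i n (map (Int.castRingHom (ZMod p)) H)
      have h6 := mul_pow_sub_mem_chartIdeal ⊥ i d (map (Int.castRingHom (ZMod p)) F)
      have h7 := add_mem (sub_mem h5 h6) (hmap (Int.castRingHom (ZMod p)))
      convert h7 using 1
      ring
    have h8 : (X i ^ d * map (Int.castRingHom (ZMod p)) F).IsHomogeneous (n + d) := by
      rw [add_comm n d]
      exact (isHomogeneous_X_pow' i d).mul hfn
    -- For the zero ideal this says that two forms of the same degree that agree on `X i = 1` are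
    -- equal.
    rw [mem_chartIdeal_iff (Ideal.IsHomogeneous.bot _)
      (((isHomogeneous_X_pow' i n).mul (hH.map _)).sub h8)] at h4
    obtain ⟨m, hm⟩ := h4
    have h9 := sub_eq_zero.mp ((mul_eq_zero.mp hm).resolve_left (pow_ne_zero _ (X_ne_zero i)))
    have h10 : X i ^ d * map (Int.castRingHom (ZMod p)) F ∈
        reduction p (C.homogeneousCore (grading r ℚ)).toIdeal := by
      rw [← h9]
      exact Ideal.mul_mem_left _ _ h3
    clear h9 hm h8 hH
    induction d with
    | zero => simpa using h10
    | succ d ih =>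
      refine ih (hp hpp.out _ ?_)
      rw [map_X, ← mul_assoc, ← pow_succ']
      exact h10

end ReductionIdeals

/-! ### Reduction of the Gorenstein adjoint ideal -/

section Chart

variable {r : ℕ}

theorem IsCurveIdeal.X_notMem {k : Type} [Field k] {I : Ideal (MvPolynomial (Fin (r + 1)) k)}
    (hI : IsCurveIdeal I) (i : Fin (r + 1)) : X i ∉ I :=
  X_notMem_of_nondegenerate hI.nondegenerate i

theorem IsCurveIdeal.ringKrullDim_chart {k : Type} [Field k]
    {I : Ideal (MvPolynomial (Fin (r + 1)) k)} (hI : IsCurveIdeal I) (i : Fin (r + 1)) :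
    ringKrullDim (MvPolynomial (Fin (r + 1)) k ⧸ chartIdeal I i) ≤ 1 := by
  have := chartIdeal_isPrime hI.isHomogeneous hI.isPrime (hI.X_notMem i)
  obtain ⟨g, hg, hint⟩ := exists_noether_chart hI.isHomogeneous hI.isPrime (hI.X_notMem i)
    hI.ringKrullDim_eq_two
  rw [ringKrullDim_eq_of_noether g hg hint]
  rfl

theorem finite_integralClosure_of_noether {A : Type} [CommRing A] [IsDomain A] [Algebra ℚ A]
    [Algebra.FiniteType ℚ A] {n : ℕ} (g : MvPolynomial (Fin n) ℚ →ₐ[ℚ] A)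
    (hg : Function.Injective g) (hint : g.toRingHom.IsIntegral) :
    Module.Finite A (integralClosure A (FractionRing A)) := by
  let _ : Algebra (MvPolynomial (Fin n) ℚ) A := g.toRingHom.toAlgebra
  have : IsScalarTower ℚ (MvPolynomial (Fin n) ℚ) A := .of_algebraMap_eq fun x => (g.commutes x).symm
  have : FaithfulSMul (MvPolynomial (Fin n) ℚ) A := (faithfulSMul_iff_algebraMap_injective _ _).mpr hg
  have : Algebra.IsIntegral (MvPolynomial (Fin n) ℚ) A := ⟨hint⟩
  have : Algebra.FiniteType (MvPolynomial (Fin n) ℚ) A :=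
    Algebra.FiniteType.of_restrictScalars_finiteType ℚ _ _
  have : Module.Finite (MvPolynomial (Fin n) ℚ) A := Algebra.IsIntegral.finite
  have := (exists_normalization (MvPolynomial (Fin n) ℚ) A).1
  exact Module.Finite.of_restrictScalars_finite (MvPolynomial (Fin n) ℚ) _ _

theorem IsCurveIdeal.finite_integralClosure_chart {I : Ideal (MvPolynomial (Fin (r + 1)) ℚ)}
    (hI : IsCurveIdeal I) (i : Fin (r + 1)) :
    Module.Finite (MvPolynomial (Fin (r + 1)) ℚ ⧸ chartIdeal I i)
      (integralClosure (MvPolynomial (Fin (r + 1)) ℚ ⧸ chartIdeal I i)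
        (FractionRing (MvPolynomial (Fin (r + 1)) ℚ ⧸ chartIdeal I i))) := by
  have := chartIdeal_isPrime hI.isHomogeneous hI.isPrime (hI.X_notMem i)
  obtain ⟨g, hg, hint⟩ := exists_noether_chart hI.isHomogeneous hI.isPrime (hI.X_notMem i)
    hI.ringKrullDim_eq_two
  exact finite_integralClosure_of_noether g hg hint

theorem IsCurveIdeal.eventually_chart {I : Ideal (MvPolynomial (Fin (r + 1)) ℚ)}
    (hI : IsCurveIdeal I) (i : Fin (r + 1)) :
    ∀ᶠ p : ℕ in atTop, ∀ [Fact p.Prime], IsCurveIdeal (reduction p I) →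
      Module.Finite (MvPolynomial (Fin (r + 1)) (ZMod p) ⧸ chartIdeal (reduction p I) i)
        (integralClosure (MvPolynomial (Fin (r + 1)) (ZMod p) ⧸ chartIdeal (reduction p I) i)
          (FractionRing (MvPolynomial (Fin (r + 1)) (ZMod p) ⧸ chartIdeal (reduction p I) i))) ∧
      chartConductor (reduction p I) i = reduction p (chartConductor I i) := by
  have := chartIdeal_isPrime hI.isHomogeneous hI.isPrime (hI.X_notMem i)
  obtain ⟨g, hg, hint⟩ := exists_noether_chart hI.isHomogeneous hI.isPrime (hI.X_notMem i)
    hI.ringKrullDim_eq_two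
  filter_upwards [AdjointCurve.eventually_chart _ g hg hint] with p hp hpp hIp
  have h := hp hpp.out
  rw [reduction_chartIdeal hI.isHomogeneous i p] at h
  exact h (chartIdeal_isPrime hIp.isHomogeneous hIp.isPrime (hIp.X_notMem i))

/-- The formation of the Gorenstein adjoint ideal commutes with reduction modulo almost all
primes. -/
theorem IsCurveIdeal.eventually_reduction_gorensteinAdjointIdeal
    {I : Ideal (MvPolynomial (Fin (r + 1)) ℚ)} (hI : IsCurveIdeal I) :
    ∀ᶠ p : ℕ in atTop, ∀ [Fact p.Prime], IsCurveIdeal (reduction p I) →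
      reduction p (gorensteinAdjointIdeal I) = gorensteinAdjointIdeal (reduction p I) := by
  have h1 := eventually_all.mpr hI.eventually_chart
  have h2 := eventually_all.mpr fun i : Fin (r + 1) => eventually_reduction_homogeneousCore
    (chartIdeal_le_chartConductor I i (span_le_chartIdeal I i (Ideal.mem_span_singleton_self _)))
  filter_upwards [h1, h2, eventually_reduction_iInf fun i =>
    ((chartConductor I i).homogeneousCore (grading r ℚ)).toIdeal] with p h1 h2 h3 hpp hIp
  rw [gorensteinAdjointIdeal_eq hI.isHomogeneous hI.isPrime
    (fun i _ => hI.finite_integralClosure_chart i) hI.X_notMem hI.ringKrullDim_chart,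
    gorensteinAdjointIdeal_eq hIp.isHomogeneous hIp.isPrime (fun i _ => (h1 i hIp).1)
      hIp.X_notMem hIp.ringKrullDim_chart, h3 hpp.out]
  exact iInf_congr fun i => by rw [h2 i, (h1 i hIp).2]

end Chart

end AdjointCurve

/-! ### Leading monomials, reduced Gröbner bases and luckiness -/

namespace AdjointCurve

open MvPolynomial
open Filter hiding map

section GroebnerBasis

variable {σ : Type} (m : MonomialOrder σ)

/-- The leading monomials of the nonzero elements of an ideal. -/
def leadingMonomials {k : Type} [Field k] (J : Ideal (MvPolynomial σ k)) : Set (σ →₀ ℕ) :=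
  {d | ∃ f ∈ J, f ≠ 0 ∧ m.degree f = d}

variable {m}

theorem leadingMonomials_isUpperSet {k : Type} [Field k] (J : Ideal (MvPolynomial σ k)) :
    IsUpperSet (leadingMonomials m J) := by
  rintro a b hab ⟨f, hf, hf0, rfl⟩
  obtain ⟨c, rfl⟩ := exists_add_of_le hab
  refine ⟨monomial c 1 * f, Ideal.mul_mem_left _ _ hf, mul_ne_zero (by simp) hf0, ?_⟩
  classical
  rw [m.degree_mul (by simp) hf0, m.degree_monomial, if_neg one_ne_zero, add_comm]

/-- The basis element for a minimal leading monomial is that monomial minus its normal form modulo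
`J`. -/
theorem exists_isReducedGroebnerBasis [Finite σ] {k : Type} [Field k]
    (J : Ideal (MvPolynomial σ k)) :
    ∃ G, IsReducedGroebnerBasis m J G ∧
      m.degree '' G = {d | Minimal (· ∈ leadingMonomials m J) d} := by
  have key : ∀ d ∈ leadingMonomials m J, ∃ h ∈ J, m.Monic h ∧ m.degree h = d ∧
      ∀ c ∈ h.support, c = d ∨ c ∉ leadingMonomials m J := by
    classical
    intro d hd
    -- Division by all nonzero elements of `J` at once: the remainder `q` contains no leading
    -- monomial of `J`.
    obtain ⟨g, q, h1, -, h2⟩ := m.div_set (B := {f | f ∈ J ∧ f ≠ 0})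
      (fun b hb => (m.leadingCoeff_ne_zero_iff.mpr hb.2).isUnit) (monomial d (1 : k))
    have h3 : ∀ c ∈ q.support, c ∉ leadingMonomials m J := by
      rintro c hc ⟨f, hf, hf0, rfl⟩
      exact h2 _ hc f ⟨hf, hf0⟩ le_rfl
    have h4 : monomial d 1 - q ∈ J := by
      rw [h1, add_sub_cancel_right]
      exact Submodule.sum_mem _ fun b _ => Ideal.mul_mem_left _ _ b.2.1
    have h5 : coeff d q = 0 := by
      by_contra h
      exact h3 d (mem_support_iff.mpr h) hd
    have h6 : coeff d (monomial d 1 - q) = 1 := by rw [coeff_sub, coeff_monomial, if_pos rfl, h5, sub_zero]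
    have h7 : monomial d 1 - q ≠ 0 := fun h => by simp [h] at h6
    have h8 : ∀ c ∈ (monomial d 1 - q).support, c = d ∨ c ∉ leadingMonomials m J := by
      intro c hc
      by_cases hcd : c = d
      · exact Or.inl hcd
      · refine Or.inr (h3 c (mem_support_iff.mpr fun h => ?_))
        rw [mem_support_iff, coeff_sub, coeff_monomial, if_neg (Ne.symm hcd), h, sub_zero] at hc
        exact hc rfl
    have h9 : m.degree (monomial d 1 - q) = d :=
      (h8 _ (m.degree_mem_support h7)).resolve_right fun h => h ⟨_, h4, h7, rfl⟩
    refine ⟨_, h4, ?_, h9, h8⟩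
    rw [MonomialOrder.Monic, MonomialOrder.leadingCoeff, h9, h6]
  choose! h hJ hmon hdeg hsupp using key
  have himg : m.degree '' (h '' {d | Minimal (· ∈ leadingMonomials m J) d}) =
      {d | Minimal (· ∈ leadingMonomials m J) d} := by
    rw [Set.image_image]
    refine (Set.image_congr fun d hd => ?_).trans (Set.image_id _)
    exact hdeg d hd.prop
  refine ⟨h '' {d | Minimal (· ∈ leadingMonomials m J) d}, ⟨?_, ?_, ?_, ?_⟩, himg⟩
  · rintro _ ⟨d, hd, rfl⟩
    exact hJ d hd.prop
  · intro f hf hf0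
    obtain ⟨d, hd, hdm⟩ := exists_minimal_le_of_wellFoundedLT (· ∈ leadingMonomials m J) (m.degree f)
      ⟨f, hf, hf0, rfl⟩
    exact ⟨h d, ⟨d, hdm, rfl⟩, by rwa [hdeg d hdm.prop]⟩
  · rintro _ ⟨d, hd, rfl⟩
    exact hmon d hd.prop
  · rintro _ ⟨d, hd, rfl⟩ _ ⟨e, he, rfl⟩ hne c hc hle
    rw [hdeg e he.prop] at hle
    rcases hsupp d hd.prop c hc with rfl | h1
    · exact hne (congrArg h (le_antisymm hle (hd.le_of_le he.prop hle)))
    · exact h1 (leadingMonomials_isUpperSet J hle he.prop)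

theorem degree_map_of_ne_zero {R S : Type*} [CommRing R] [CommRing S] (φ : R →+* S)
    {f : MvPolynomial σ R} (hf : φ (m.leadingCoeff f) ≠ 0) : m.degree (map φ f) = m.degree f := by
  refine m.toSyn.injective (le_antisymm ?_ (m.le_degree ?_))
  · rw [m.degree_le_iff]
    exact fun b hb => m.le_degree (support_map_subset φ f hb)
  · rwa [mem_support_iff, coeff_map]

variable [Finite σ]

/-- By Dickson's lemma there are finitely many minimal leading monomials; `p` has to avoid the
leading coefficients of one integral lift for each. -/
theorem eventually_leadingMonomials_reduction (J : Ideal (MvPolynomial σ ℚ)) :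
    ∀ᶠ p : ℕ in atTop, ∀ [Fact p.Prime],
      leadingMonomials m (reduction p J) = leadingMonomials m J := by
  classical
  let B : Set (σ →₀ ℕ) := {d | Minimal (· ∈ leadingMonomials m J) d}
  have hB : B.Finite := WellQuasiOrderedLE.finite_of_isAntichain (setOfPred_minimal_antichain _)
  have hBle : ∀ d ∈ leadingMonomials m J, ∃ b ∈ B, b ≤ d := fun d hd => by
    obtain ⟨b, hb, hbm⟩ := exists_minimal_le_of_wellFoundedLT (· ∈ leadingMonomials m J) d hd
    exact ⟨b, hbm, hb⟩
  have hinj : Function.Injective (Int.castRingHom ℚ) := Int.cast_injective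
  have hdegQ : ∀ F : MvPolynomial σ ℤ, m.degree (map (Int.castRingHom ℚ) F) = m.degree F := by
    intro F
    by_cases hF : F = 0
    · simp [hF]
    · exact degree_map_of_ne_zero _ fun h => m.leadingCoeff_ne_zero_iff.mpr hF
        (hinj (h.trans (map_zero _).symm))
  have hlift : ∀ b ∈ B, ∃ F : MvPolynomial σ ℤ, map (Int.castRingHom ℚ) F ∈ J ∧ F ≠ 0 ∧
      m.degree F = b := by
    intro b hb
    obtain ⟨f, hf, hf0, hfb⟩ := hb.prop
    obtain ⟨n, hn, F, hF⟩ := exists_mvPolynomial_map_eq f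
    have hn' : (n : MvPolynomial σ ℚ) ≠ 0 := Nat.cast_ne_zero.mpr hn
    refine ⟨F, hF ▸ Ideal.mul_mem_left _ _ hf, fun h => ?_, ?_⟩
    · rw [h, map_zero] at hF
      exact (mul_ne_zero hn' hf0) hF.symm
    · rw [← hdegQ, hF, m.degree_mul hn' hf0, hfb, ← map_natCast C, m.degree_C, zero_add]
  choose! F hFJ hF0 hFb using hlift
  have hev : ∀ᶠ p : ℕ in atTop, ∀ b ∈ B, ¬ (p : ℤ) ∣ m.leadingCoeff (F b) := by
    refine (hB.eventually_all).mpr fun b hb => ?_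
    filter_upwards [eventually_gt_atTop (m.leadingCoeff (F b)).natAbs] with p hp hdvd
    have h1 := Nat.le_of_dvd (Int.natAbs_pos.mpr (m.leadingCoeff_ne_zero_iff.mpr (hF0 b hb)))
      (Int.natCast_dvd.mp hdvd)
    omega
  filter_upwards [hev] with p hp hpp
  have hlc : ∀ b ∈ B, Int.castRingHom (ZMod p) (m.leadingCoeff (F b)) ≠ 0 := fun b hb h =>
    hp b hb ((ZMod.intCast_zmod_eq_zero_iff_dvd _ p).mp h)
  refine Set.Subset.antisymm ?_ ?_
  · rintro d ⟨f, hf, hf0, rfl⟩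
    obtain ⟨H, hH, rfl⟩ := mem_reduction_iff.mp hf
    clear hf
    -- The leading term of an integral lift `H` may vanish modulo `p`. Well-founded induction on its
    -- degree replaces `H` by lifts with smaller leading monomial until this no longer happens.
    induction hs : m.toSyn (m.degree H) using WellFoundedLT.induction generalizing H with
    | ind s ih =>
    have hH0 : H ≠ 0 := fun h => hf0 (by rw [h, map_zero])
    have hmem : m.degree H ∈ leadingMonomials m J := by
      refine ⟨_, hH, fun h => hH0 ?_, hdegQ H⟩
      exact map_injective _ hinj (h.trans (map_zero _).symm)
    by_cases hdvd : Int.castRingHom (ZMod p) (m.leadingCoeff H) = 0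
    · obtain ⟨b, hb, hle⟩ := hBle _ hmem
      obtain ⟨c, hc⟩ := exists_add_of_le hle
      -- An S-polynomial step: the leading terms cancel, while modulo `p` the subtracted term
      -- vanishes and `H` is only multiplied by a nonzero constant.
      set H' := C (m.leadingCoeff (F b)) * H - monomial c (m.leadingCoeff H) * F b with hH'
      have hmap : map (Int.castRingHom (ZMod p)) H' =
          C (Int.castRingHom (ZMod p) (m.leadingCoeff (F b))) * map (Int.castRingHom (ZMod p)) H := by
        rw [hH', map_sub, map_mul, map_mul, map_C, map_monomial, hdvd, monomial_zero, zero_mul,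
          sub_zero]
      have hC0 : (C (Int.castRingHom (ZMod p) (m.leadingCoeff (F b))) : MvPolynomial σ (ZMod p)) ≠ 0 :=
        C_ne_zero.mpr (hlc b hb)
      have hf0' : map (Int.castRingHom (ZMod p)) H' ≠ 0 := by
        rw [hmap]
        exact mul_ne_zero hC0 hf0
      have hJ' : map (Int.castRingHom ℚ) H' ∈ J := by
        rw [hH', map_sub, map_mul, map_mul]
        exact sub_mem (Ideal.mul_mem_left _ _ hH) (Ideal.mul_mem_left _ _ (hFJ b hb))
      have hlcH : m.leadingCoeff H ≠ 0 := m.leadingCoeff_ne_zero_iff.mpr hH0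
      have hlcF : m.leadingCoeff (F b) ≠ 0 := m.leadingCoeff_ne_zero_iff.mpr (hF0 b hb)
      have hd1 : m.degree (C (m.leadingCoeff (F b)) * H) = m.degree H := by
        rw [m.degree_mul (C_ne_zero.mpr hlcF) hH0, m.degree_C, zero_add]
      have hd2 : m.degree (monomial c (m.leadingCoeff H) * F b) = m.degree H := by
        rw [m.degree_mul (by simpa using hlcH) (hF0 b hb), m.degree_monomial, if_neg hlcH, hFb b hb,
          hc, add_comm]
      have hH'0 : H' ≠ 0 := fun h => hf0' (by rw [h, map_zero])
      have hlt : m.toSyn (m.degree H') < s := by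
        rw [← hs]
        refine lt_of_le_of_ne ?_ fun h => ?_
        · refine m.degree_le_iff.mpr fun e he => ?_
          by_contra! hlt
          rw [mem_support_iff, hH', coeff_sub, m.coeff_eq_zero_of_lt (by rwa [hd1]),
            m.coeff_eq_zero_of_lt (by rwa [hd2]), sub_zero] at he
          exact he rfl
        · have h1 := m.toSyn.injective h
          have h2 := m.coeff_degree_ne_zero_iff.mpr hH'0
          rw [h1, hH', coeff_sub, coeff_C_mul] at h2
          have h3 : coeff (m.degree H) (monomial c (m.leadingCoeff H) * F b) =
              m.leadingCoeff H * m.leadingCoeff (F b) := by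
            rw [hc, add_comm, coeff_monomial_mul, MonomialOrder.leadingCoeff, MonomialOrder.leadingCoeff,
              hFb b hb]
          rw [h3] at h2
          refine h2 ?_
          rw [MonomialOrder.leadingCoeff, MonomialOrder.leadingCoeff]
          ring
      have := ih _ hlt H' hJ' hf0' rfl
      rwa [hmap, m.degree_mul hC0 hf0, m.degree_C, zero_add] at this
    · rwa [degree_map_of_ne_zero _ hdvd]
  · intro d hd
    obtain ⟨b, hb, hle⟩ := hBle d hd
    refine leadingMonomials_isUpperSet _ hle ⟨map (Int.castRingHom (ZMod p)) (F b),
      mem_reduction_iff.mpr ⟨_, hFJ b hb, rfl⟩, fun h => ?_, ?_⟩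
    · have h1 := congrArg (coeff (m.degree (F b))) h
      rw [coeff_map, coeff_zero] at h1
      exact hlc b hb h1
    · rw [degree_map_of_ne_zero _ (hlc b hb), hFb b hb]

end GroebnerBasis

theorem IsCurveIdeal.eventually_isLucky {r : ℕ} (m : MonomialOrder (Fin (r + 1)))
    {I : Ideal (MvPolynomial (Fin (r + 1)) ℚ)} (hI : IsCurveIdeal I) :
    ∀ᶠ p : ℕ in atTop, ∀ [Fact p.Prime], IsCurveIdeal (reduction p I) → IsLucky m I p := by
  filter_upwards [hI.eventually_reduction_gorensteinAdjointIdeal,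
    eventually_leadingMonomials_reduction (m := m) (gorensteinAdjointIdeal I)] with p h1 h2 hpp hIp
  obtain ⟨G₀, hG₀, h3⟩ := exists_isReducedGroebnerBasis (m := m) (gorensteinAdjointIdeal I)
  obtain ⟨Gp, hGp, h4⟩ := exists_isReducedGroebnerBasis (m := m)
    (gorensteinAdjointIdeal (reduction p I))
  exact ⟨h1 hIp, G₀, Gp, hG₀, hGp, by rw [h3, h4, ← h1 hIp, h2]⟩

end AdjointCurve

/-! ### Primality of `p` in a finite extension -/

namespace AdjointCurve

open Filter Polynomial

section IntegralExtension

/-- The quotient `b / a` lies in the fraction field of `R` and is integral over `R`. -/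
theorem dvd_of_algebraMap_dvd {R S : Type*} [CommRing R] [IsDomain R] [IsIntegrallyClosed R]
    [CommRing S] [IsDomain S] [Algebra R S] [Algebra.IsIntegral R S] [FaithfulSMul R S] {a b : R}
    (h : algebraMap R S a ∣ algebraMap R S b) : a ∣ b := by
  by_cases ha : a = 0
  · subst ha
    rw [map_zero, zero_dvd_iff] at h
    rw [(FaithfulSMul.algebraMap_injective R S) (h.trans (map_zero _).symm)]
  obtain ⟨s, hs⟩ := h
  have hinj : Function.Injective (algebraMap R (FractionRing S)) := by
    rw [IsScalarTower.algebraMap_eq R S (FractionRing S)]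
    exact (IsFractionRing.injective S _).comp (FaithfulSMul.algebraMap_injective R S)
  let _ : Algebra (FractionRing R) (FractionRing S) := (IsFractionRing.lift hinj).toAlgebra
  have : IsScalarTower R (FractionRing R) (FractionRing S) :=
    .of_algebraMap_eq fun x => (IsFractionRing.lift_algebraMap hinj x).symm
  have ha' : algebraMap R (FractionRing S) a ≠ 0 := fun h => ha (hinj (h.trans (map_zero _).symm))
  have ha'' : algebraMap R (FractionRing R) a ≠ 0 := by
    simpa using ha
  have h1 : algebraMap (FractionRing R) (FractionRing S)
      (algebraMap R (FractionRing R) b / algebraMap R (FractionRing R) a) =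
        algebraMap S (FractionRing S) s := by
    rw [map_div₀, ← IsScalarTower.algebraMap_apply, ← IsScalarTower.algebraMap_apply, div_eq_iff ha',
      IsScalarTower.algebraMap_apply R S (FractionRing S) b, hs, map_mul, mul_comm,
      ← IsScalarTower.algebraMap_apply]
  have h2 : IsIntegral R (algebraMap R (FractionRing R) b / algebraMap R (FractionRing R) a) := by
    rw [← isIntegral_algebraMap_iff (algebraMap (FractionRing R) (FractionRing S)).injective, h1]
    exact (Algebra.IsIntegral.isIntegral s).algebraMap
  obtain ⟨c, hc⟩ := IsIntegrallyClosed.isIntegral_iff.mp h2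
  refine ⟨c, IsFractionRing.injective R (FractionRing R) ?_⟩
  rw [map_mul, hc, mul_div_cancel₀ _ ha'']

attribute [local instance] FractionRing.liftAlgebra

/-- A finite extension of a normal domain is a domain modulo `p` if the minimal polynomial of
a primitive element generates a prime ideal modulo `p`. -/
theorem eventually_dvd_or_dvd {R S : Type} [CommRing R] [IsDomain R] [IsIntegrallyClosed R]
    [IsNoetherianRing R] [CharZero R] [CommRing S] [IsDomain S] [Algebra R S] [Module.Finite R S]
    [FaithfulSMul R S] {y : S} (hy : Algebra.adjoin (FractionRing R)
      {algebraMap S (FractionRing S) y} = ⊤)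
    (hprime : ∀ᶠ p : ℕ in atTop, p.Prime → ∀ a b q e : R[X], a * b = minpoly R y * q + p * e →
      (∃ q e, a = minpoly R y * q + p * e) ∨ ∃ q e, b = minpoly R y * q + p * e) :
    ∀ᶠ p : ℕ in atTop, p.Prime → ∀ s t : S, (p : S) ∣ s * t → (p : S) ∣ s ∨ (p : S) ∣ t := by
  have : CharZero S := charZero_of_injective_algebraMap (FaithfulSMul.algebraMap_injective R S)
  have : IsNoetherianRing S := IsNoetherianRing.of_finite R S
  have hden : ∀ s : S, ∃ d : R, d ≠ 0 ∧ ∃ P : R[X], algebraMap R S d * s = aeval y P := by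
    intro s
    have h1 : algebraMap S (FractionRing S) s ∈ Algebra.adjoin (FractionRing R)
      {algebraMap S (FractionRing S) y} := hy ▸ Algebra.mem_top
    rw [Algebra.adjoin_singleton_eq_range_aeval] at h1
    obtain ⟨Q, hQ⟩ := h1
    obtain ⟨d, hd0, hd⟩ := IsLocalization.integerNormalization_spec (nonZeroDivisors R) Q
    refine ⟨d, nonZeroDivisors.ne_zero hd0, IsLocalization.integerNormalization (nonZeroDivisors R) Q,
      IsFractionRing.injective S (FractionRing S) ?_⟩
    rw [← aeval_algebraMap_apply, ← aeval_map_algebraMap (FractionRing R), hd,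
      ← algebraMap_smul (FractionRing R) d Q, map_smul, Algebra.smul_def, map_mul, ← hQ,
      ← IsScalarTower.algebraMap_apply, ← IsScalarTower.algebraMap_apply]
    rfl
  obtain ⟨n, z, hz⟩ := Module.Finite.exists_fin (R := R) (M := S)
  choose d hd0 P hP using fun i => hden (z i)
  -- The product `δ` of the denominators of module generators satisfies `δS ⊆ R[y]`, so divisibility
  -- in `S` can be studied through polynomials in `y`.
  have hδ0 : ∏ i, d i ≠ 0 := Finset.prod_ne_zero_iff.mpr fun i _ => hd0 i
  set δ := ∏ i, d i with hδdef
  have hδ : ∀ s : S, algebraMap R S δ * s ∈ Algebra.adjoin R {y} := by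
    intro s
    have hs : s ∈ Submodule.span R (Set.range z) := hz ▸ Submodule.mem_top
    induction hs using Submodule.span_induction with
    | mem x hx =>
      obtain ⟨i, rfl⟩ := hx
      obtain ⟨c, hc⟩ : d i ∣ δ := Finset.dvd_prod_of_mem d (Finset.mem_univ i)
      rw [hc, mul_comm (d i), map_mul, mul_assoc, hP]
      exact mul_mem (Subalgebra.algebraMap_mem _ _) (aeval_mem_adjoin_singleton R y)
    | zero => rw [mul_zero]; exact zero_mem _
    | add x y _ _ hx hy => rw [mul_add]; exact add_mem hx hy
    | smul r x _ hx =>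
      rw [mul_smul_comm]
      exact Subalgebra.smul_mem _ hx r
  have hδ' : algebraMap R S δ ≠ 0 := by simpa using hδ0
  filter_upwards [hprime, eventually_torsionFree S (S ⧸ Ideal.span {algebraMap R S δ}),
    eventually_torsionFree R (S ⧸ Subalgebra.toSubmodule (Algebra.adjoin R {y}))]
    with p h1 h2 h3 hp s t hst
  have hp0 : (p : S) ≠ 0 := Nat.cast_ne_zero.mpr hp.ne_zero
  have hB : ∀ s : S, (p : S) * s ∈ Algebra.adjoin R {y} → s ∈ Algebra.adjoin R {y} := by
    intro s hs
    rw [← Subalgebra.mem_toSubmodule, ← Submodule.Quotient.mk_eq_zero]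
    refine h3 hp _ ?_
    rw [← Submodule.Quotient.mk_smul, Submodule.Quotient.mk_eq_zero, nsmul_eq_mul]
    exact hs
  have hD : ∀ s : S, (p : S) ∣ algebraMap R S δ * s → (p : S) ∣ s := by
    rintro s ⟨u, hu⟩
    have h4 : Ideal.Quotient.mk (Ideal.span {algebraMap R S δ}) u = 0 := by
      refine h2 hp _ ?_
      rw [nsmul_eq_mul, ← map_natCast (Ideal.Quotient.mk _), ← map_mul, ← hu,
        Ideal.Quotient.eq_zero_iff_mem]
      exact Ideal.mul_mem_right _ _ (Ideal.mem_span_singleton_self _)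
    rw [Ideal.Quotient.eq_zero_iff_mem, Ideal.mem_span_singleton] at h4
    obtain ⟨v, rfl⟩ := h4
    exact ⟨v, mul_left_cancel₀ hδ' (by rw [hu]; ring)⟩
  have hrange : ∀ s ∈ Algebra.adjoin R {y}, ∃ a : R[X], aeval y a = s := by
    intro s hs
    rw [Algebra.adjoin_singleton_eq_range_aeval] at hs
    exact hs
  obtain ⟨a, ha⟩ := hrange _ (hδ s)
  obtain ⟨b, hb⟩ := hrange _ (hδ t)
  have hint : IsIntegral R y := Algebra.IsIntegral.isIntegral y
  obtain ⟨u, hu⟩ := hst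
  -- From `st = pu` the element `p δ² u` is in `R[y]`, and so is `δ² u`, as `S / R[y]` has no
  -- `p`-torsion. This turns the divisibility into a congruence modulo the minimal polynomial and
  -- `p`.
  obtain ⟨e, he⟩ := hrange _ (hB (algebraMap R S δ * algebraMap R S δ * u) (by
    have h5 := mul_mem (hδ s) (hδ t)
    have h6 : (p : S) * (algebraMap R S δ * algebraMap R S δ * u) =
      algebraMap R S δ * s * (algebraMap R S δ * t) := by linear_combination (-algebraMap R S δ * algebraMap R S δ) * hu
    rwa [h6]))
  have h7 : minpoly R y ∣ a * b - p * e := by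
    refine minpoly.isIntegrallyClosed_dvd hint ?_
    rw [map_sub, map_mul, map_mul, ha, hb, he, map_natCast]
    linear_combination (algebraMap R S δ * algebraMap R S δ) * hu
  obtain ⟨q, hq⟩ := h7
  have h8 : ∀ (s : S) (a : R[X]), aeval y a = algebraMap R S δ * s →
      (∃ q e, a = minpoly R y * q + p * e) → (p : S) ∣ s := by
    rintro s a ha ⟨q, e, rfl⟩
    refine hD s ⟨aeval y e, ?_⟩
    rw [← ha, map_add, map_mul, minpoly.aeval, zero_mul, zero_add, map_mul, map_natCast]
  exact (h1 hp a b q e (by linear_combination hq)).imp (h8 s a ha) (h8 t b hb)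

end IntegralExtension

end AdjointCurve

/-! ### Spreading out absolute irreducibility -/

namespace AdjointCurve

open Filter Polynomial

section SpreadingOut

theorem nonempty_algHom_algebraicClosure (L : Type) [Field L] [Algebra ℚ L]
    [Algebra.IsAlgebraic ℚ L] : Nonempty (L →ₐ[ℚ] AlgebraicClosure ℚ) :=
  ⟨IsAlgClosed.lift⟩

/-- A scheme of finite type over `ℤ` without points over `ℚ̄` has no points over `𝔽_p` for almost
all `p`. -/
theorem eventually_isEmpty_ringHom (B : Type) [CommRing B] [Algebra.FiniteType ℤ B]
    (h : IsEmpty (B →+* AlgebraicClosure ℚ)) :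
    ∀ᶠ p : ℕ in atTop, p.Prime → IsEmpty (B →+* ZMod p) := by
  -- Nullstellensatz: a nonzero `ℚ ⊗ B` would have a residue field finite over ℚ, which embeds into
  -- `ℚ̄`.
  have hsub : Subsingleton (TensorProduct ℤ ℚ B) := by
    by_contra hns
    rw [not_subsingleton_iff_nontrivial] at hns
    obtain ⟨M, hM⟩ := Ideal.exists_maximal (TensorProduct ℤ ℚ B)
    let _ : Field (TensorProduct ℤ ℚ B ⧸ M) := Ideal.Quotient.field M
    have : Algebra.FiniteType ℚ (TensorProduct ℤ ℚ B ⧸ M) :=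
      Algebra.FiniteType.of_surjective (Ideal.Quotient.mkₐ ℚ M) (Ideal.Quotient.mkₐ_surjective ℚ M)
    have : Module.Finite ℚ (TensorProduct ℤ ℚ B ⧸ M) := finite_of_finite_type_of_isJacobsonRing _ _
    have : Algebra.IsAlgebraic ℚ (TensorProduct ℤ ℚ B ⧸ M) := Algebra.IsAlgebraic.of_finite _ _
    obtain ⟨ψ⟩ := nonempty_algHom_algebraicClosure (TensorProduct ℤ ℚ B ⧸ M)
    exact h.false ((ψ.toRingHom.comp (Ideal.Quotient.mk M)).comp
      (Algebra.TensorProduct.includeRight : B →ₐ[ℤ] TensorProduct ℤ ℚ B).toRingHom)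
  have hloc : IsLocalizedModule (nonZeroDivisors ℤ) (TensorProduct.mk ℤ ℚ B 1) :=
    (isLocalizedModule_iff_isBaseChange (nonZeroDivisors ℤ) ℚ _).mpr
      (TensorProduct.isBaseChange ℤ B ℚ)
  -- The element `1` dies in `ℚ ⊗ B`, so a nonzero integer `n` is zero in `B`; this excludes maps to
  -- `𝔽_p` for `p > |n|`.
  obtain ⟨n, hn⟩ := (IsLocalizedModule.eq_zero_iff (nonZeroDivisors ℤ)
    (TensorProduct.mk ℤ ℚ B 1) (m := 1)).mp (Subsingleton.elim _ _)
  have hn0 : (n : ℤ) ≠ 0 := nonZeroDivisors.ne_zero n.2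
  filter_upwards [eventually_gt_atTop (n : ℤ).natAbs] with p hp hpp
  refine ⟨fun φ => ?_⟩
  have h1 : ((n : ℤ) : ZMod p) = 0 := by
    have h2 := congrArg φ hn
    rw [Submonoid.smul_def, zsmul_eq_mul, mul_one, map_intCast, map_zero] at h2
    exact h2
  rw [ZMod.intCast_zmod_eq_zero_iff_dvd, Int.natCast_dvd] at h1
  exact absurd (Nat.le_of_dvd (Int.natAbs_pos.mpr hn0) h1) (not_le.mpr hp)

variable {τ : Type} {R : Type} [CommRing R]

/-- The monic polynomial of degree `d` with given coefficients, whose monomials lie in `s`. -/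
noncomputable def monicOfCoeff (s : Finset (τ →₀ ℕ)) (d : ℕ) (c : Fin d × s → R) :
    (MvPolynomial τ R)[X] :=
  X ^ d + ∑ j : Fin d, C (∑ α : s, MvPolynomial.monomial (α : τ →₀ ℕ) (c (j, α))) * X ^ (j : ℕ)

theorem map_monicOfCoeff {K : Type} [CommRing K] (φ : R →+* K) (s : Finset (τ →₀ ℕ)) (d : ℕ)
    (c : Fin d × s → R) : (monicOfCoeff s d c).map (MvPolynomial.map φ) =
      monicOfCoeff s d (φ ∘ c) := by
  simp [monicOfCoeff, Polynomial.map_sum, MvPolynomial.map_monomial]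

theorem degree_sum_C_mul_X_pow_lt (d : ℕ) (a : Fin d → R) :
    (∑ j : Fin d, C (a j) * X ^ (j : ℕ)).degree < (d : WithBot ℕ) := by
  refine (degree_sum_le _ _).trans_lt ((Finset.sup_lt_iff (WithBot.bot_lt_coe d)).mpr fun j _ => ?_)
  exact (degree_C_mul_X_pow_le _ _).trans_lt (WithBot.coe_lt_coe.mpr j.2)

theorem monic_monicOfCoeff (s : Finset (τ →₀ ℕ)) (d : ℕ) (c : Fin d × s → R) :
    (monicOfCoeff s d c).Monic :=
  monic_X_pow_add (degree_sum_C_mul_X_pow_lt d _)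

theorem natDegree_monicOfCoeff [Nontrivial R] (s : Finset (τ →₀ ℕ)) (d : ℕ) (c : Fin d × s → R) :
    (monicOfCoeff s d c).natDegree = d := by
  refine natDegree_eq_of_degree_eq_some ?_
  rw [monicOfCoeff, degree_add_eq_left_of_degree_lt, degree_X_pow]
  rw [degree_X_pow]
  exact degree_sum_C_mul_X_pow_lt d _

theorem eq_monicOfCoeff {s : Finset (τ →₀ ℕ)} {G : (MvPolynomial τ R)[X]} (hG : G.Monic)
    (hs : ∀ j, (G.coeff j).support ⊆ s) :
    G = monicOfCoeff s G.natDegree fun x => (G.coeff x.1).coeff x.2 := by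
  conv_lhs => rw [hG.as_sum]
  rw [monicOfCoeff, Finset.sum_range fun i => C (G.coeff i) * X ^ i]
  congr 1
  refine Finset.sum_congr rfl fun j _ => ?_
  congr 2
  conv_lhs => rw [MvPolynomial.as_sum (G.coeff j)]
  rw [Finset.sum_coe_sort s fun α => MvPolynomial.monomial α ((G.coeff j).coeff α)]
  refine Finset.sum_subset (hs j) fun α _ hα => ?_
  rw [MvPolynomial.notMem_support_iff.mp hα, MvPolynomial.monomial_zero]

/-- A monic polynomial over `ℤ[Y]` without monic factorizations of a given shape over `ℚ̄[Y]` has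
no such factorizations modulo almost all primes. -/
theorem eventually_monicOfCoeff_mul_ne (F : (MvPolynomial τ ℤ)[X]) (s : Finset (τ →₀ ℕ)) (d e : ℕ)
    (h : ∀ (a : Fin d × s → AlgebraicClosure ℚ) (b : Fin e × s → AlgebraicClosure ℚ),
      monicOfCoeff s d a * monicOfCoeff s e b ≠ F.map (MvPolynomial.map (Int.castRingHom _))) :
    ∀ᶠ p : ℕ in atTop, p.Prime → ∀ (a : Fin d × s → ZMod p) (b : Fin e × s → ZMod p),
      monicOfCoeff s d a * monicOfCoeff s e b ≠ F.map (MvPolynomial.map (Int.castRingHom _)) := by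
  let ι := (Fin d × s) ⊕ (Fin e × s)
  -- The generic product minus `F`. Its coefficients generate the ideal whose zeros are exactly the
  -- factorizations of this shape.
  let U : (MvPolynomial τ (MvPolynomial ι ℤ))[X] :=
    monicOfCoeff s d (fun x => MvPolynomial.X (Sum.inl x)) *
      monicOfCoeff s e (fun x => MvPolynomial.X (Sum.inr x)) -
      F.map (MvPolynomial.map (Int.castRingHom _))
  let 𝔞 : Ideal (MvPolynomial ι ℤ) :=
    Ideal.span (Set.range fun x : ℕ × (τ →₀ ℕ) => (U.coeff x.1).coeff x.2)
  have hU : ∀ {K : Type} [CommRing K] (φ : MvPolynomial ι ℤ →+* K),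
      U.map (MvPolynomial.map φ) =
        monicOfCoeff s d (fun x => φ (MvPolynomial.X (Sum.inl x))) *
          monicOfCoeff s e (fun x => φ (MvPolynomial.X (Sum.inr x))) -
        F.map (MvPolynomial.map (Int.castRingHom _)) := by
    intro K _ φ
    rw [Polynomial.map_sub, Polynomial.map_mul, map_monicOfCoeff, map_monicOfCoeff,
      Polynomial.map_map]
    congr 2
    refine MvPolynomial.ringHom_ext (fun a => by simp) fun i => by simp
  have hker : ∀ {K : Type} [CommRing K] (φ : MvPolynomial ι ℤ →+* K),
      U.map (MvPolynomial.map φ) = 0 ↔ ∀ x ∈ 𝔞, φ x = 0 := by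
    intro K _ φ
    have : (∀ x ∈ 𝔞, φ x = 0) ↔ 𝔞 ≤ RingHom.ker φ := Iff.rfl
    rw [this, Ideal.span_le, Set.range_subset_iff]
    simp only [SetLike.mem_coe, RingHom.mem_ker, Prod.forall, Polynomial.ext_iff,
      MvPolynomial.ext_iff, Polynomial.coeff_map, MvPolynomial.coeff_map, Polynomial.coeff_zero,
      MvPolynomial.coeff_zero]
  have : Algebra.FiniteType ℤ (MvPolynomial ι ℤ ⧸ 𝔞) :=
    Algebra.FiniteType.of_surjective (Ideal.Quotient.mkₐ ℤ 𝔞) (Ideal.Quotient.mkₐ_surjective ℤ 𝔞)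
  have : @Algebra.FiniteType ℤ (MvPolynomial ι ℤ ⧸ 𝔞) _ _ (Ring.toIntAlgebra _) := by
    convert this
    · rfl
    · exact Algebra.algebra_ext _ _ fun x => by simp
  have hempty := eventually_isEmpty_ringHom (MvPolynomial ι ℤ ⧸ 𝔞) ⟨fun φ => by
    refine h (fun x => φ (Ideal.Quotient.mk 𝔞 (MvPolynomial.X (Sum.inl x))))
      (fun x => φ (Ideal.Quotient.mk 𝔞 (MvPolynomial.X (Sum.inr x)))) ?_
    rw [← sub_eq_zero]
    refine (hU (φ.comp (Ideal.Quotient.mk 𝔞))).symm.trans ((hker _).mpr fun x hx => ?_)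
    rw [RingHom.comp_apply, Ideal.Quotient.eq_zero_iff_mem.mpr hx, map_zero]⟩
  filter_upwards [hempty] with p hp hpp a b hab
  refine (hp hpp).false (Ideal.Quotient.lift 𝔞
    (MvPolynomial.eval₂Hom (Int.castRingHom (ZMod p)) (Sum.elim a b)) ((hker _).mp ?_))
  rw [hU, sub_eq_zero, ← hab]
  simp

theorem map_finSuccEquiv {K : Type} [CommRing K] {n : ℕ} (φ : R →+* K)
    (f : MvPolynomial (Fin (n + 1)) R) :
    MvPolynomial.finSuccEquiv K n (MvPolynomial.map φ f) =
      (MvPolynomial.finSuccEquiv R n f).map (MvPolynomial.map φ) := by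
  ext i m
  rw [Polynomial.coeff_map, MvPolynomial.coeff_map, MvPolynomial.finSuccEquiv_coeff_coeff,
    MvPolynomial.finSuccEquiv_coeff_coeff, MvPolynomial.coeff_map]

/-- Total degree is additive over a domain. The bound confines the coefficients of all factors to a
finite set of monomials independent of the field. -/
theorem totalDegree_coeff_le_of_dvd {K : Type} [Field K] {n : ℕ}
    {F G : (MvPolynomial (Fin n) K)[X]} (hF : F ≠ 0) (h : G ∣ F) (j : ℕ) :
    (G.coeff j).totalDegree ≤ ((MvPolynomial.finSuccEquiv K n).symm F).totalDegree := by
  obtain ⟨H, rfl⟩ := h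
  by_cases hj : G.coeff j = 0
  · rw [hj, MvPolynomial.totalDegree_zero]; exact Nat.zero_le _
  have hG : (MvPolynomial.finSuccEquiv K n).symm G ≠ 0 := by simpa using left_ne_zero_of_mul hF
  have hH : (MvPolynomial.finSuccEquiv K n).symm H ≠ 0 := by simpa using right_ne_zero_of_mul hF
  have h1 := MvPolynomial.totalDegree_coeff_finSuccEquiv_add_le
    ((MvPolynomial.finSuccEquiv K n).symm G) j
  rw [AlgEquiv.apply_symm_apply] at h1
  rw [map_mul, MvPolynomial.totalDegree_mul_of_isDomain hG hH]
  have := h1 hj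
  lia

theorem totalDegree_map_finSuccEquiv_symm_le {K : Type} [Field K] {n : ℕ} (φ : R →+* K)
    (F : (MvPolynomial (Fin n) R)[X]) :
    ((MvPolynomial.finSuccEquiv K n).symm (F.map (MvPolynomial.map φ))).totalDegree ≤
      ((MvPolynomial.finSuccEquiv R n).symm F).totalDegree := by
  have h : (MvPolynomial.finSuccEquiv K n).symm (F.map (MvPolynomial.map φ)) =
      MvPolynomial.map φ ((MvPolynomial.finSuccEquiv R n).symm F) := by
    rw [AlgEquiv.symm_apply_eq, map_finSuccEquiv, AlgEquiv.apply_symm_apply]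
  rw [h]
  exact Finset.sup_mono (MvPolynomial.support_map_subset _ _)

/-- A monic polynomial over `ℤ[Y]` that is irreducible over `ℚ̄[Y]` is irreducible modulo almost
all primes. -/
theorem eventually_irreducible {n : ℕ} {F : (MvPolynomial (Fin n) ℤ)[X]} (hF : F.Monic)
    (h : Irreducible (F.map (MvPolynomial.map (Int.castRingHom (AlgebraicClosure ℚ))))) :
    ∀ᶠ p : ℕ in atTop, p.Prime →
      Irreducible (F.map (MvPolynomial.map (Int.castRingHom (ZMod p)))) := by
  let s : Finset (Fin n →₀ ℕ) := (Finsupp.finite_of_degree_le (σ := Fin n)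
    ((MvPolynomial.finSuccEquiv ℤ n).symm F).totalDegree).toFinset
  have hs : ∀ {K : Type} [Field K] (G : (MvPolynomial (Fin n) K)[X]),
      G ∣ F.map (MvPolynomial.map (Int.castRingHom K)) → ∀ j, (G.coeff j).support ⊆ s := by
    intro K _ G hG j α hα
    rw [Set.Finite.mem_toFinset]
    exact ((MvPolynomial.le_totalDegree hα).trans (totalDegree_coeff_le_of_dvd
      (hF.map _).ne_zero hG j)).trans (totalDegree_map_finSuccEquiv_symm_le _ F)
  have hdeg : ∀ {K : Type} [Field K],
      (F.map (MvPolynomial.map (Int.castRingHom K))).natDegree = F.natDegree :=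
    hF.natDegree_map _
  have h1 : (F.map (MvPolynomial.map (Int.castRingHom (AlgebraicClosure ℚ)))) ≠ 1 :=
    fun h1 => h.not_isUnit (h1 ▸ isUnit_one)
  have hF0 : F.natDegree ≠ 0 := fun h0 => h1 ((hF.map _).natDegree_eq_zero.mp (hdeg.trans h0))
  replace h := ((hF.map _).irreducible_iff_natDegree.mp h).2
  -- A monic polynomial other than `1` is reducible only through two monic factors of positive
  -- degree, so finitely many degrees `d` have to be excluded.
  have key : ∀ d ∈ Finset.range F.natDegree, ∀ᶠ p : ℕ in atTop, d ≠ 0 → p.Prime →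
      ∀ (a : Fin d × s → ZMod p) (b : Fin (F.natDegree - d) × s → ZMod p),
        monicOfCoeff s d a * monicOfCoeff s (F.natDegree - d) b ≠
          F.map (MvPolynomial.map (Int.castRingHom _)) := by
    intro d hd
    by_cases hd0 : d = 0
    · exact .of_forall fun p h => absurd hd0 h
    filter_upwards [eventually_monicOfCoeff_mul_ne F s d (F.natDegree - d) fun a b hab => by
      rcases h _ _ (monic_monicOfCoeff s d a) (monic_monicOfCoeff s _ b) hab with h | h
      · exact hd0 ((natDegree_monicOfCoeff s d a).symm.trans h)
      · rw [natDegree_monicOfCoeff] at h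
        rw [Finset.mem_range] at hd
        lia] with p hp _ using hp
  filter_upwards [(Filter.eventually_all_finset _).mpr key] with p hp hpp
  have : Fact p.Prime := ⟨hpp⟩
  have h2 : F.map (MvPolynomial.map (Int.castRingHom (ZMod p))) ≠ 1 := fun h2 =>
    hF0 (hdeg.symm.trans (h2 ▸ natDegree_one))
  refine (hF.map _).irreducible_iff_natDegree.mpr ⟨h2, ?_⟩
  intro G H hG hH hGH
  by_contra! hne
  have h3 : G.natDegree + H.natDegree = F.natDegree := by
    rw [← hG.natDegree_mul hH, hGH, hdeg]
  have h4 : H.natDegree = F.natDegree - G.natDegree := by lia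
  refine hp G.natDegree (Finset.mem_range.mpr (by lia)) hne.1 hpp
    (fun x => (G.coeff x.1).coeff x.2) (fun x => (H.coeff x.1).coeff x.2) ?_
  have h5 := eq_monicOfCoeff hH (hs H (Dvd.intro_left G hGH))
  rw [h4] at h5
  rw [← eq_monicOfCoeff hG (hs G (Dvd.intro H hGH)), ← h5, hGH]

end SpreadingOut

end AdjointCurve

/-! ### Absolute irreducibility of the minimal equation -/

namespace AdjointCurve

open Filter Polynomial

section CoefficientwiseMap

variable {σ τ k L : Type} [Field k] [Field L] [Algebra k L] (ℓ : L →ₗ[k] k)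

/-- The application of a linear form to the coefficients of a polynomial. -/
noncomputable def coeffwise : MvPolynomial σ L →ₗ[k] MvPolynomial σ k :=
  (MvPolynomial.basisMonomials σ k).repr.symm.toLinearMap ∘ₗ
    Finsupp.mapRange.linearMap ℓ ∘ₗ
      ((MvPolynomial.basisMonomials σ L).repr.restrictScalars k).toLinearMap

theorem coeff_coeffwise (f : MvPolynomial σ L) (d : σ →₀ ℕ) :
    (coeffwise ℓ f).coeff d = ℓ (f.coeff d) := rfl

theorem coeffwise_mul_map (f : MvPolynomial σ L) (g : MvPolynomial σ k) :
    coeffwise ℓ (f * MvPolynomial.map (algebraMap k L) g) = coeffwise ℓ f * g := by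
  classical
  ext d
  rw [coeff_coeffwise, MvPolynomial.coeff_mul, MvPolynomial.coeff_mul, map_sum]
  refine Finset.sum_congr rfl fun x _ => ?_
  rw [MvPolynomial.coeff_map, mul_comm, ← Algebra.smul_def, map_smul, smul_eq_mul, mul_comm,
    coeff_coeffwise]

theorem coeffwise_monomial (d : σ →₀ ℕ) (c : L) :
    coeffwise ℓ (MvPolynomial.monomial d c) = MvPolynomial.monomial d (ℓ c) := by
  classical
  ext e
  rw [coeff_coeffwise, MvPolynomial.coeff_monomial, MvPolynomial.coeff_monomial]
  split_ifs <;> simp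

/-- Applying a `k`-linear form to coefficients is linear over the polynomials with coefficients in
`k`. The claim is proved for all multiples of `f`, because the map does not respect multiplication
by polynomials over `L`. -/
theorem coeffwise_mem {J : Ideal (MvPolynomial σ k)} {f : MvPolynomial σ L}
    (hf : f ∈ J.map (MvPolynomial.map (algebraMap k L))) : coeffwise ℓ f ∈ J := by
  suffices ∀ a, coeffwise ℓ (a * f) ∈ J by simpa using this 1
  refine Submodule.span_induction (p := fun f _ => ∀ a, coeffwise ℓ (a * f) ∈ J) ?_ ?_ ?_ ?_ hf
  · rintro _ ⟨g, hg, rfl⟩ a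
    rw [coeffwise_mul_map]
    exact J.mul_mem_left _ hg
  · intro a
    rw [mul_zero, map_zero]
    exact zero_mem _
  · intro x y _ _ hx hy a
    rw [mul_add, map_add]
    exact add_mem (hx a) (hy a)
  · intro b x _ hx a
    rw [smul_eq_mul, ← mul_assoc]
    exact hx _

theorem coeffwise_eval₂ (u : τ → MvPolynomial σ k) (g : MvPolynomial τ L) :
    coeffwise ℓ (MvPolynomial.eval₂Hom MvPolynomial.C
      (fun i => MvPolynomial.map (algebraMap k L) (u i)) g) =
    MvPolynomial.eval₂Hom MvPolynomial.C u (coeffwise ℓ g) := by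
  induction g using MvPolynomial.induction_on' with
  | monomial d c =>
    have : ∀ {K : Type} [Field K] (w : τ → MvPolynomial σ K) (c : K),
        MvPolynomial.eval₂Hom MvPolynomial.C w (MvPolynomial.monomial d c) =
          MvPolynomial.C c * d.prod fun i n => w i ^ n :=
      fun w c => MvPolynomial.eval₂_monomial _ _
    rw [coeffwise_monomial, this, this, MvPolynomial.C_apply, MvPolynomial.C_apply,
      ← coeffwise_monomial, ← coeffwise_mul_map]
    simp only [Finsupp.prod, map_prod, map_pow]
  | add p q hp hq => rw [map_add, map_add, hp, hq, map_add, map_add]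

/-- The evaluation of a polynomial in one variable, with polynomial coefficients. -/
noncomputable def polyEval {R A : Type} [CommRing R] [CommRing A] (φ : R →+* A) (u : τ → A) (v : A) :
    (MvPolynomial τ R)[X] →+* A :=
  eval₂RingHom (MvPolynomial.eval₂Hom φ u) v

theorem polyEval_map {R A B K : Type} [CommRing R] [CommRing A] [CommRing B] [CommRing K]
    (φ : R →+* A) (ψ : K →+* B) (α : R →+* K) (β : A →+* B) (h : ψ.comp α = β.comp φ) (u : τ → A)
    (v : A) (F : (MvPolynomial τ R)[X]) :
    polyEval ψ (β ∘ u) (β v) (F.map (MvPolynomial.map α)) = β (polyEval φ u v F) := by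
  have h1 : ((polyEval ψ (β ∘ u) (β v)).comp (mapRingHom (MvPolynomial.map α))) =
      β.comp (polyEval φ u v) := by
    refine Polynomial.ringHom_ext (fun a => ?_) (by simp [polyEval])
    have h2 : (MvPolynomial.eval₂Hom ψ (β ∘ u)).comp (MvPolynomial.map α) =
        β.comp (MvPolynomial.eval₂Hom φ u) :=
      MvPolynomial.ringHom_ext (fun r => by simpa using RingHom.congr_fun h r) fun i => by simp
    simpa only [polyEval, RingHom.comp_apply, coe_mapRingHom, map_C, coe_eval₂RingHom, eval₂_C]
      using RingHom.congr_fun h2 a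
  exact RingHom.congr_fun h1 F

/-- Descent of an equation from `L` to `k`: with `ℓ 1 = 1` the leading coefficient of the monic `G`
stays `1`, so the image is nonzero and of no larger degree. -/
theorem exists_monic_polyEval_mem (hℓ : ℓ 1 = 1) {J : Ideal (MvPolynomial σ k)}
    {u : τ → MvPolynomial σ k} {v : MvPolynomial σ k} {G : (MvPolynomial τ L)[X]} (hG : G.Monic)
    (h : polyEval MvPolynomial.C (MvPolynomial.map (algebraMap k L) ∘ u)
      (MvPolynomial.map (algebraMap k L) v) G ∈ J.map (MvPolynomial.map (algebraMap k L))) :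
    ∃ Q : (MvPolynomial τ k)[X], Q ≠ 0 ∧ Q.natDegree ≤ G.natDegree ∧
      polyEval MvPolynomial.C u v Q ∈ J := by
  refine ⟨∑ j ∈ Finset.range (G.natDegree + 1), C (coeffwise ℓ (G.coeff j)) * X ^ j, ?_, ?_, ?_⟩
  · intro h0
    have h1 := congrArg (fun Q => Q.coeff G.natDegree) h0
    simp only [finsetSum_coeff, coeff_C_mul, coeff_X_pow, coeff_zero, mul_ite, mul_one, mul_zero,
      Finset.sum_ite_eq, Finset.mem_range, Nat.lt_succ_self, if_true, hG.coeff_natDegree] at h1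
    have h2 : coeffwise ℓ (1 : MvPolynomial τ L) = 1 := by
      rw [← MvPolynomial.C_1, MvPolynomial.C_apply, coeffwise_monomial, hℓ]; rfl
    exact one_ne_zero (h2.symm.trans h1)
  · refine natDegree_sum_le_of_forall_le _ _ fun j hj => ?_
    exact (natDegree_C_mul_X_pow_le _ _).trans (Nat.lt_succ_iff.mp (Finset.mem_range.mp hj))
  · have h1 := coeffwise_mem ℓ h
    have h2 : coeffwise ℓ (polyEval MvPolynomial.C (MvPolynomial.map (algebraMap k L) ∘ u)
        (MvPolynomial.map (algebraMap k L) v) G) = polyEval MvPolynomial.C u v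
          (∑ j ∈ Finset.range (G.natDegree + 1), C (coeffwise ℓ (G.coeff j)) * X ^ j) := by
      conv_lhs => rw [G.as_sum_range_C_mul_X_pow]
      rw [map_sum, map_sum, map_sum]
      refine Finset.sum_congr rfl fun j _ => ?_
      simp only [polyEval, map_mul, map_pow, coe_eval₂RingHom, eval₂_C, eval₂_X]
      rw [← map_pow, coeffwise_mul_map, ← coeffwise_eval₂]
      rfl
    rwa [h2] at h1

end CoefficientwiseMap

theorem exists_polynomial_map_eq {τ : Type} (Q : (MvPolynomial τ ℚ)[X]) :
    ∃ n : ℕ, n ≠ 0 ∧ ∃ P : (MvPolynomial τ ℤ)[X],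
      P.map (MvPolynomial.map (Int.castRingHom ℚ)) = n * Q := by
  induction Q using Polynomial.induction_on' with
  | add f g hf hg =>
    obtain ⟨n, hn, F, hF⟩ := hf
    obtain ⟨m, hm, G, hG⟩ := hg
    refine ⟨n * m, mul_ne_zero hn hm, m * F + n * G, ?_⟩
    simp only [Polynomial.map_add, Polynomial.map_mul, Polynomial.map_natCast, hF, hG]
    push_cast
    ring
  | monomial j a =>
    obtain ⟨n, hn, A, hA⟩ := exists_mvPolynomial_map_eq a
    refine ⟨n, hn, monomial j A, ?_⟩
    rw [map_monomial, hA, ← C_mul_X_pow_eq_monomial, ← C_mul_X_pow_eq_monomial, map_mul,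
      map_natCast, mul_assoc]

theorem natDegree_map_intCast {τ : Type} (P : (MvPolynomial τ ℤ)[X]) :
    (P.map (MvPolynomial.map (Int.castRingHom ℚ))).natDegree = P.natDegree :=
  natDegree_map_eq_of_injective (MvPolynomial.map_injective _ Int.cast_injective) P

/-- The minimal equation of an element of the coordinate ring of a geometrically integral affine
variety over a Noether normalization is irreducible over `ℚ̄`. -/
theorem irreducible_map_of_minimal {σ τ : Type} {J : Ideal (MvPolynomial σ ℚ)}
    (hJ : (J.map (MvPolynomial.map (algebraMap ℚ (AlgebraicClosure ℚ)))).IsPrime)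
    {u : τ → MvPolynomial σ ℚ} {v : MvPolynomial σ ℚ} {F : (MvPolynomial τ ℤ)[X]} (hF : F.Monic)
    (hF1 : F ≠ 1) (hFJ : polyEval (Int.castRingHom _) u v F ∈ J)
    (hmin : ∀ P : (MvPolynomial τ ℤ)[X], P ≠ 0 → polyEval (Int.castRingHom _) u v P ∈ J →
      F.natDegree ≤ P.natDegree) :
    Irreducible (F.map (MvPolynomial.map (Int.castRingHom (AlgebraicClosure ℚ)))) := by
  obtain ⟨ℓ, hℓ⟩ : ∃ ℓ : AlgebraicClosure ℚ →ₗ[ℚ] ℚ, ℓ 1 = 1 := by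
    obtain ⟨ℓ, hℓ⟩ := (Algebra.linearMap ℚ (AlgebraicClosure ℚ)).exists_leftInverse_of_injective
      (LinearMap.ker_eq_bot.mpr (algebraMap ℚ (AlgebraicClosure ℚ)).injective)
    exact ⟨ℓ, by simpa using LinearMap.congr_fun hℓ 1⟩
  have hdeg : (F.map (MvPolynomial.map (Int.castRingHom (AlgebraicClosure ℚ)))).natDegree =
    F.natDegree := hF.natDegree_map _
  refine (hF.map _).irreducible_iff_natDegree.mpr ⟨fun h => hF1 ?_, fun G H hG hH hGH => ?_⟩
  · exact hF.natDegree_eq_zero.mp (by rw [← hdeg, h, natDegree_one])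
  -- An equation over `ℚ̄` descends to ℤ without increase of degree, so its degree is at least that
  -- of `F`. As the extended ideal is prime, one factor of `F` is such an equation, and the other
  -- has degree zero.
  have key : ∀ G : (MvPolynomial τ (AlgebraicClosure ℚ))[X], G.Monic →
      polyEval MvPolynomial.C (MvPolynomial.map (algebraMap ℚ (AlgebraicClosure ℚ)) ∘ u)
        (MvPolynomial.map (algebraMap ℚ (AlgebraicClosure ℚ)) v) G ∈
          J.map (MvPolynomial.map (algebraMap ℚ (AlgebraicClosure ℚ))) →
      F.natDegree ≤ G.natDegree := by
    intro G hG h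
    obtain ⟨Q, hQ0, hQG, hQ⟩ := exists_monic_polyEval_mem ℓ hℓ hG h
    obtain ⟨n, hn, P, hP⟩ := exists_polynomial_map_eq Q
    have h1 := polyEval_map (Int.castRingHom _) MvPolynomial.C (Int.castRingHom ℚ)
      (RingHom.id (MvPolynomial σ ℚ)) (RingHom.ext_int _ _) u v P
    have hn' : (n : (MvPolynomial τ ℚ)[X]) ≠ 0 := Nat.cast_ne_zero.mpr hn
    refine (hmin P (fun h0 => ?_) ?_).trans (le_trans (Eq.le ?_) hQG)
    · rw [h0, Polynomial.map_zero] at hP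
      exact mul_ne_zero hn' hQ0 hP.symm
    · rw [hP] at h1
      change _ = polyEval _ u v P at h1
      rw [← h1, map_mul]
      exact J.mul_mem_left _ hQ
    · rw [← natDegree_map_intCast, hP, natDegree_mul hn' hQ0, natDegree_natCast, zero_add]
  have h1 := polyEval_map (Int.castRingHom _) MvPolynomial.C (Int.castRingHom (AlgebraicClosure ℚ))
    (MvPolynomial.map (σ := σ) (algebraMap ℚ (AlgebraicClosure ℚ))) (RingHom.ext_int _ _) u v F
  rw [← hGH, map_mul] at h1
  have h2 := h1 ▸ Ideal.mem_map_of_mem (MvPolynomial.map (algebraMap ℚ (AlgebraicClosure ℚ))) hFJ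
  have h3 : G.natDegree + H.natDegree = F.natDegree := by
    rw [← hG.natDegree_mul hH, hGH, hdeg]
  rcases hJ.mem_or_mem h2 with h | h
  · have := key G hG h
    right; lia
  · have := key H hH h
    left; lia

end AdjointCurve

/-! ### Integral reductions of geometrically integral varieties -/

namespace AdjointCurve

open Filter Polynomial

theorem natCast_dvd_iff_map_eq_zero {τ : Type} {p : ℕ} {f : MvPolynomial τ ℤ} :
    (p : MvPolynomial τ ℤ) ∣ f ↔ MvPolynomial.map (Int.castRingHom (ZMod p)) f = 0 := by
  rw [← MvPolynomial.C_dvd_iff_zmod, map_natCast]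

theorem natCast_dvd_iff_polynomial_map_eq_zero {τ : Type} {p : ℕ} {f : (MvPolynomial τ ℤ)[X]} :
    (p : (MvPolynomial τ ℤ)[X]) ∣ f ↔
      f.map (MvPolynomial.map (Int.castRingHom (ZMod p))) = 0 := by
  rw [← map_natCast (C : MvPolynomial τ ℤ →+* _), C_dvd_iff_dvd_coeff]
  simp only [natCast_dvd_iff_map_eq_zero, Polynomial.ext_iff, coeff_map, coeff_zero]

/-- An irreducible polynomial over `𝔽_p[Y]` generates a prime ideal. -/
theorem exists_eq_mul_add_of_irreducible {τ : Type} {p : ℕ} (hp : p.Prime)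
    {F : (MvPolynomial τ ℤ)[X]}
    (hF : Irreducible (F.map (MvPolynomial.map (Int.castRingHom (ZMod p)))))
    {a b q e : (MvPolynomial τ ℤ)[X]} (h : a * b = F * q + p * e) :
    (∃ q e, a = F * q + p * e) ∨ ∃ q e, b = F * q + p * e := by
  have : Fact p.Prime := ⟨hp⟩
  have hsurj : Function.Surjective
      (Polynomial.map (MvPolynomial.map (σ := τ) (Int.castRingHom (ZMod p)))) :=
    Polynomial.map_surjective _ (MvPolynomial.map_surjective _ (ZMod.ringHom_surjective _))
  have key : ∀ a : (MvPolynomial τ ℤ)[X],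
      F.map (MvPolynomial.map (Int.castRingHom (ZMod p))) ∣
        a.map (MvPolynomial.map (Int.castRingHom (ZMod p))) → ∃ q e, a = F * q + p * e := by
    rintro a ⟨c, hc⟩
    obtain ⟨q, rfl⟩ := hsurj c
    obtain ⟨e, he⟩ := natCast_dvd_iff_polynomial_map_eq_zero.mpr (show (a - F * q).map
      (MvPolynomial.map (Int.castRingHom (ZMod p))) = 0 by
        rw [Polynomial.map_sub, Polynomial.map_mul, hc, sub_self])
    exact ⟨q, e, by rw [← he]; ring⟩
  refine (hF.prime.dvd_or_dvd ?_).imp (key a) (key b)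
  refine ⟨q.map (MvPolynomial.map (Int.castRingHom (ZMod p))), ?_⟩
  rw [← Polynomial.map_mul, h, Polynomial.map_add, Polynomial.map_mul,
    natCast_dvd_iff_polynomial_map_eq_zero.mp (Dvd.intro e rfl), add_zero]

/-- Noether normalization modulo `p`. -/
theorem isDomain_and_ringKrullDim_eq {n p : ℕ} [Fact p.Prime] {S B : Type} [CommRing S] [IsDomain S]
    [Algebra (MvPolynomial (Fin n) ℤ) S] [Algebra.IsIntegral (MvPolynomial (Fin n) ℤ) S]
    [FaithfulSMul (MvPolynomial (Fin n) ℤ) S] [CommRing B] [Algebra (ZMod p) B] (π : S →+* B)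
    (hπ : Function.Surjective π) (hker : ∀ s, π s = 0 ↔ (p : S) ∣ s)
    (hp : ∀ s t : S, (p : S) ∣ s * t → (p : S) ∣ s ∨ (p : S) ∣ t) :
    IsDomain B ∧ ringKrullDim B = n := by
  -- As `ℤ[Y]` is normal, `p ∣ f` in `S` already holds in `ℤ[Y]`. Hence `𝔽_p[Y] → B` is injective,
  -- which gives nontriviality and the dimension.
  have hker' : ∀ f : MvPolynomial (Fin n) ℤ, π (algebraMap _ S f) = 0 →
      MvPolynomial.map (Int.castRingHom (ZMod p)) f = 0 := by
    intro f hf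
    rw [← natCast_dvd_iff_map_eq_zero]
    refine dvd_of_algebraMap_dvd (S := S) ?_
    rw [map_natCast]
    exact (hker _).mp hf
  have hnt : Nontrivial B := by
    by_contra h
    rw [not_nontrivial_iff_subsingleton] at h
    have h1 := hker' 1 (Subsingleton.elim _ _)
    rw [map_one] at h1
    exact one_ne_zero h1
  have hnzd : NoZeroDivisors B := by
    refine ⟨fun {a b : B} hab => ?_⟩
    obtain ⟨s, rfl⟩ := hπ a
    obtain ⟨t, rfl⟩ := hπ b
    rw [← map_mul] at hab
    exact (hp s t ((hker _).mp hab)).imp (hker s).mpr (hker t).mpr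
  have hB : IsDomain B := NoZeroDivisors.to_isDomain B
  refine ⟨hB, ?_⟩
  let gp : MvPolynomial (Fin n) (ZMod p) →ₐ[ZMod p] B :=
    MvPolynomial.aeval fun i => π (algebraMap (MvPolynomial (Fin n) ℤ) S (MvPolynomial.X i))
  have hgp : gp.toRingHom.comp (MvPolynomial.map (Int.castRingHom (ZMod p))) =
      π.comp (algebraMap _ S) :=
    MvPolynomial.ringHom_ext (fun a => by simp [gp]) fun i => by simp [gp]
  have hmap : Function.Surjective
      (MvPolynomial.map (σ := Fin n) (Int.castRingHom (ZMod p))) :=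
    MvPolynomial.map_surjective _ (ZMod.ringHom_surjective _)
  refine ringKrullDim_eq_of_noether gp ?_ fun a => ?_
  · rw [injective_iff_map_eq_zero]
    intro f hf
    obtain ⟨f, rfl⟩ := hmap f
    exact hker' f ((RingHom.congr_fun hgp f).symm.trans hf)
  · obtain ⟨s, rfl⟩ := hπ a
    obtain ⟨P, hP, hPs⟩ := Algebra.IsIntegral.isIntegral (R := MvPolynomial (Fin n) ℤ) s
    refine ⟨P.map (MvPolynomial.map (Int.castRingHom (ZMod p))), hP.map _, ?_⟩
    rw [eval₂_map, hgp, ← hom_eval₂, hPs, map_zero]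

set_option maxHeartbeats 1600000 in
/-- Geometrically integral affine varieties have integral reductions of the same dimension for
almost all primes. -/
theorem eventually_isPrime_reduction {σ : Type} [Finite σ] {J : Ideal (MvPolynomial σ ℚ)}
    [hJ : J.IsPrime]
    (hgeom : (J.map (MvPolynomial.map (algebraMap ℚ (AlgebraicClosure ℚ)))).IsPrime) {n : ℕ}
    (g : MvPolynomial (Fin n) ℚ →ₐ[ℚ] MvPolynomial σ ℚ ⧸ J) (hg : Function.Injective g)
    (hint : g.toRingHom.IsIntegral) :
    ∀ᶠ p : ℕ in atTop, p.Prime → (reduction p J).IsPrime ∧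
      ringKrullDim (MvPolynomial σ (ZMod p) ⧸ reduction p J) = n := by
  obtain ⟨u, N, hN0, hinj, hi⟩ := exists_integral_model J g hg hint
  let A := MvPolynomial σ ℚ ⧸ J
  let Λ := MvPolynomial (Fin n) ℤ
  let γ : Λ →+* A := MvPolynomial.eval₂Hom (Int.castRingHom A) fun i => intEval J (u i)
  let _ : Algebra Λ A := γ.toAlgebra
  have : FaithfulSMul Λ A := (faithfulSMul_iff_algebraMap_injective _ _).mpr hinj
  let S : Subalgebra Λ A :=
    Algebra.adjoin Λ (Set.range fun i => (N : A) * intEval J (MvPolynomial.X i))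
  have : Module.Finite Λ S := by
    refine Algebra.finite_adjoin_of_finite_of_isIntegral (Set.finite_range _) ?_
    rintro _ ⟨i, rfl⟩
    exact hi i
  have hγ : ∀ f : Λ, γ f = intEval J (MvPolynomial.eval₂Hom (Int.castRingHom _) u f) := by
    have : γ = (intEval J).comp (MvPolynomial.eval₂Hom (Int.castRingHom _) u) :=
      MvPolynomial.ringHom_ext (fun a => by simp [γ]) fun i => by simp [γ]
    exact RingHom.congr_fun this
  have hSle : S.toSubring ≤ (intEval J).range := by
    change ∀ x ∈ S, x ∈ (intEval J).range
    intro x hx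
    induction hx using Algebra.adjoin_induction with
    | mem x hx =>
      obtain ⟨i, rfl⟩ := hx
      exact ⟨(N : MvPolynomial σ ℤ) * MvPolynomial.X i, by rw [map_mul, map_natCast]⟩
    | algebraMap f => exact ⟨_, (hγ f).symm⟩
    | add x y _ _ hx hy => exact add_mem hx hy
    | mul x y _ _ hx hy => exact mul_mem hx hy
  have hNS : ∀ i, (N : A) * intEval J (MvPolynomial.X i) ∈ S.toSubring :=
    fun i => Algebra.subset_adjoin ⟨i, rfl⟩
  obtain ⟨y, hy⟩ := exists_adjoin_eq_top Λ S
  have hyint : IsIntegral Λ y := Algebra.IsIntegral.isIntegral y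
  obtain ⟨v, hv⟩ := hSle y.2
  -- With `v` an integral lift of `y`, an equation of `v` modulo `J` is the same as an equation of
  -- `y`; thus the minimal polynomial of `y` is a minimal equation modulo `J`.
  have hmem : ∀ P : Λ[X], polyEval (Int.castRingHom (MvPolynomial σ ℚ))
      (fun i => MvPolynomial.map (Int.castRingHom ℚ) (u i))
      (MvPolynomial.map (Int.castRingHom ℚ) v) P ∈ J ↔ aeval y P = 0 := by
    intro P
    have h1 := polyEval_map (Int.castRingHom (MvPolynomial σ ℚ)) (Int.castRingHom A)
      (RingHom.id ℤ) (Ideal.Quotient.mk J) (RingHom.ext_int _ _)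
      (fun i => MvPolynomial.map (Int.castRingHom ℚ) (u i))
      (MvPolynomial.map (Int.castRingHom ℚ) v) P
    rw [show MvPolynomial.map (RingHom.id ℤ) = RingHom.id Λ from
      RingHom.ext fun f => MvPolynomial.map_id f, Polynomial.map_id] at h1
    have h2 : ((aeval y P : S) : A) = aeval (y : A) P := (Polynomial.aeval_algHom_apply S.val y P).symm
    rw [← Ideal.Quotient.eq_zero_iff_mem, ← h1, ← ZeroMemClass.coe_eq_zero, h2, ← hv]
    rfl
  have hirr := irreducible_map_of_minimal (F := minpoly Λ y) hgeom (minpoly.monic hyint)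
    (fun h => (minpoly.natDegree_pos hyint).ne' (by rw [h, natDegree_one]))
    ((hmem _).mpr (minpoly.aeval Λ y)) fun P hP0 hP => natDegree_le_natDegree
      (minpoly.IsIntegrallyClosed.degree_le_of_ne_zero hP0 ((hmem P).mp hP))
  have hdvd := eventually_dvd_or_dvd hy ((eventually_irreducible (minpoly.monic hyint) hirr).mono
    fun p hp hpp a b q e h => exists_eq_mul_add_of_irreducible hpp (hp hpp) h)
  filter_upwards [hdvd, eventually_gt_atTop N] with p hp hpN hpp
  have hpN' : ¬ p ∣ N := fun h => by have := Nat.le_of_dvd (Nat.pos_of_ne_zero hN0) h; lia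
  have := Fact.mk hpp
  obtain ⟨π, hπ, hker, hπe⟩ := exists_reductionHom hSle hNS hpp hpN'
  replace hker : ∀ s : S, π s = 0 ↔ (p : S) ∣ s := by
    intro s
    rw [← Ideal.mem_span_singleton]
    exact Ideal.ext_iff.mp hker s
  have h1 := isDomain_and_ringKrullDim_eq (S := S) (n := n) π hπ hker (hp hpp)
  exact ⟨(Ideal.Quotient.isDomain_iff_prime _).mp h1.1, h1.2⟩

end AdjointCurve

/-! ### Reductions of geometrically integral curves and the conclusion -/

namespace AdjointCurve

open Filter MvPolynomial

attribute [local instance] MvPolynomial.gradedAlgebra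

/-- Reductions of non-degenerate projective varieties are non-degenerate. -/
theorem reduction_nondegenerate {σ : Type} {J : Ideal (MvPolynomial σ ℚ)}
    (hJ : J.IsHomogeneous (homogeneousSubmodule σ ℚ))
    (h : ∀ l ∈ J, l.IsHomogeneous 1 → l = 0) (p : ℕ) :
    ∀ l ∈ reduction p J, l.IsHomogeneous 1 → l = 0 := by
  intro l hl hl1
  obtain ⟨F, hF, rfl⟩ := mem_reduction_iff.mp hl
  have h1 : homogeneousComponent 1 (MvPolynomial.map (Int.castRingHom ℚ) F) ∈ J :=
    decomposition.decompose'_apply (MvPolynomial.map (Int.castRingHom ℚ) F) 1 ▸ hJ 1 hF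
  have h2 := h _ h1 (homogeneousComponent_isHomogeneous 1 _)
  rw [map_homogeneousComponent] at h2
  have h3 : homogeneousComponent 1 F = 0 :=
    MvPolynomial.map_injective _ Int.cast_injective (h2.trans (_root_.map_zero _).symm)
  have h4 := map_homogeneousComponent (Int.castRingHom (ZMod p)) 1 F
  rwa [h3, _root_.map_zero, homogeneousComponent_of_mem ((mem_homogeneousSubmodule _ _).mpr hl1),
    if_pos rfl] at h4

/-- A geometrically integral curve has an integral and non-degenerate reduction for almost all
primes. -/
theorem IsCurveIdeal.eventually_isCurveIdeal_reduction {r : ℕ}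
    {I : Ideal (MvPolynomial (Fin (r + 1)) ℚ)} (hI : IsCurveIdeal I)
    (hgeom : IsGeometricallyIntegral I) :
    ∀ᶠ p : ℕ in atTop, ∀ [Fact p.Prime], IsCurveIdeal (reduction p I) := by
  have := hI.isPrime
  -- The affine variety used here is the cone over `Γ`, so primality and dimension two of the
  -- reduced homogeneous ideal come out directly.
  obtain ⟨n, g, hg, hint⟩ := exists_integral_inj_algHom_of_fg ℚ (MvPolynomial (Fin (r + 1)) ℚ ⧸ I)
  have hn := (ringKrullDim_eq_of_noether g hg hint).symm.trans hI.ringKrullDim_eq_two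
  filter_upwards [eventually_isPrime_reduction hgeom g hg hint] with p hp hpp
  obtain ⟨h1, h2⟩ := hp hpp.out
  exact ⟨reduction_isHomogeneous hI.isHomogeneous, h1, h2.trans hn,
    reduction_nondegenerate hI.isHomogeneous hI.nondegenerate p⟩

end AdjointCurve

/-- All but finitely many of the primes `p` for which `I(Γ)_p` is the ideal of an integral,
non-degenerate curve `Γ_p` are lucky; and if `Γ` is geometrically integral, then all but finitely
many primes have both properties. -/
theorem mainTheorem7 {r : ℕ} (m : MonomialOrder (Fin (r + 1)))
    (I : Ideal (MvPolynomial (Fin (r + 1)) ℚ)) (hI : AdjointCurve.IsCurveIdeal I) :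
    {p : ℕ | ∃ _ : Fact p.Prime, AdjointCurve.IsCurveIdeal (AdjointCurve.reduction p I) ∧
      ¬ AdjointCurve.IsLucky m I p}.Finite ∧
    (AdjointCurve.IsGeometricallyIntegral I →
      {p : ℕ | ∃ _ : Fact p.Prime, ¬ (AdjointCurve.IsCurveIdeal (AdjointCurve.reduction p I) ∧
        AdjointCurve.IsLucky m I p)}.Finite) := by
  have h1 := hI.eventually_isLucky m
  refine ⟨?_, fun hgeom => ?_⟩
  · rw [← Nat.cofinite_eq_atTop, Filter.eventually_cofinite] at h1
    refine h1.subset ?_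
    rintro p ⟨hp, hc, hl⟩ h
    exact hl (h hc)
  · have h2 := h1.and (hI.eventually_isCurveIdeal_reduction hgeom)
    rw [← Nat.cofinite_eq_atTop, Filter.eventually_cofinite] at h2
    refine h2.subset ?_
    rintro p ⟨hp, hn⟩ ⟨h3, h4⟩
    exact hn ⟨h4, h3 h4⟩
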